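/- Let $n\ge 1$, $\beta>0$, and let $T$ be the random $n\times n$ tridiagonal matrix with diagonal $a_n,\dots,a_1$ (from top to bottom), superdiagonal $1,\dots,1$ and subdiagonal $b_{n-1},\dots,b_1$, whose entries $a_j,b_j$ are independent, with $\operatorname{Re}a_j,\operatorname{Im}a_j\sim\mathcal N(0,1)$ independent, and $|b_j|\sim\chi_{\beta j/2}$ and $\arg b_j\sim\mathcal U(0,2\pi)$ independent. *Eigenvector parameters.* Consider a matrix $T$ of this form with all $b_j\neq0$ and distinct eigenvalues $\lambda=(\lambda_1,\dots,\lambda_n)$, listed in some order, and write $T=R\Lambda R^{-1}$ with $\Lambda=\mathrm{diag}(\lambda)$ and $R$ normalized so that the first column of $R^{-1}$ is $(1,\dots,1)^t$. Let $r=(r_1,\dots,r_n)$ be the first row of $R$; then $r_1+\dots+r_n=1$. The vector $r$ exists and is unique, and $(\lambda,r)$ determines $T=T(\lambda,r)$ through the three-term recurrences $TR=R\Lambda$, $R^{-1}T=\Lambda R^{-1}$. Call such pairs $(\lambda,r)$ admissible. For every $\lambda$ with distinct entries, almost every $(r_1,\dots,r_{n-1})\in\mathbb C^{n-1}$, with $r_n=1-r_1-\dots-r_{n-1}$,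 gives an admissible pair. Put $$g(\lambda,r)=\tfrac12\Big(\|T(\lambda,r)\|_{\mathrm F}^2-\sum_{j=1}^n|\lambda_j|^2\Big).$$ *Density.* The joint probability density function of the (unordered) eigenvalues of $T$, with respect to Lebesgue measure on $\mathbb C^n$, is $$P_\beta(\lambda)=\frac1{Z_\beta}\prod_{j=1}^n e^{-|\lambda_j|^2/2}\prod_{1\le j<k\le n}|\lambda_k-\lambda_j|^{\beta}\,f(\lambda),$$ where $0<Z_\beta<\infty$ is a normalization constant depending only on $n$ and $\beta$, and $$f(\lambda)=\int_{\mathbb C^{n-1}}e^{-g(\lambda,r)}\prod_{k=1}^n|r_k|^{\beta/2-1}\,d\mu(r),\qquad d\mu(r)=\frac{1}{|r_n|}\prod_{k=1}^{n-1}d|r_k|\,d\phi_{r_k},$$ with $r_n=1-r_1-\dots-r_{n-1}$ and $r_k=|r_k|e^{i\phi_{r_k}}$; equivalently, $d\mu$ is $\prod_{k=1}^n|r_k|^{-1}$ times Lebesgue measure on $\mathbb C^{n-1}$. The integral converges whenever the $\lambda_j$ are distinct. *Properties of $g$.* On admissible pairs, $g$ is a rational function of the real and imaginary parts of the $\lambda_j$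 and $r_j$ (with a denominator that does not vanish there); $g\ge0$, with $g(\lambda,r)=0$ exactly when $T(\lambda,r)$ is a normal matrix; for each $j$, with $r$ and the other eigenvalues fixed, $g(\lambda,r)=O(|\lambda_j|^4)$ as $\lambda_j\to\infty$; and $g(e^{i\phi}\lambda,r)=g(\lambda,r)$ for all real $\phi$. -/

import Mathlib

open MeasureTheory ProbabilityTheory
open scoped Asymptotics

noncomputable section

namespace ComplexBeta

/-- The tridiagonal matrix of size `n = m + 1` with diagonal `a_n, …, a_1` (from top to bottom),
superdiagonal `1, …, 1` and subdiagonal `b_{n-1}, …, b_1`. Here `a k` and `b k` stand for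
`a_{k+1}` and `b_{k+1}`. -/
def tridiag {m : ℕ} (a : Fin (m + 1) → ℂ) (b : Fin m → ℂ) :
    Matrix (Fin (m + 1)) (Fin (m + 1)) ℂ :=
  Matrix.of fun i j =>
    if i = j then a (Fin.rev i)
    else if i.1 + 1 = j.1 then 1
    else if h : j.1 + 1 = i.1 then b (Fin.rev ⟨j.1, by omega⟩)
    else 0

/-! ### The distribution of the matrix entries -/

/-- Law of a complex number with independent standard normal real and imaginary parts. -/
def complexGaussian : Measure ℂ :=
  ((gaussianReal 0 1).prod (gaussianReal 0 1)).map fun p => (⟨p.1, p.2⟩ : ℂ)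

/-- Density of the chi distribution with parameter `α`. -/
def chiPDF (α x : ℝ) : ℝ :=
  if 0 ≤ x then
    2 ^ (1 - α / 2) / Real.Gamma (α / 2) * Real.exp (-x ^ 2 / 2) * x ^ (α - 1)
  else 0

/-- The chi distribution with parameter `α`. -/
def chiLaw (α : ℝ) : Measure ℝ :=
  volume.withDensity fun x => ENNReal.ofReal (chiPDF α x)

/-- Law of `ρ e^{iθ}` with `ρ ∼ χ_α` and `θ` uniform on `[0, 2π)`, independent. -/
def subdiagLaw (α : ℝ) : Measure ℂ :=
  ((chiLaw α).prod (cond volume (Set.Ico 0 (2 * Real.pi)))).map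
    fun p => (p.1 : ℂ) * Complex.exp ((p.2 : ℂ) * Complex.I)

/-! ### Spectral parameters -/

/-- `(lam, r)` are spectral parameters of `T`: the `lam k` are distinct, and `T = R Λ R⁻¹` with
`Λ = diag(lam)`, where the first row of `R` is `r` and the first column of `R⁻¹` is `(1, …, 1)`.
In particular the `r k` are the first components of the right eigenvectors, with sum `1`. -/
def IsSpectralData {m : ℕ} (T : Matrix (Fin (m + 1)) (Fin (m + 1)) ℂ)
    (lam r : Fin (m + 1) → ℂ) : Prop :=
  Function.Injective lam ∧
    ∃ R : Matrix (Fin (m + 1)) (Fin (m + 1)) ℂ, IsUnit R.det ∧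
      T = R * Matrix.diagonal lam * R⁻¹ ∧ (∀ k, R 0 k = r k) ∧ ∀ k, R⁻¹ k 0 = 1

/-- `(lam, r)` are the spectral parameters of some matrix of the model with nonzero subdiagonal. -/
def Admissible {m : ℕ} (lam r : Fin (m + 1) → ℂ) : Prop :=
  ∃ (a : Fin (m + 1) → ℂ) (b : Fin m → ℂ), (∀ j, b j ≠ 0) ∧ IsSpectralData (tridiag a b) lam r

/-- Two consecutive rows of `R`, two consecutive columns of `R⁻¹`, and the subdiagonal entry
linking them. -/
structure RecState (n : ℕ) where
  /-- the previous row of `R` -/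
  rPrev : Fin n → ℂ
  /-- the current row of `R` -/
  rCur : Fin n → ℂ
  /-- the previous column of `R⁻¹` -/
  lPrev : Fin n → ℂ
  /-- the current column of `R⁻¹` -/
  lCur : Fin n → ℂ
  /-- the subdiagonal entry in the current row -/
  sub : ℂ

/-- The diagonal entry in the current row. -/
def RecState.diag {n : ℕ} (s : RecState n) (lam : Fin n → ℂ) : ℂ :=
  ∑ k, s.rCur k * lam k * s.lCur k

/-- One step of the three-term recurrences `T R = R Λ`, `R⁻¹ T = Λ R⁻¹`. -/
def RecState.next {n : ℕ} (s : RecState n) (lam : Fin n → ℂ) : RecState n :=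
  let r' : Fin n → ℂ := fun k => s.rCur k * lam k - s.diag lam * s.rCur k - s.sub * s.rPrev k
  let b' : ℂ := ∑ k, r' k * lam k * s.lCur k
  { rPrev := s.rCur
    rCur := r'
    lPrev := s.lCur
    lCur := fun k => (lam k * s.lCur k - s.diag lam * s.lCur k - s.lPrev k) / b'
    sub := b' }

/-- The state of the recurrence in row `j` (counted from `0`), started from the first row `r` of
`R` and the first column `(1, …, 1)` of `R⁻¹`. -/
def recState {n : ℕ} (lam r : Fin n → ℂ) : ℕ → RecState n
  | 0 => { rPrev := 0, rCur := r, lPrev := 0, lCur := 1, sub := 0 }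
  | j + 1 => (recState lam r j).next lam

/-- The tridiagonal matrix reconstructed from its spectral parameters. -/
def reconstruct {m : ℕ} (lam r : Fin (m + 1) → ℂ) : Matrix (Fin (m + 1)) (Fin (m + 1)) ℂ :=
  tridiag (fun k => (recState lam r (Fin.rev k).1).diag lam)
    (fun k => (recState lam r ((Fin.rev k).1 + 1)).sub)

/-- The exponent `g`: half of the difference between the squared Frobenius norm of the matrix and
the sum of the squared moduli of its eigenvalues (half of the squared norm of the strictly upper
triangular part in a Schur decomposition). -/
def g {m : ℕ} (lam r : Fin (m + 1) → ℂ) : ℝ :=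
  ((∑ i, ∑ j, ‖reconstruct lam r i j‖ ^ 2) - ∑ j, ‖lam j‖ ^ 2) / 2

/-- Real coordinates of `(lam, r)`: real and imaginary parts. -/
def realCoords {m : ℕ} (lam r : Fin (m + 1) → ℂ) : Fin 4 × Fin (m + 1) → ℝ := fun p =>
  ![(lam p.2).re, (lam p.2).im, (r p.2).re, (r p.2).im] p.1

/-! ### The eigenvalue density -/

/-- The vector `(r_1, …, r_n)` with `r_n = 1 - r_1 - ⋯ - r_{n-1}`. -/
def complete {m : ℕ} (r : Fin m → ℂ) : Fin (m + 1) → ℂ :=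
  Fin.snoc (α := fun _ => ℂ) r (1 - ∑ k, r k)

/-- The reference measure on the eigenvector parameters, `∏_{k ≤ n} |r_k|⁻¹` times Lebesgue
measure on `ℂ^{n-1}`; that is, `|r_n|⁻¹ ∏_{k < n} d|r_k| dφ_k` in polar coordinates
`r_k = |r_k| e^{iφ_k}`. -/
def eigenvectorMeasure (m : ℕ) : Measure (Fin m → ℂ) :=
  volume.withDensity fun r => ∏ k, ENNReal.ofReal ‖complete r k‖⁻¹

/-- The integrand of the factor `f`. -/
def fIntegrand {m : ℕ} (β : ℝ) (lam : Fin (m + 1) → ℂ) (r : Fin m → ℂ) : ℝ :=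
  Real.exp (-g lam (complete r)) * ∏ k, ‖complete r k‖ ^ (β / 2 - 1)

/-- The factor `f`: the integral over the eigenvector parameters. -/
def f {m : ℕ} (β : ℝ) (lam : Fin (m + 1) → ℂ) : ℝ :=
  ∫ r, fIntegrand β lam r ∂(eigenvectorMeasure m)

/-- The density `(1 / Z) ∏ exp(-|λ_j|² / 2) ∏_{j < k} |λ_k - λ_j|^β f(λ)`. -/
def jpdf {m : ℕ} (β Z : ℝ) (lam : Fin (m + 1) → ℂ) : ℝ :=
  1 / Z * (∏ j, Real.exp (-‖lam j‖ ^ 2 / 2)) *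
    (∏ j, ∏ k ∈ Finset.Ioi j, ‖lam k - lam j‖ ^ β) * f β lam

/-- The random variables `a`, `b` are distributed as in the model with parameter `β`: all entries
are independent, `a_j` is complex Gaussian, `|b_j| ∼ χ_{βj/2}` and `b_j` has uniform phase. -/
structure IsModel {m : ℕ} {Ω : Type*} [MeasurableSpace Ω] (β : ℝ) (P : Measure Ω)
    (a : Fin (m + 1) → Ω → ℂ) (b : Fin m → Ω → ℂ) : Prop where
  law_a : ∀ j, HasLaw (a j) complexGaussian P
  law_b : ∀ j, HasLaw (b j) (subdiagLaw (β * ((j : ℝ) + 1) / 2)) P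
  indep : iIndepFun (Sum.elim a b) P

/-- `lam` lists the eigenvalues of `T` with multiplicity. -/
def ListsEigenvalues {n : ℕ} (T : Matrix (Fin n) (Fin n) ℂ) (lam : Fin n → ℂ) : Prop :=
  T.charpoly = ∏ j, (Polynomial.X - Polynomial.C (lam j))

/-- `p` is the joint probability density function of the (unordered) eigenvalues of the random
matrix `T`: it is nonnegative, measurable, symmetric, and
`E[F(λ_1, …, λ_n)] = ∫ F p` for each measurable symmetric `F ≥ 0`, however the eigenvalues
`λ_1, …, λ_n` of `T` are listed. -/
def IsEigenvalueDensity {n : ℕ} {Ω : Type*} [MeasurableSpace Ω] (P : Measure Ω)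
    (T : Ω → Matrix (Fin n) (Fin n) ℂ) (p : (Fin n → ℂ) → ℝ) : Prop :=
  (∀ lam, 0 ≤ p lam) ∧ AEMeasurable p volume ∧
  (∀ (σ : Equiv.Perm (Fin n)) (lam : Fin n → ℂ), p (lam ∘ σ) = p lam) ∧
  ∀ ev : Ω → Fin n → ℂ, (∀ ω, ListsEigenvalues (T ω) (ev ω)) →
    ∀ F : (Fin n → ℂ) → ENNReal, Measurable F →
      (∀ (σ : Equiv.Perm (Fin n)) (lam : Fin n → ℂ), F (lam ∘ σ) = F lam) →
      ∫⁻ ω, F (ev ω) ∂P = ∫⁻ lam, F lam * ENNReal.ofReal (p lam)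

end ComplexBeta

end

noncomputable section

namespace ComplexBeta

section

/-! ### Tridiagonal matrices and their eigenvectors -/

variable {m : ℕ}

/-! Write `n = m + 1` and let `V` be the Vandermonde determinant of the eigenvalues. A matrix of the
model with nonzero subdiagonal is the Jacobi matrix of the complex discrete functional `p ↦ ∑ k, r k
* p (lam k)`: row `j` of `R` is `r k * q j (lam k)` and column `j` of `R⁻¹` is proportional to `q j
(lam k)`, where the `q j` are the monic orthogonal polynomials. The three-term recurrence recovers
the matrix from `(lam, r)` (`recState_spec`), and admissibility amounts to nonvanishing Hankel
determinants (`Admissible.of_nonDegenerate`, `Admissible.nonDegenerate`). These are polynomials in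
`r`, not identically zero on `∑ r = 1`, whence `ae_admissible`. Determinants in `R * R⁻¹ = 1` give
`∏ b k ^ (k + 1) = (∏ r k) * V ^ 2` (`prod_weights_mul_vandermonde_sq`).

For the density, the entries are compared with `(lam, r)` through the pair of monic polynomials
formed by the characteristic polynomial of `T` and that of its lower right block of size `m`. From
entries to coefficients the real Jacobian is `∏ ‖b k‖ ^ (2 * k)` (`lintegral_charCoeffs`). In
spectral terms the first polynomial has roots `lam`, and the second is `∑ k, r k ∏_{j ≠ k} (X - lam
j)`, affine in the free weights; each contributes a Jacobian `‖V‖ ^ 2` (`lintegral_rootCoeffs`,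
`lintegral_residueCoeffs`). The entries have density proportional to `exp (-(∑ ‖a‖² + ∑ ‖b‖²) / 2) *
∏ ‖b k‖ ^ (β (k + 1) / 2 - 2)`. After division by the first Jacobian the exponent of `‖b k‖` is `(k
+ 1) * (β / 2 - 2)`, so the product identity turns the powers of `b` into powers of `‖r k‖` and
`‖V‖` (`prod_rpow_eq`). The exponential becomes the Gaussian weight of the eigenvalues times `exp
(-g)`. Integrating out `r`, and passing from ordered to unordered eigenvalues, gives
`isEigenvalueDensity_jpdf`.

Convergence of the integral over `r` holds because the moments are entries of powers of `T`: they
bound the weights by a power of `1 + g`, so `exp (-g)` beats any polynomial in the weights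
(`exists_weight_bound`, `exists_integrand_bound`).

Positivity of `g` and its zero set are Schur's inequality with its equality case
(`schur_inequality`). Rationality and rotation invariance are read off the recurrence. The growth
bound is the delicate property: when one node `z` goes to infinity, the coefficient of `X ^ c` in
the orthogonal polynomial of degree `i` has to be `O(‖z‖ ^ (i - c))`. After rescaling by `z` this
says that a limiting leading coefficient does not vanish (`leading_coeff_ne_zero`). Then `a` is
`O(‖z‖)` and `b` is `O(‖z‖ ^ 2)`, so `g` is `O(‖z‖ ^ 4)`. -/

lemma tridiag_self (a : Fin (m + 1) → ℂ) (b : Fin m → ℂ) (i : Fin (m + 1)) :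
    tridiag a b i i = a (Fin.rev i) := by
  simp [tridiag]

lemma tridiag_succ (a : Fin (m + 1) → ℂ) (b : Fin m → ℂ) {i j : Fin (m + 1)}
    (h : i.1 + 1 = j.1) : tridiag a b i j = 1 := by
  have : i ≠ j := fun e => by subst e; omega
  simp [tridiag, this, h]

lemma tridiag_pred (a : Fin (m + 1) → ℂ) (b : Fin m → ℂ) {i j : Fin (m + 1)}
    (h : j.1 + 1 = i.1) : tridiag a b i j = b (Fin.rev ⟨j.1, by omega⟩) := by
  have h1 : i ≠ j := fun e => by subst e; omega
  have h2 : ¬ (i.1 + 1 = j.1) := by omega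
  simp [tridiag, h1, h2, h]

lemma tridiag_eq_zero (a : Fin (m + 1) → ℂ) (b : Fin m → ℂ) {i j : Fin (m + 1)}
    (h1 : i ≠ j) (h2 : i.1 + 1 ≠ j.1) (h3 : j.1 + 1 ≠ i.1) : tridiag a b i j = 0 := by
  simp [tridiag, h1, h2, h3]

lemma sum_tridiag_row (a : Fin (m + 1) → ℂ) (b : Fin m → ℂ) (v : Fin (m + 1) → ℂ)
    (j : Fin (m + 1)) :
    ∑ i, tridiag a b j i * v i = a (Fin.rev j) * v j +
      (if h : j.1 + 1 < m + 1 then v ⟨j.1 + 1, h⟩ else 0) +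
      (if h : 0 < j.1 then b (Fin.rev ⟨j.1 - 1, by omega⟩) * v ⟨j.1 - 1, by omega⟩ else 0) := by
  have key : ∀ i, tridiag a b j i * v i = (if i = j then a (Fin.rev j) * v j else 0) +
      (if j.1 + 1 = i.1 then v i else 0) +
      (if h : i.1 + 1 = j.1 then b (Fin.rev ⟨j.1 - 1, by omega⟩) * v i else 0) := by
    intro i
    rcases eq_or_ne i j with rfl | h1
    · simp [tridiag_self]
    by_cases h2 : j.1 + 1 = i.1
    · have h3 : ¬ (i.1 + 1 = j.1) := by omega
      simp [tridiag_succ a b h2, h1, h2, h3]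
    by_cases h3 : i.1 + 1 = j.1
    · rw [tridiag_pred a b h3]
      have : (⟨i.1, by omega⟩ : Fin m) = ⟨j.1 - 1, by omega⟩ := Fin.ext (by simp; omega)
      simp [h1, h2, h3, this]
    · simp [tridiag_eq_zero a b (Ne.symm h1) h2 h3, h1, h2, h3]
  rw [Finset.sum_congr rfl fun i _ => key i, Finset.sum_add_distrib, Finset.sum_add_distrib]
  congr 1
  · congr 1
    · simp
    · split_ifs with h
      · rw [Finset.sum_eq_single ⟨j.1 + 1, h⟩]
        · simp
        · intro i _ hi
          rw [if_neg]
          exact fun e => hi (Fin.ext e.symm)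
        · simp
      · apply Finset.sum_eq_zero
        intro i _
        rw [if_neg]
        have := i.2
        omega
  · split_ifs with h
    · rw [Finset.sum_eq_single ⟨j.1 - 1, by omega⟩]
      · rw [dif_pos]
        simp; omega
      · intro i _ hi
        rw [dif_neg]
        exact fun e => hi (Fin.ext (by simp; omega))
      · simp
    · apply Finset.sum_eq_zero
      intro i _
      rw [dif_neg]
      omega

lemma sum_tridiag_col (a : Fin (m + 1) → ℂ) (b : Fin m → ℂ) (v : Fin (m + 1) → ℂ)
    (j : Fin (m + 1)) :
    ∑ i, v i * tridiag a b i j = v j * a (Fin.rev j) +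
      (if h : 0 < j.1 then v ⟨j.1 - 1, by omega⟩ else 0) +
      (if h : j.1 + 1 < m + 1 then v ⟨j.1 + 1, h⟩ * b (Fin.rev ⟨j.1, by omega⟩) else 0) := by
  have key : ∀ i, v i * tridiag a b i j = (if i = j then v j * a (Fin.rev j) else 0) +
      (if i.1 + 1 = j.1 then v i else 0) +
      (if h : j.1 + 1 = i.1 then v i * b (Fin.rev ⟨j.1, by omega⟩) else 0) := by
    intro i
    rcases eq_or_ne i j with rfl | h1
    · simp [tridiag_self]
    by_cases h2 : i.1 + 1 = j.1
    · have h3 : ¬ (j.1 + 1 = i.1) := by omega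
      simp [tridiag_succ a b h2, h1, h2, h3]
    by_cases h3 : j.1 + 1 = i.1
    · rw [tridiag_pred a b h3]
      simp [h1, h2, h3]
    · simp [tridiag_eq_zero a b h1 h2 h3, h1, h2, h3]
  rw [Finset.sum_congr rfl fun i _ => key i, Finset.sum_add_distrib, Finset.sum_add_distrib]
  congr 1
  · congr 1
    · simp
    · split_ifs with h
      · rw [Finset.sum_eq_single ⟨j.1 - 1, by omega⟩]
        · rw [if_pos]
          simp; omega
        · intro i _ hi
          rw [if_neg]
          exact fun e => hi (Fin.ext (by simp; omega))
        · simp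
      · apply Finset.sum_eq_zero
        intro i _
        rw [if_neg]
        omega
  · split_ifs with h
    · rw [Finset.sum_eq_single ⟨j.1 + 1, h⟩]
      · simp
      · intro i _ hi
        rw [dif_neg]
        exact fun e => hi (Fin.ext e.symm)
      · simp
    · apply Finset.sum_eq_zero
      intro i _
      rw [dif_neg]
      have := i.2
      omega

/-- A left eigenvector of a tridiagonal matrix with nonzero subdiagonal is determined by its first
entry. -/
lemma left_eigenvector_eq_zero {a : Fin (m + 1) → ℂ} {b : Fin m → ℂ} (hb : ∀ j, b j ≠ 0)
    {w : Fin (m + 1) → ℂ} {μ : ℂ} (hw : ∀ j, ∑ i, w i * tridiag a b i j = μ * w j)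
    (h0 : w 0 = 0) : w = 0 := by
  have key : ∀ j : ℕ, ∀ i (h : i < m + 1), i ≤ j → w ⟨i, h⟩ = 0 := by
    intro j
    induction j with
    | zero =>
      intro i h hi
      obtain rfl : i = 0 := by omega
      exact h0
    | succ j ih =>
      intro i h hi
      rcases Nat.lt_or_ge i (j + 1) with h' | h'
      · exact ih i h (by omega)
      obtain rfl : i = j + 1 := by omega
      -- Column `j` of the eigenvector equation expresses the nonzero subdiagonal entry times `w (j
      -- + 1)` through the two preceding entries of `w`.
      have e := hw ⟨j, by omega⟩
      rw [sum_tridiag_col, ih j (by omega) le_rfl, dif_pos h] at e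
      have e2 : (if h : 0 < j then w ⟨j - 1, by omega⟩ else 0) = 0 := by
        split_ifs with h0
        · exact ih _ _ (by omega)
        · rfl
      simp only [e2] at e
      simpa [hb] using e
  funext i
  exact key i.1 i.1 i.2 le_rfl

lemma IsSpectralData.exists_inverse {T : Matrix (Fin (m + 1)) (Fin (m + 1)) ℂ}
    {lam r : Fin (m + 1) → ℂ} (h : IsSpectralData T lam r) :
    ∃ R L : Matrix (Fin (m + 1)) (Fin (m + 1)) ℂ, R * L = 1 ∧ L * R = 1 ∧
      T = R * Matrix.diagonal lam * L ∧ (∀ k, R 0 k = r k) ∧ ∀ k, L k 0 = 1 := by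
  obtain ⟨-, R, hR, hT, h0, h1⟩ := h
  exact ⟨R, R⁻¹, Matrix.mul_nonsing_inv R hR, Matrix.nonsing_inv_mul R hR, hT, h0, h1⟩

lemma isSpectralData_of_inverse {T : Matrix (Fin (m + 1)) (Fin (m + 1)) ℂ}
    {lam r : Fin (m + 1) → ℂ} (hlam : Function.Injective lam)
    {R L : Matrix (Fin (m + 1)) (Fin (m + 1)) ℂ} (hRL : R * L = 1)
    (hT : T = R * Matrix.diagonal lam * L) (h0 : ∀ k, R 0 k = r k) (h1 : ∀ k, L k 0 = 1) :
    IsSpectralData T lam r := by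
  have hinv : R⁻¹ = L := Matrix.inv_eq_right_inv hRL
  refine ⟨hlam, R, ?_, ?_, h0, ?_⟩
  · exact Matrix.isUnit_det_of_right_inverse hRL
  · rw [hinv, hT]
  · rwa [hinv]

lemma left_eigen_of_eq {T R L : Matrix (Fin (m + 1)) (Fin (m + 1)) ℂ} {lam : Fin (m + 1) → ℂ}
    (hLR : L * R = 1) (hT : T = R * Matrix.diagonal lam * L) (k j : Fin (m + 1)) :
    ∑ i, L k i * T i j = lam k * L k j := by
  have : L * T = Matrix.diagonal lam * L := by
    rw [hT, ← mul_assoc, ← mul_assoc, hLR, one_mul]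
  have := congrFun (congrFun this k) j
  rwa [Matrix.mul_apply, Matrix.diagonal_mul] at this

lemma right_eigen_of_eq {T R L : Matrix (Fin (m + 1)) (Fin (m + 1)) ℂ} {lam : Fin (m + 1) → ℂ}
    (hLR : L * R = 1) (hT : T = R * Matrix.diagonal lam * L) (k j : Fin (m + 1)) :
    ∑ i, T j i * R i k = R j k * lam k := by
  have : T * R = R * Matrix.diagonal lam := by
    rw [hT, mul_assoc, hLR, mul_one]
  have := congrFun (congrFun this j) k
  rwa [Matrix.mul_apply, Matrix.mul_diagonal] at this

/-- The rows of `R⁻¹` are left eigenvectors with first entry `1`, and such an eigenvector is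
determined by its eigenvalue. So `R⁻¹`, hence `R` and its first row, is determined. -/
lemma isSpectralData_unique {a : Fin (m + 1) → ℂ} {b : Fin m → ℂ} (hb : ∀ j, b j ≠ 0)
    {lam r r' : Fin (m + 1) → ℂ} (h : IsSpectralData (tridiag a b) lam r)
    (h' : IsSpectralData (tridiag a b) lam r') : r = r' := by
  obtain ⟨R, L, hRL, hLR, hT, h0, h1⟩ := h.exists_inverse
  obtain ⟨R', L', hRL', hLR', hT', h0', h1'⟩ := h'.exists_inverse
  have hL : L = L' := by
    funext k
    rw [← sub_eq_zero]
    refine left_eigenvector_eq_zero (a := a) hb (μ := lam k) (fun j => ?_) (by simp [h1, h1'])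
    have e1 := left_eigen_of_eq hLR hT k j
    have e2 := left_eigen_of_eq hLR' hT' k j
    simp only [Pi.sub_apply, sub_mul, Finset.sum_sub_distrib, e1, e2, mul_sub]
  have hR : R = R' := by
    calc R = R * (L' * R') := by rw [hLR', mul_one]
      _ = R' := by rw [← hL, ← mul_assoc, hRL, one_mul]
  funext k
  rw [← h0, ← h0', hR]

/-- Each root of the characteristic polynomial has a left eigenvector. Its first entry cannot
vanish, by `left_eigenvector_eq_zero`, so it can be normalized to `1`. Distinct eigenvalues make
these rows independent, and the inverse of the matrix they form is `R`. -/
lemma exists_isSpectralData {a : Fin (m + 1) → ℂ} {b : Fin m → ℂ} (hb : ∀ j, b j ≠ 0)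
    {lam : Fin (m + 1) → ℂ} (hlam : Function.Injective lam)
    (hl : ListsEigenvalues (tridiag a b) lam) :
    ∃ r, IsSpectralData (tridiag a b) lam r := by
  set T := tridiag a b with hTdef
  have ex : ∀ k, ∃ w : Fin (m + 1) → ℂ, w 0 = 1 ∧ ∀ j, ∑ i, w i * T i j = lam k * w j := by
    intro k
    have hdet : (Matrix.scalar (Fin (m + 1)) (lam k) - T).det = 0 := by
      rw [← Matrix.eval_charpoly, hl, Polynomial.eval_prod]
      exact Finset.prod_eq_zero (Finset.mem_univ k) (by simp)
    obtain ⟨v, hv, hv'⟩ := Matrix.exists_vecMul_eq_zero_iff.2 hdet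
    have hv2 : ∀ j, ∑ i, v i * T i j = lam k * v j := by
      intro j
      have := congrFun hv' j
      rw [Matrix.vecMul_sub] at this
      rw [Matrix.scalar_apply, Pi.sub_apply, Matrix.vecMul_diagonal, Pi.zero_apply,
        Matrix.vecMul, dotProduct] at this
      linear_combination -this
    have hv0 : v 0 ≠ 0 := fun e => hv (left_eigenvector_eq_zero hb hv2 e)
    refine ⟨fun i => (v 0)⁻¹ * v i, by simp [hv0], fun j => ?_⟩
    simp only [mul_assoc, ← Finset.mul_sum, hv2]
    ring
  choose w hw0 hw using ex
  set L : Matrix (Fin (m + 1)) (Fin (m + 1)) ℂ := Matrix.of w with hL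
  have hind : LinearIndependent ℂ L.row := by
    refine Module.End.eigenvectors_linearIndependent' (Matrix.vecMulLinear T) lam hlam
      w fun k => ?_
    rw [Module.End.hasEigenvector_iff, Module.End.mem_eigenspace_iff]
    constructor
    · funext j
      simpa [Matrix.vecMul, dotProduct] using hw k j
    · intro e
      have := congrFun e 0
      simp [hw0] at this
  have hu : IsUnit L.det := by
    rw [← Matrix.isUnit_iff_isUnit_det]
    exact Matrix.linearIndependent_rows_iff_isUnit.1 hind
  have hLT : L * T = Matrix.diagonal lam * L := by
    ext k j
    rw [Matrix.mul_apply, Matrix.diagonal_mul]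
    exact hw k j
  refine ⟨L⁻¹ 0, isSpectralData_of_inverse hlam (R := L⁻¹) (L := L)
    (Matrix.nonsing_inv_mul L hu) ?_ (fun k => rfl) hw0⟩
  rw [mul_assoc, ← hLT, ← mul_assoc, Matrix.nonsing_inv_mul L hu, one_mul]

/-- Everything rests on `T i j = ∑ k, R i k * lam k * L k j`. Since the superdiagonal is `1`, the
equation `T R = R Λ` yields the next row of `R` without division; the subdiagonal entry is then such
a sum, and dividing by it yields the next column of `L`. -/
lemma recState_spec {a : Fin (m + 1) → ℂ} {b : Fin m → ℂ} (hb : ∀ j, b j ≠ 0)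
    {lam r : Fin (m + 1) → ℂ} {R L : Matrix (Fin (m + 1)) (Fin (m + 1)) ℂ} (hLR : L * R = 1)
    (hT : tridiag a b = R * Matrix.diagonal lam * L) (h0 : ∀ k, R 0 k = r k)
    (h1 : ∀ k, L k 0 = 1) (j : ℕ) (hj : j < m + 1) :
    (∀ k, (recState lam r j).rCur k = R ⟨j, hj⟩ k) ∧
    (∀ k, (recState lam r j).lCur k = L k ⟨j, hj⟩) ∧
    (∀ k, (recState lam r j).sub * (recState lam r j).rPrev k =
      if h : 0 < j then b (Fin.rev ⟨j - 1, by omega⟩) * R ⟨j - 1, by omega⟩ k else 0) ∧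
    (∀ k, (recState lam r j).lPrev k = if h : 0 < j then L k ⟨j - 1, by omega⟩ else 0) ∧
    (∀ h : 0 < j, (recState lam r j).sub = b (Fin.rev ⟨j - 1, by omega⟩)) ∧
    (recState lam r j).diag lam = a (Fin.rev ⟨j, hj⟩) := by
  have hent : ∀ i j, ∑ k, R i k * lam k * L k j = tridiag a b i j := by
    intro i j
    rw [hT, Matrix.mul_apply]
    simp only [Matrix.mul_diagonal]
  induction j with
  | zero =>
    have hr : ∀ k, r k = R 0 k := fun k => (h0 k).symm
    refine ⟨hr, fun k => (h1 k).symm, by simp [recState], by simp [recState], by simp, ?_⟩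
    have := hent 0 0
    rw [tridiag_self] at this
    simpa [RecState.diag, recState, h0, h1] using this
  | succ j ih =>
    obtain ⟨i1, i2, i3, i4, i5, i6⟩ := ih (by omega)
    set s := recState lam r j with hs
    have hn : recState lam r (j + 1) = s.next lam := rfl
    have c1 : ∀ k, (recState lam r (j + 1)).rCur k = R ⟨j + 1, hj⟩ k := by
      intro k
      have e := right_eigen_of_eq hLR hT k ⟨j, by omega⟩
      rw [sum_tridiag_row, dif_pos hj, ← i3] at e
      simp only [hn, RecState.next, i6, i1]
      linear_combination -e
    have c5 : (recState lam r (j + 1)).sub = b (Fin.rev ⟨j, by omega⟩) := by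
      have e : (recState lam r (j + 1)).sub =
        ∑ k, (recState lam r (j + 1)).rCur k * lam k * s.lCur k := rfl
      rw [e]
      simp only [c1, i2, hent]
      rw [tridiag_pred a b rfl]
    have c2 : ∀ k, (recState lam r (j + 1)).lCur k = L k ⟨j + 1, hj⟩ := by
      intro k
      have e : (recState lam r (j + 1)).lCur k =
        (lam k * s.lCur k - s.diag lam * s.lCur k - s.lPrev k) /
          (recState lam r (j + 1)).sub := rfl
      have e2 := left_eigen_of_eq hLR hT k ⟨j, by omega⟩
      rw [sum_tridiag_col, dif_pos hj] at e2
      rw [e, c5, div_eq_iff (hb _), i6, i4, i2]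
      linear_combination -e2
    have c6 : (recState lam r (j + 1)).diag lam = a (Fin.rev ⟨j + 1, hj⟩) := by
      simp only [RecState.diag, c1, c2, hent, tridiag_self]
    refine ⟨c1, c2, fun k => ?_, fun k => ?_, fun _ => c5, c6⟩
    · rw [c5]
      simp only [hn, RecState.next, i1]
      simp
    · simp only [hn, RecState.next, i2]
      simp

lemma reconstruct_eq {a : Fin (m + 1) → ℂ} {b : Fin m → ℂ} (hb : ∀ j, b j ≠ 0)
    {lam r : Fin (m + 1) → ℂ} (h : IsSpectralData (tridiag a b) lam r) :
    reconstruct lam r = tridiag a b := by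
  obtain ⟨R, L, hRL, hLR, hT, h0, h1⟩ := h.exists_inverse
  have key := recState_spec hb hLR hT h0 h1
  have ea : (fun k : Fin (m + 1) => (recState lam r (Fin.rev k).1).diag lam) = a := by
    funext k
    rw [(key _ (Fin.rev k).2).2.2.2.2.2]
    exact congrArg a (Fin.rev_rev k)
  have eb : (fun k : Fin m => (recState lam r ((Fin.rev k).1 + 1)).sub) = b := by
    funext k
    rw [(key ((Fin.rev k).1 + 1) (by omega)).2.2.2.2.1 (by omega)]
    exact congrArg b (Fin.rev_rev k)
  rw [reconstruct, ea, eb]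

end

section

/-! ### Orthogonal polynomials for a complex discrete weight -/

open Polynomial in
/-- The functional `p ↦ ∑ k, r k * p (lam k)` on polynomials. -/
def moment {n : ℕ} (lam r : Fin n → ℂ) : ℂ[X] →ₗ[ℂ] ℂ :=
  ∑ k, r k • Polynomial.leval (lam k)

/-- The Hankel matrix of the moments of the weights `r` at the nodes `lam`. -/
def hankel {n : ℕ} (lam r : Fin n → ℂ) (i : ℕ) : Matrix (Fin i) (Fin i) ℂ :=
  Matrix.of fun s t => ∑ k, r k * lam k ^ (s.1 + t.1)

open Polynomial

variable {n m : ℕ} {lam r : Fin n → ℂ}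

lemma moment_apply (p : ℂ[X]) : moment lam r p = ∑ k, r k * p.eval (lam k) := by
  simp [moment, LinearMap.sum_apply]

lemma moment_mul_eq_zero {p q : ℂ[X]} {i : ℕ} (h : ∀ t < i, moment lam r (p * X ^ t) = 0)
    (hq : q.degree < i) : moment lam r (p * q) = 0 := by
  rcases eq_or_ne q 0 with rfl | hq0
  · simp
  rw [q.as_sum_range' i ((natDegree_lt_iff_degree_lt hq0).2 hq), Finset.mul_sum, map_sum]
  refine Finset.sum_eq_zero fun t ht => ?_
  rw [← C_mul_X_pow_eq_monomial, mul_left_comm, ← smul_eq_C_mul, map_smul,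
    h t (Finset.mem_range.1 ht), smul_zero]

lemma sum_monomial_degree_lt {i : ℕ} (v : Fin i → ℂ) :
    (∑ s, C (v s) * X ^ s.1 : ℂ[X]).degree < i := by
  refine lt_of_le_of_lt (degree_sum_le _ _) ?_
  rw [Finset.sup_lt_iff (by exact_mod_cast WithBot.bot_lt_coe i)]
  intro s _
  exact lt_of_le_of_lt (degree_C_mul_X_pow_le _ _) (by exact_mod_cast s.2)

lemma sum_monomial_coeff {i : ℕ} (v : Fin i → ℂ) (t : Fin i) :
    (∑ s, C (v s) * X ^ s.1 : ℂ[X]).coeff t.1 = v t := by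
  simp only [finsetSum_coeff, coeff_C_mul, coeff_X_pow]
  rw [Finset.sum_eq_single t]
  · simp
  · intro s _ hs
    rw [if_neg, mul_zero]
    exact fun e => hs (Fin.ext e.symm)
  · simp

lemma eq_sum_monomial {i : ℕ} {p : ℂ[X]} (hp : p.degree < i) :
    p = ∑ s : Fin i, C (p.coeff s.1) * X ^ s.1 := by
  rcases eq_or_ne p 0 with rfl | hp0
  · simp
  conv_lhs => rw [p.as_sum_range' i ((natDegree_lt_iff_degree_lt hp0).2 hp)]
  rw [Finset.sum_range]
  simp [C_mul_X_pow_eq_monomial]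

lemma hankel_mulVec {i : ℕ} (v : Fin i → ℂ) (t : Fin i) :
    (hankel lam r i).mulVec v t = moment lam r ((∑ s, C (v s) * X ^ s.1) * X ^ t.1) := by
  simp only [Matrix.mulVec, dotProduct, hankel, Matrix.of_apply, moment_apply, eval_mul,
    eval_finsetSum, eval_C, eval_pow, eval_X, Finset.sum_mul, Finset.mul_sum]
  rw [Finset.sum_comm]
  refine Finset.sum_congr rfl fun k _ => Finset.sum_congr rfl fun s _ => ?_
  ring

/-- The kernel of the Hankel matrix consists of the coefficient vectors of polynomials of degree
less than `i` that are orthogonal to all of `X ^ t`, `t < i`. Nondegeneracy is used below in this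
form. -/
lemma hankel_det_ne_zero_iff {i : ℕ} : (hankel lam r i).det ≠ 0 ↔
    ∀ p : ℂ[X], p.degree < i → (∀ t < i, moment lam r (p * X ^ t) = 0) → p = 0 := by
  constructor
  · intro h p hp hpt
    have hv : (hankel lam r i).mulVec (fun s => p.coeff s.1) = 0 := by
      funext t
      rw [hankel_mulVec, ← eq_sum_monomial hp]
      exact hpt t.1 t.2
    have h0 := Matrix.eq_zero_of_mulVec_eq_zero h hv
    rw [eq_sum_monomial hp]
    refine Finset.sum_eq_zero fun s _ => ?_
    rw [congrFun h0 s]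
    simp
  · intro h h0
    obtain ⟨v, hv, hv'⟩ := Matrix.exists_mulVec_eq_zero_iff.2 h0
    refine hv (funext fun t => ?_)
    rw [← sum_monomial_coeff v t, h _ (sum_monomial_degree_lt v) fun t ht => ?_]
    · simp
    · have := congrFun hv' ⟨t, ht⟩
      rwa [hankel_mulVec] at this

lemma exists_orthogonal {i : ℕ} (h : (hankel lam r i).det ≠ 0) :
    ∃ p : ℂ[X], p.Monic ∧ p.natDegree = i ∧ ∀ t < i, moment lam r (p * X ^ t) = 0 := by
  set y : Fin i → ℂ := fun t => -moment lam r (X ^ i * X ^ t.1) with hy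
  set v := (hankel lam r i)⁻¹.mulVec y with hv
  have hvy : (hankel lam r i).mulVec v = y := by
    rw [hv, Matrix.mulVec_mulVec, Matrix.mul_nonsing_inv _ (isUnit_iff_ne_zero.2 h),
      Matrix.one_mulVec]
  refine ⟨X ^ i + ∑ s, C (v s) * X ^ s.1, monic_X_pow_add (sum_monomial_degree_lt v), ?_, ?_⟩
  · rw [natDegree_add_eq_left_of_degree_lt]
    · simp
    · rw [degree_X_pow]
      exact sum_monomial_degree_lt v
  · intro t ht
    have := congrFun hvy ⟨t, ht⟩
    rw [hankel_mulVec] at this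
    rw [add_mul, map_add, this, hy]
    simp

/-- Nodes and weights of total mass one whose Hankel determinants do not vanish. -/
def NonDegenerate (lam r : Fin (m + 1) → ℂ) : Prop :=
  Function.Injective lam ∧ ∑ k, r k = 1 ∧ ∀ i ≤ m + 1, (hankel lam r i).det ≠ 0

lemma degree_lt_of_monic {p : ℂ[X]} {i j : ℕ} (h : p.natDegree = i) (hij : i < j) :
    p.degree < j :=
  lt_of_le_of_lt degree_le_natDegree (by exact_mod_cast h ▸ hij)

/-- With `q j` the monic orthogonal polynomials, `R j k = r k * q j (lam k)` and `L k j = q j (lam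
k) / ⟨q j, q j⟩` are inverse to each other by orthogonality. The matrix `R Λ L` represents
multiplication by `X` and so is tridiagonal, and `q 0 = 1` gives the required normalization. -/
lemma Admissible.of_nonDegenerate {lam r : Fin (m + 1) → ℂ} (h : NonDegenerate lam r) :
    Admissible lam r := by
  obtain ⟨hlam, hsum, hdet⟩ := h
  have ex : ∀ j : Fin (m + 1), ∃ p : ℂ[X], p.Monic ∧ p.natDegree = j.1 ∧
      ∀ t < j.1, moment lam r (p * X ^ t) = 0 := fun j => exists_orthogonal (hdet _ j.2.le)
  choose q hmon hdeg horth using ex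
  have horth' : ∀ j (p : ℂ[X]), p.degree < j.1 → moment lam r (q j * p) = 0 :=
    fun j p hp => moment_mul_eq_zero (horth j) hp
  have hlt : ∀ i j : Fin (m + 1), i < j → moment lam r (q i * q j) = 0 := by
    intro i j hij
    rw [mul_comm]
    exact horth' j _ (degree_lt_of_monic (hdeg i) hij)
  have hne : ∀ i j : Fin (m + 1), i ≠ j → moment lam r (q i * q j) = 0 := by
    intro i j hij
    rcases lt_or_gt_of_ne hij with h | h
    · exact hlt i j h
    · rw [mul_comm]
      exact hlt j i h
  -- If the self-pairing vanished, `q j` would also be orthogonal to `X ^ j` and would lie in the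
  -- kernel of the Hankel matrix of size `j + 1`.
  have hη : ∀ j, moment lam r (q j * q j) ≠ 0 := by
    intro j h0
    refine (hmon j).ne_zero (hankel_det_ne_zero_iff.1 (hdet (j.1 + 1) j.2) (q j) ?_ ?_)
    · exact degree_lt_of_monic (hdeg j) (Nat.lt_succ_self _)
    · intro t ht
      rcases Nat.lt_succ_iff_lt_or_eq.1 ht with h | rfl
      · exact horth j t h
      have : moment lam r (q j * (X ^ j.1 - q j)) = 0 := by
        refine horth' j _ ?_
        have hd : (X ^ j.1 : ℂ[X]).degree = (q j).degree := by
          rw [degree_X_pow, degree_eq_natDegree (hmon j).ne_zero, hdeg]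
        have := degree_sub_lt_left hd (pow_ne_zero _ X_ne_zero) (by simp [(hmon j).leadingCoeff])
        rwa [degree_X_pow] at this
      rw [mul_sub, map_sub, h0, sub_zero] at this
      exact this
  set R : Matrix (Fin (m + 1)) (Fin (m + 1)) ℂ :=
    Matrix.of fun j k => r k * (q j).eval (lam k) with hR
  set L : Matrix (Fin (m + 1)) (Fin (m + 1)) ℂ :=
    Matrix.of fun k j => (q j).eval (lam k) / moment lam r (q j * q j) with hL
  have hRL : R * L = 1 := by
    ext i j
    have e : (R * L) i j = moment lam r (q i * q j) / moment lam r (q j * q j) := by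
      rw [Matrix.mul_apply, moment_apply (q i * q j), Finset.sum_div]
      refine Finset.sum_congr rfl fun k _ => ?_
      simp only [hR, hL, Matrix.of_apply, eval_mul]
      ring
    rw [e]
    rcases eq_or_ne i j with rfl | hij
    · rw [div_self (hη i), Matrix.one_apply_eq]
    · rw [hne i j hij, zero_div, Matrix.one_apply_ne hij]
  set T := R * Matrix.diagonal lam * L with hT
  have hTe : ∀ i j, T i j = moment lam r (X * q i * q j) / moment lam r (q j * q j) := by
    intro i j
    rw [hT, Matrix.mul_apply, moment_apply (X * q i * q j), Finset.sum_div]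
    refine Finset.sum_congr rfl fun k _ => ?_
    simp only [Matrix.mul_diagonal]
    simp only [hR, hL, Matrix.of_apply, eval_mul, eval_X]
    ring
  -- `X * q i` and `q j` are monic of the same degree, so they differ by a polynomial of smaller
  -- degree, orthogonal to `q j`. This makes the superdiagonal equal to `1`.
  have hXq : ∀ i j : Fin (m + 1), i.1 + 1 = j.1 →
      moment lam r (X * q i * q j) = moment lam r (q j * q j) := by
    intro i j hij
    rw [← sub_eq_zero, ← map_sub, ← sub_mul, mul_comm]
    refine horth' j _ ?_
    have hm : (X * q i).Monic := monic_X.mul (hmon i)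
    have hnd : (X * q i).natDegree = j.1 := by
      rw [natDegree_X_mul (hmon i).ne_zero, hdeg, hij]
    have hd : (X * q i).degree = (q j).degree := by
      rw [degree_eq_natDegree hm.ne_zero, degree_eq_natDegree (hmon j).ne_zero, hnd, hdeg]
    have := degree_sub_lt_left hd hm.ne_zero (by rw [hm.leadingCoeff, (hmon j).leadingCoeff])
    rwa [degree_eq_natDegree hm.ne_zero, hnd] at this
  have hfar : ∀ i j : Fin (m + 1), i.1 + 1 < j.1 → moment lam r (X * q i * q j) = 0 := by
    intro i j hij
    rw [mul_comm]
    refine horth' j _ (degree_lt_of_monic (i := i.1 + 1) ?_ hij)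
    rw [natDegree_X_mul (hmon i).ne_zero, hdeg]
  refine ⟨fun k => T (Fin.rev k) (Fin.rev k), fun k =>
    moment lam r (q (Fin.rev k).succ * q (Fin.rev k).succ) /
      moment lam r (q (Fin.rev k).castSucc * q (Fin.rev k).castSucc),
    fun k => div_ne_zero (hη _) (hη _), ?_⟩
  have hTtri : tridiag (fun k => T (Fin.rev k) (Fin.rev k)) (fun k : Fin m =>
      moment lam r (q (Fin.rev k).succ * q (Fin.rev k).succ) /
      moment lam r (q (Fin.rev k).castSucc * q (Fin.rev k).castSucc)) = T := by
    ext i j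
    rcases eq_or_ne i j with rfl | h1
    · rw [tridiag_self, Fin.rev_rev]
    by_cases h2 : i.1 + 1 = j.1
    · rw [tridiag_succ _ _ h2, hTe, hXq i j h2, div_self (hη j)]
    by_cases h3 : j.1 + 1 = i.1
    · rw [tridiag_pred _ _ h3, hTe, mul_right_comm, hXq j i h3]
      simp only [Fin.rev_rev]
      have e1 : (⟨j.1, by omega⟩ : Fin m).succ = i := Fin.ext h3
      have e2 : (⟨j.1, by omega⟩ : Fin m).castSucc = j := Fin.ext rfl
      rw [e1, e2]
    · rw [tridiag_eq_zero _ _ h1 h2 h3, hTe]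
      have h1' : i.1 ≠ j.1 := fun e => h1 (Fin.ext e)
      rcases lt_or_gt_of_ne h1' with h | h
      · rw [hfar i j (by omega), zero_div]
      · rw [mul_right_comm, hfar j i (by omega), zero_div]
  have hq0 : q 0 = 1 := by
    have h0 := hmon 0
    rw [eq_C_of_natDegree_eq_zero (hdeg 0)] at h0 ⊢
    rw [Monic, leadingCoeff_C] at h0
    rw [h0, C_1]
  rw [hTtri]
  refine isSpectralData_of_inverse hlam hRL rfl (fun k => ?_) (fun k => ?_)
  · simp [hR, hq0]
  · simp [hL, hq0, moment_apply, hsum]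

/-- The product of the first `j` subdiagonal entries of `tridiag a b`, from the top. -/
def subProd (b : Fin m → ℂ) (j : ℕ) : ℂ :=
  ∏ i ∈ Finset.range j, if h : i < m then b (Fin.rev ⟨i, h⟩) else 1

lemma subProd_succ (b : Fin m → ℂ) {j : ℕ} (hj : j < m) :
    subProd b (j + 1) = subProd b j * b (Fin.rev ⟨j, hj⟩) := by
  rw [subProd, Finset.prod_range_succ, dif_pos hj, subProd]

lemma subProd_ne_zero {b : Fin m → ℂ} (hb : ∀ j, b j ≠ 0) (j : ℕ) : subProd b j ≠ 0 := by
  refine Finset.prod_ne_zero_iff.2 fun i _ => ?_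
  split_ifs
  · exact hb _
  · exact one_ne_zero

lemma prod_range_prod_range {M : Type*} [CommMonoid M] (B : ℕ → M) (N : ℕ) :
    ∏ j ∈ Finset.range (N + 1), ∏ i ∈ Finset.range j, B i =
      ∏ i ∈ Finset.range N, B i ^ (N - i) := by
  induction N with
  | zero => simp
  | succ N ih =>
    have e : ∏ i ∈ Finset.range (N + 1), B i ^ (N + 1 - i) =
        (∏ i ∈ Finset.range (N + 1), B i ^ (N - i)) * ∏ i ∈ Finset.range (N + 1), B i := by
      rw [← Finset.prod_mul_distrib]
      refine Finset.prod_congr rfl fun i hi => ?_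
      rw [← pow_succ, Nat.succ_sub (Nat.lt_succ_iff.1 (Finset.mem_range.1 hi))]
    rw [Finset.prod_range_succ, ih, e]
    congr 1
    rw [Finset.prod_range_succ, Nat.sub_self, pow_zero, mul_one]

/-- The subdiagonal entry at position `i` from the top occurs in `subProd b j` for `i < j ≤ m`, that
is `m - i` times; reversing the indices turns `m - i` into `k + 1`. -/
lemma prod_subProd (b : Fin m → ℂ) :
    ∏ j : Fin (m + 1), subProd b j.1 = ∏ k : Fin m, b k ^ (k.1 + 1) := by
  rw [← Finset.prod_range (fun j => subProd b j)]
  refine (prod_range_prod_range (fun i => if h : i < m then b (Fin.rev ⟨i, h⟩) else 1) m).trans ?_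
  rw [Finset.prod_range, ← Equiv.prod_comp Fin.revPerm]
  refine Finset.prod_congr rfl fun k _ => ?_
  have e : Fin.revPerm k = Fin.rev k := rfl
  rw [dif_pos (Fin.is_lt _), e]
  have h1 : Fin.rev ⟨(Fin.rev k).1, (Fin.rev k).2⟩ = k := Fin.rev_rev k
  rw [h1]
  congr 1
  rw [Fin.val_rev]
  omega

/-- The monic polynomials given by the three-term recurrence of `tridiag a b`, from the top. -/
def topPoly (a : Fin (m + 1) → ℂ) (b : Fin m → ℂ) : ℕ → ℂ[X]
  | 0 => 1
  | 1 => X - C (a (Fin.rev 0))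
  | i + 2 => (X - C (if h : i + 1 < m + 1 then a (Fin.rev ⟨i + 1, h⟩) else 0)) *
      topPoly a b (i + 1) - C (if h : i < m then b (Fin.rev ⟨i, h⟩) else 0) * topPoly a b i

lemma topPoly_monic_natDegree (a : Fin (m + 1) → ℂ) (b : Fin m → ℂ) (i : ℕ) :
    ((topPoly a b i).Monic ∧ (topPoly a b i).natDegree = i) ∧
      ((topPoly a b (i + 1)).Monic ∧ (topPoly a b (i + 1)).natDegree = i + 1) := by
  induction i with
  | zero => exact ⟨⟨monic_one, natDegree_one⟩, monic_X_sub_C _, natDegree_X_sub_C _⟩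
  | succ i ih =>
    refine ⟨ih.2, ?_⟩
    obtain ⟨⟨hσm, hσd⟩, hpm, hpd⟩ := ih
    set α := if h : i + 1 < m + 1 then a (Fin.rev ⟨i + 1, h⟩) else 0 with hα
    set γ := if h : i < m then b (Fin.rev ⟨i, h⟩) else 0 with hγ
    have e : topPoly a b (i + 1 + 1) =
      (X - C α) * topPoly a b (i + 1) - C γ * topPoly a b i := rfl
    have hm1 : ((X - C α) * topPoly a b (i + 1)).Monic := (monic_X_sub_C _).mul hpm
    have hd1 : ((X - C α) * topPoly a b (i + 1)).natDegree = i + 1 + 1 := by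
      rw [(monic_X_sub_C _).natDegree_mul hpm, natDegree_X_sub_C, hpd, add_comm]
    have hd2 : (C γ * topPoly a b i).natDegree < ((X - C α) * topPoly a b (i + 1)).natDegree := by
      refine lt_of_le_of_lt (natDegree_C_mul_le _ _) ?_
      omega
    rw [e]
    refine ⟨hm1.sub_of_left (degree_lt_degree hd2), ?_⟩
    rw [natDegree_sub_eq_left_of_natDegree_lt hd2, hd1]

lemma topPoly_monic (a : Fin (m + 1) → ℂ) (b : Fin m → ℂ) (i : ℕ) : (topPoly a b i).Monic :=
  (topPoly_monic_natDegree a b i).1.1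

lemma natDegree_topPoly (a : Fin (m + 1) → ℂ) (b : Fin m → ℂ) (i : ℕ) :
    (topPoly a b i).natDegree = i :=
  (topPoly_monic_natDegree a b i).1.2

/-- The entries of the eigenvector matrices of a tridiagonal matrix are values of polynomials. -/
lemma eigenvector_eq_topPoly {a : Fin (m + 1) → ℂ} {b : Fin m → ℂ}
    {lam r : Fin (m + 1) → ℂ} {R L : Matrix (Fin (m + 1)) (Fin (m + 1)) ℂ} (hLR : L * R = 1)
    (hT : tridiag a b = R * Matrix.diagonal lam * L) (h0 : ∀ k, R 0 k = r k)
    (h1 : ∀ k, L k 0 = 1) (j : ℕ) (hj : j < m + 1) :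
    (∀ k, R ⟨j, hj⟩ k = r k * (topPoly a b j).eval (lam k)) ∧
      ∀ k, L k ⟨j, hj⟩ * subProd b j = (topPoly a b j).eval (lam k) := by
  induction j using Nat.strong_induction_on with
  | _ j ih =>
  rcases j with _ | _ | j
  · exact ⟨by simpa [topPoly] using h0, by simpa [subProd, topPoly] using h1⟩
  · have h00 : ¬ 0 < ((0 : Fin (m + 1)) : ℕ) := lt_irrefl 0
    have h01 : ((0 : Fin (m + 1)) : ℕ) + 1 < m + 1 := hj
    refine ⟨fun k => ?_, fun k => ?_⟩
    · have e := right_eigen_of_eq hLR hT k 0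
      rw [sum_tridiag_row, dif_pos h01, dif_neg h00, h0] at e
      change a (Fin.rev 0) * r k + R ⟨0 + 1, hj⟩ k + 0 = _ at e
      simp only [topPoly, eval_sub, eval_X, eval_C]
      linear_combination e
    · have e := left_eigen_of_eq hLR hT k 0
      rw [sum_tridiag_col, dif_pos h01, dif_neg h00, h1] at e
      change 1 * a (Fin.rev 0) + 0 + L k ⟨0 + 1, hj⟩ * b (Fin.rev ⟨0, by omega⟩) = _ at e
      rw [subProd_succ b (by omega)]
      simp only [topPoly, eval_sub, eval_X, eval_C, subProd, Finset.range_zero, Finset.prod_empty]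
      linear_combination e
  · obtain ⟨iR, iL⟩ := ih j (by omega) (by omega)
    obtain ⟨iR', iL'⟩ := ih (j + 1) (by omega) (by omega)
    have hjm : j < m := by omega
    have hj1 : j + 1 < m + 1 := by omega
    refine ⟨fun k => ?_, fun k => ?_⟩
    · have e := right_eigen_of_eq hLR hT k ⟨j + 1, by omega⟩
      rw [sum_tridiag_row, dif_pos hj, dif_pos (Nat.succ_pos j)] at e
      simp only [Nat.add_sub_cancel, iR, iR'] at e
      simp only [topPoly, eval_sub, eval_mul, eval_X, eval_C, dif_pos hjm, dif_pos hj1]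
      linear_combination e
    · have e := left_eigen_of_eq hLR hT k ⟨j + 1, by omega⟩
      rw [sum_tridiag_col, dif_pos hj, dif_pos (Nat.succ_pos j)] at e
      simp only [Nat.add_sub_cancel] at e
      have hs := subProd_succ b hjm
      rw [subProd_succ b (by omega : j + 1 < m)]
      simp only [topPoly, eval_sub, eval_mul, eval_X, eval_C, dif_pos hjm, dif_pos hj1,
        ← iL, ← iL']
      rw [hs]
      linear_combination subProd b j * b (Fin.rev ⟨j, hjm⟩) * e

/-- The last polynomial of the recurrence vanishes at the eigenvalues. -/
lemma topPoly_eval_eq_zero {a : Fin (m + 1) → ℂ} {b : Fin m → ℂ}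
    {lam r : Fin (m + 1) → ℂ} {R L : Matrix (Fin (m + 1)) (Fin (m + 1)) ℂ} (hLR : L * R = 1)
    (hT : tridiag a b = R * Matrix.diagonal lam * L) (h0 : ∀ k, R 0 k = r k)
    (h1 : ∀ k, L k 0 = 1) (k : Fin (m + 1)) : (topPoly a b (m + 1)).eval (lam k) = 0 := by
  rcases m with _ | m
  · have e := left_eigen_of_eq hLR hT k 0
    have h00 : ¬ 0 < ((0 : Fin (0 + 1)) : ℕ) := lt_irrefl 0
    have h01 : ¬ ((0 : Fin (0 + 1)) : ℕ) + 1 < 0 + 1 := lt_irrefl 1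
    rw [sum_tridiag_col, dif_neg h00, dif_neg h01, h1] at e
    simp only [topPoly, eval_sub, eval_X, eval_C]
    linear_combination -e
  · have iL := (eigenvector_eq_topPoly hLR hT h0 h1 m (by omega)).2
    have iL' := (eigenvector_eq_topPoly hLR hT h0 h1 (m + 1) (by omega)).2
    have e := left_eigen_of_eq hLR hT k ⟨m + 1, by omega⟩
    rw [sum_tridiag_col, dif_pos (Nat.succ_pos m), dif_neg (by simp)] at e
    simp only [Nat.add_sub_cancel] at e
    have hs := subProd_succ b (lt_add_one m)
    simp only [topPoly, eval_sub, eval_mul, eval_X, eval_C, dif_pos (lt_add_one m),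
      dif_pos (lt_add_one (m + 1)), ← iL, ← iL']
    rw [hs]
    linear_combination -subProd b m * b (Fin.rev ⟨m, lt_add_one m⟩) * e

lemma IsSpectralData.sum_eq_one {T : Matrix (Fin (m + 1)) (Fin (m + 1)) ℂ}
    {lam r : Fin (m + 1) → ℂ} (h : IsSpectralData T lam r) : ∑ k, r k = 1 := by
  obtain ⟨R, L, hRL, hLR, hT, h0, h1⟩ := h.exists_inverse
  have := congrFun (congrFun hRL 0) 0
  simpa [Matrix.mul_apply, h0, h1] using this

/-- This is `R * L = 1` written in terms of the polynomials: the columns of `L` carry the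
normalization `1 / subProd b j`. -/
lemma moment_topPoly_mul_topPoly {a : Fin (m + 1) → ℂ} {b : Fin m → ℂ}
    {lam r : Fin (m + 1) → ℂ} (hs : IsSpectralData (tridiag a b) lam r) {i j : ℕ}
    (hi : i < m + 1) (hj : j < m + 1) :
    moment lam r (topPoly a b i * topPoly a b j) = if i = j then subProd b j else 0 := by
  obtain ⟨R, L, hRL, hLR, hT, h0, h1⟩ := hs.exists_inverse
  have key := eigenvector_eq_topPoly hLR hT h0 h1
  have e := congrFun (congrFun hRL ⟨i, hi⟩) ⟨j, hj⟩
  rw [Matrix.one_apply, Matrix.mul_apply] at e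
  have e2 : moment lam r (topPoly a b i * topPoly a b j) =
      subProd b j * ∑ k, R ⟨i, hi⟩ k * L k ⟨j, hj⟩ := by
    rw [moment_apply, Finset.mul_sum]
    refine Finset.sum_congr rfl fun k _ => ?_
    rw [eval_mul, ← (key j hj).2, (key i hi).1]
    ring
  rw [e2, e]
  simp [Fin.ext_iff]

/-- The monomial `X ^ t` differs from `topPoly a b t` by lower degree, which gives an induction on
`t`. The extreme index `i = m + 1` is separate: there the polynomial vanishes at every node. -/
lemma moment_topPoly_mul_X_pow {a : Fin (m + 1) → ℂ} {b : Fin m → ℂ}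
    {lam r : Fin (m + 1) → ℂ} (hs : IsSpectralData (tridiag a b) lam r) {i : ℕ}
    (hi : i ≤ m + 1) (t : ℕ) (ht : t < i) : moment lam r (topPoly a b i * X ^ t) = 0 := by
  rcases hi.eq_or_lt with rfl | hi
  · obtain ⟨R, L, hRL, hLR, hT, h0, h1⟩ := hs.exists_inverse
    rw [moment_apply]
    refine Finset.sum_eq_zero fun k _ => ?_
    rw [eval_mul, topPoly_eval_eq_zero hLR hT h0 h1, zero_mul, mul_zero]
  induction t using Nat.strong_induction_on with
  | _ t iht =>
  have h2 : moment lam r (topPoly a b i * topPoly a b t) = 0 := by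
    rw [moment_topPoly_mul_topPoly hs hi (by omega), if_neg (by omega)]
  have h3 : moment lam r (topPoly a b i * (X ^ t - topPoly a b t)) = 0 := by
    refine moment_mul_eq_zero (fun s hs => iht s hs (by omega)) ?_
    have hd : (X ^ t : ℂ[X]).degree = (topPoly a b t).degree := by
      rw [degree_X_pow, degree_eq_natDegree (topPoly_monic a b t).ne_zero, natDegree_topPoly]
    have := degree_sub_lt_left hd (pow_ne_zero _ X_ne_zero)
      (by simp [(topPoly_monic a b t).leadingCoeff])
    rwa [degree_X_pow] at this
  rw [mul_sub, map_sub, h2, sub_zero] at h3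
  exact h3

/-- A nonzero `p` in the kernel of a Hankel matrix, paired with the recurrence polynomial of its own
degree, gives its leading coefficient times a product of subdiagonal entries, which is not zero. -/
lemma Admissible.nonDegenerate {lam r : Fin (m + 1) → ℂ} (h : Admissible lam r) :
    NonDegenerate lam r := by
  obtain ⟨a, b, hb, hs⟩ := h
  refine ⟨hs.1, hs.sum_eq_one, fun i hi => hankel_det_ne_zero_iff.2 fun p hp hpt => ?_⟩
  by_contra hp0
  have hpd : p.natDegree < m + 1 :=
    lt_of_lt_of_le ((natDegree_lt_iff_degree_lt hp0).2 hp) hi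
  set q := topPoly a b p.natDegree with hq
  have hqm : q.Monic := topPoly_monic a b _
  have hqd : q.natDegree = p.natDegree := natDegree_topPoly a b _
  have hqq : moment lam r (q * q) = subProd b p.natDegree := by
    rw [hq, moment_topPoly_mul_topPoly hs hpd hpd, if_pos rfl]
  have h4 : moment lam r (p * q) = 0 := by
    refine moment_mul_eq_zero hpt ?_
    rw [degree_eq_natDegree hqm.ne_zero, hqd, ← degree_eq_natDegree hp0]
    exact hp
  have h5 : moment lam r (q * (p - C p.leadingCoeff * q)) = 0 := by
    refine moment_mul_eq_zero (moment_topPoly_mul_X_pow hs hpd.le) ?_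
    have hlc : p.leadingCoeff ≠ 0 := leadingCoeff_ne_zero.2 hp0
    have hd : p.degree = (C p.leadingCoeff * q).degree := by
      rw [degree_C_mul hlc, degree_eq_natDegree hqm.ne_zero, hqd, ← degree_eq_natDegree hp0]
    have := degree_sub_lt_left hd hp0 (by simp [hqm.leadingCoeff])
    rwa [degree_eq_natDegree hp0] at this
  rw [mul_sub, map_sub, mul_comm q p, h4, zero_sub, mul_left_comm, ← smul_eq_C_mul, map_smul,
    hqq, neg_eq_zero, smul_eq_mul, mul_eq_zero, leadingCoeff_eq_zero] at h5
  exact h5.elim hp0 (subProd_ne_zero hb _)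

/-- The values of monic polynomials of degrees `0, …, m` at the nodes have the Vandermonde
determinant `V`. Hence `det R = V * ∏ r` and `det L * ∏ subProd = V`, and `det R * det L = 1` leaves
`∏ subProd = (∏ r) * V ^ 2`. -/
lemma prod_weights_mul_vandermonde_sq {a : Fin (m + 1) → ℂ} {b : Fin m → ℂ}
    {lam r : Fin (m + 1) → ℂ} (hs : IsSpectralData (tridiag a b) lam r) :
    ∏ k : Fin m, b k ^ (k.1 + 1) = (∏ k, r k) * (Matrix.vandermonde lam).det ^ 2 := by
  obtain ⟨R, L, hRL, hLR, hT, h0, h1⟩ := hs.exists_inverse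
  set p : Fin (m + 1) → ℂ[X] := fun j => topPoly a b j.1 with hp
  have hpm : ∀ j, (p j).Monic := fun j => topPoly_monic a b j.1
  have hpd : ∀ j, (p j).natDegree = j.1 := fun j => natDegree_topPoly a b j.1
  have hpR := fun j : Fin (m + 1) => (eigenvector_eq_topPoly hLR hT h0 h1 j.1 j.2).1
  have hpL := fun j : Fin (m + 1) => (eigenvector_eq_topPoly hLR hT h0 h1 j.1 j.2).2
  have hV : (Matrix.of fun i j : Fin (m + 1) => (p j).eval (lam i)).det =
      (Matrix.vandermonde lam).det :=
    (Matrix.det_eval_matrixOfPolynomials_eq_det_vandermonde lam p hpd hpm).symm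
  have eR : R = ((Matrix.of fun i j : Fin (m + 1) => (p j).eval (lam i)).transpose *
      Matrix.diagonal r) := by
    ext j k
    rw [Matrix.mul_diagonal, Matrix.transpose_apply, Matrix.of_apply]
    exact (hpR j k).trans (mul_comm _ _)
  have eL : L * Matrix.diagonal (fun j : Fin (m + 1) => subProd b j.1) =
      (Matrix.of fun i j : Fin (m + 1) => (p j).eval (lam i)) := by
    ext k j
    rw [Matrix.mul_diagonal, Matrix.of_apply]
    exact hpL j k
  have dR := congrArg Matrix.det eR
  have dL := congrArg Matrix.det eL
  have dRL := congrArg Matrix.det hRL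
  rw [Matrix.det_mul, Matrix.det_transpose, hV, Matrix.det_diagonal] at dR
  rw [Matrix.det_mul, hV, Matrix.det_diagonal, prod_subProd] at dL
  rw [Matrix.det_mul, Matrix.det_one] at dRL
  linear_combination (∏ k : Fin m, b k ^ (k.1 + 1)) * (-dRL) + R.det * dL +
    (Matrix.vandermonde lam).det * dR

end

section

/-! ### Almost all weights are admissible -/

open Polynomial

variable {m : ℕ}

/-- Pairing a kernel polynomial with the product of `X - lam j` over the other nodes of the support
isolates its value at one node. It therefore vanishes at as many nodes as the size of the Hankel
matrix, and its degree is smaller. -/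
lemma hankel_det_ne_zero_of_support {n : ℕ} {lam r : Fin n → ℂ} (hlam : Function.Injective lam)
    {S : Finset (Fin n)} (hS : ∀ k, r k ≠ 0 ↔ k ∈ S) : (hankel lam r S.card).det ≠ 0 := by
  refine hankel_det_ne_zero_iff.2 fun p hp hpt => ?_
  refine eq_zero_of_degree_lt_of_eval_index_eq_zero (s := S) (v := lam) hlam.injOn hp fun k hk => ?_
  have h0 : moment lam r (p * ∏ j ∈ S.erase k, (X - C (lam j))) = 0 := by
    refine moment_mul_eq_zero hpt ?_
    rw [degree_prod]
    simp only [degree_X_sub_C, Finset.sum_const, Finset.card_erase_of_mem hk]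
    rw [nsmul_one]
    have : 0 < S.card := Finset.card_pos.2 ⟨k, hk⟩
    exact_mod_cast Nat.sub_lt this one_pos
  rw [moment_apply, Finset.sum_eq_single k] at h0
  · rw [eval_mul, eval_prod] at h0
    have h2 : ∏ j ∈ S.erase k, eval (lam k) (X - C (lam j)) ≠ 0 := by
      refine Finset.prod_ne_zero_iff.2 fun j hj => ?_
      rw [eval_sub, eval_X, eval_C, sub_ne_zero]
      exact fun e => (Finset.ne_of_mem_erase hj) (hlam e).symm
    have h3 := (hS k).2 hk
    exact (mul_eq_zero.1 ((mul_eq_zero.1 h0).resolve_left h3)).resolve_right h2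
  · intro j _ hjk
    by_cases hj : j ∈ S
    · rw [eval_mul, eval_prod, Finset.prod_eq_zero (Finset.mem_erase.2 ⟨hjk, hj⟩) (by simp)]
      simp
    · have : r j = 0 := by
        by_contra h
        exact hj ((hS j).1 h)
      rw [this, zero_mul]
  · simp

lemma sum_complete (r : Fin m → ℂ) : ∑ k, complete r k = 1 := by
  simp [complete, Fin.sum_univ_castSucc]

lemma complete_add_smul (r : Fin m → ℂ) (v : Fin (m + 1) → ℂ) (hv : ∑ k, v k = 0) (t : ℂ) :
    complete (r + t • fun k => v k.castSucc) = complete r + t • v := by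
  funext k
  rw [Fin.sum_univ_castSucc] at hv
  refine Fin.lastCases ?_ (fun k => ?_) k
  · simp only [complete, Fin.snoc_last, Pi.add_apply, Pi.smul_apply, smul_eq_mul,
      Finset.sum_add_distrib, ← Finset.mul_sum]
    linear_combination -t * hv
  · simp [complete]

lemma hankel_add_smul {n : ℕ} (lam r v : Fin n → ℂ) (t : ℂ) (i : ℕ) :
    hankel lam (r + t • v) i = t • hankel lam v i + hankel lam r i := by
  ext s u
  simp only [hankel, Matrix.of_apply, Pi.add_apply, Pi.smul_apply, Matrix.add_apply,
    Matrix.smul_apply, smul_eq_mul, Finset.mul_sum, ← Finset.sum_add_distrib]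
  exact Finset.sum_congr rfl fun k _ => by ring

/-- The determinant is a polynomial in `t` whose top coefficient is `det A`. -/
lemma finite_det_smul_add_eq_zero {ι : Type*} [Fintype ι] [DecidableEq ι] (A B : Matrix ι ι ℂ)
    (hA : A.det ≠ 0) : {t : ℂ | (t • A + B).det = 0}.Finite := by
  set p : ℂ[X] := ((X : ℂ[X]) • A.map C + B.map C).det with hp
  have hp0 : p ≠ 0 := fun h => by
    have := coeff_det_X_add_C_card A B
    rw [← hp, h, coeff_zero] at this
    exact hA this.symm
  refine (p.rootSet_finite ℂ).subset fun t ht => ?_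
  rw [mem_rootSet]
  refine ⟨hp0, ?_⟩
  rw [coe_aeval_eq_eval, hp, ← coe_evalRingHom, RingHom.map_det, ← ht.out]
  congr 1
  ext i j
  change eval t (X * C (A i j) + C (B i j)) = t * A i j + B i j
  rw [eval_add, eval_mul, eval_X, eval_C, eval_C]

lemma continuous_complete : Continuous (complete : (Fin m → ℂ) → Fin (m + 1) → ℂ) := by
  refine continuous_pi fun k => ?_
  refine Fin.lastCases ?_ (fun k => ?_) k
  · simp only [complete, Fin.snoc_last]
    fun_prop
  · simp only [complete, Fin.snoc_castSucc]
    fun_prop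

lemma continuous_hankel_det {n : ℕ} {α : Type*} [TopologicalSpace α] {lam r : α → Fin n → ℂ}
    (hlam : Continuous lam) (hr : Continuous r) (i : ℕ) :
    Continuous fun x => (hankel (lam x) (r x) i).det := by
  refine Continuous.matrix_det (continuous_matrix fun s t => ?_)
  simp only [hankel, Matrix.of_apply]
  fun_prop

/-- Along each line in a fixed direction `v` of total mass zero, the determinant is a polynomial in
the parameter with top coefficient the Hankel determinant of `v`. It is enough that `v` has exactly
`i` nonzero entries; then each line meets the bad set in finitely many points. For `i = 1` no such
`v` exists, but the determinant is the total mass `1`. -/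
lemma ae_hankel_det_ne_zero {lam : Fin (m + 1) → ℂ} (hlam : Function.Injective lam) {i : ℕ}
    (hi : i ≤ m + 1) : ∀ᵐ r : Fin m → ℂ, (hankel lam (complete r) i).det ≠ 0 := by
  rcases i with _ | i
  · simp
  rcases i with _ | i
  · simp [hankel, sum_complete, Matrix.det_unique]
  have hm : 0 < m := by omega
  -- The direction has `i + 1` ones after its first entry, and that entry `-s` cancels their sum;
  -- its support is the set of the first `i + 2` indices.
  set s : ℂ := ∑ k : Fin m, if k.1 < i + 1 then 1 else 0 with hs
  have hs0 : s ≠ 0 := by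
    rw [hs, Finset.sum_boole, Nat.cast_ne_zero]
    exact (Finset.card_pos.2 ⟨⟨0, hm⟩, by simp⟩).ne'
  set v : Fin (m + 1) → ℂ := Fin.cons (-s) fun k => if k.1 < i + 1 then 1 else 0 with hv
  have hv0 : ∑ k, v k = 0 := by
    rw [Fin.sum_univ_succ]
    simp [hv, hs]
  have hdet : (hankel lam v (i + 2)).det ≠ 0 := by
    have hcard : (Finset.univ.filter fun k : Fin (m + 1) => k.1 < i + 2).card = i + 2 := by
      rw [Fin.card_filter_val_lt]
      omega
    rw [← hcard]
    refine hankel_det_ne_zero_of_support hlam fun k => ?_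
    refine Fin.cases ?_ (fun k => ?_) k
    · simp [hv, hs0]
    · simp [hv]
  have hmeas : MeasurableSet {r : Fin m → ℂ | (hankel lam (complete r) (i + 2)).det ≠ 0} := by
    have hc := continuous_hankel_det (continuous_const (y := lam)) (continuous_complete (m := m))
      (i + 2)
    exact (isOpen_ne_fun hc continuous_const).measurableSet
  refine ae_mem_of_ae_add_linearMap_mem
    (LinearMap.toSpanSingleton ℝ (Fin m → ℂ) fun k => v k.castSucc) volume volume hmeas
    fun r => ?_
  have hfin := finite_det_smul_add_eq_zero _ (hankel lam (complete r) (i + 2)) hdet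
  have hfin' : {t : ℝ | ((t : ℂ) • hankel lam v (i + 2) +
      hankel lam (complete r) (i + 2)).det = 0}.Finite :=
    hfin.preimage Complex.ofReal_injective.injOn
  filter_upwards [compl_mem_ae_iff.2 (hfin'.measure_zero volume)] with t ht
  intro h
  apply ht
  have e : r + (LinearMap.toSpanSingleton ℝ (Fin m → ℂ) fun k => v k.castSucc) t =
      r + (t : ℂ) • fun k : Fin m => v k.castSucc := by
    funext k
    simp
  simp only [Set.mem_ofPred_eq, e, complete_add_smul r v hv0, hankel_add_smul] at h ⊢
  exact h

lemma ae_nonDegenerate {lam : Fin (m + 1) → ℂ} (hlam : Function.Injective lam) :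
    ∀ᵐ r : Fin m → ℂ, NonDegenerate lam (complete r) := by
  have h : ∀ᵐ r : Fin m → ℂ, ∀ i : Fin (m + 2), (hankel lam (complete r) i.1).det ≠ 0 :=
    ae_all_iff.2 fun i => ae_hankel_det_ne_zero hlam (by omega)
  filter_upwards [h] with r hr
  exact ⟨hlam, sum_complete r, fun i hi => hr ⟨i, by omega⟩⟩

lemma ae_admissible {lam : Fin (m + 1) → ℂ} (hlam : Function.Injective lam) :
    ∀ᵐ r : Fin m → ℂ, Admissible lam (complete r) :=
  (ae_nonDegenerate hlam).mono fun _ h => .of_nonDegenerate h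

end

section

/-! ### The Schur triangulation and normality -/

section Schur

open Matrix

variable {n : ℕ}

lemma BlockTriangular.diag_mul {A B : Matrix (Fin n) (Fin n) ℂ} (hA : A.BlockTriangular id)
    (hB : B.BlockTriangular id) (i : Fin n) : (A * B) i i = A i i * B i i := by
  rw [Matrix.mul_apply, Finset.sum_eq_single i]
  · intro j _ hj
    rcases lt_or_gt_of_ne hj with h | h
    · rw [hA (i := i) (j := j) h, zero_mul]
    · rw [hB (i := j) (j := i) h, mul_zero]
  · simp

/-- A diagonalized matrix is unitarily similar to an upper triangular matrix with the eigenvalues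
on the diagonal. -/
lemma exists_unitary_triangular {R : Matrix (Fin n) (Fin n) ℂ} (hR : IsUnit R.det)
    (lam : Fin n → ℂ) :
    ∃ U S : Matrix (Fin n) (Fin n) ℂ, Uᴴ * U = 1 ∧ U * Uᴴ = 1 ∧
      R * diagonal lam * R⁻¹ = U * S * Uᴴ ∧ S.BlockTriangular id ∧ ∀ i, S i i = lam i := by
  set f : Fin n → EuclideanSpace ℂ (Fin n) := fun j => WithLp.toLp 2 (R.col j) with hf
  -- Gram–Schmidt on the columns of `R` gives `R = U * W` with `U` unitary and `W` upper triangular,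
  -- so `R Λ R⁻¹ = U * (W Λ W⁻¹) * Uᴴ` is a Schur form.
  set e := InnerProductSpace.gramSchmidtOrthonormalBasis (𝕜 := ℂ) (by simp) f with he
  set U : Matrix (Fin n) (Fin n) ℂ := Matrix.of fun i j => e j i with hU
  have hUU : Uᴴ * U = 1 := by
    ext i j
    have := orthonormal_iff_ite.1 e.orthonormal i j
    rw [Matrix.one_apply, ← this, Matrix.mul_apply, PiLp.inner_apply]
    refine Finset.sum_congr rfl fun k _ => ?_
    simp [hU, mul_comm]
  have hUU' : U * Uᴴ = 1 := mul_eq_one_comm.1 hUU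
  set W := Uᴴ * R with hW
  have hWt : W.BlockTriangular id := by
    intro i j hij
    have := InnerProductSpace.gramSchmidtOrthonormalBasis_inv_triangular (𝕜 := ℂ) (by simp) f hij
    rw [← he, PiLp.inner_apply] at this
    rw [hW, Matrix.mul_apply, ← this]
    refine Finset.sum_congr rfl fun k _ => ?_
    simp [hU, hf, mul_comm]
  have hWR : R = U * W := by rw [hW, ← mul_assoc, hUU', one_mul]
  have hWu : IsUnit W.det := by
    rw [hWR, det_mul] at hR
    exact isUnit_of_mul_isUnit_right hR
  have hWi : W⁻¹.BlockTriangular id := by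
    have : Invertible W := invertibleOfIsUnitDet W hWu
    exact blockTriangular_inv_of_blockTriangular hWt
  have hD : (diagonal lam).BlockTriangular (id : Fin n → Fin n) := blockTriangular_diagonal lam
  refine ⟨U, W * diagonal lam * W⁻¹, hUU, hUU', ?_, (hWt.mul hD).mul hWi, fun i => ?_⟩
  · have : R⁻¹ = W⁻¹ * Uᴴ := by
      rw [hWR, Matrix.mul_inv_rev, inv_eq_left_inv hUU]
    rw [this, hWR]
    simp only [mul_assoc]
  · rw [BlockTriangular.diag_mul (hWt.mul hD) hWi, BlockTriangular.diag_mul hWt hD,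
      diagonal_apply_eq]
    have := BlockTriangular.diag_mul hWt hWi i
    rw [mul_nonsing_inv W hWu, one_apply_eq] at this
    linear_combination -lam i * this

lemma sum_norm_sq_eq_trace (T : Matrix (Fin n) (Fin n) ℂ) :
    ((∑ i, ∑ j, ‖T i j‖ ^ 2 : ℝ) : ℂ) = (T * Tᴴ).trace := by
  simp [Matrix.trace, Matrix.mul_apply, Complex.mul_conj, Complex.normSq_eq_norm_sq]

lemma sum_norm_sq_unitary_conj {U S : Matrix (Fin n) (Fin n) ℂ} (hU : Uᴴ * U = 1) :
    ∑ i, ∑ j, ‖(U * S * Uᴴ) i j‖ ^ 2 = ∑ i, ∑ j, ‖S i j‖ ^ 2 := by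
  apply Complex.ofReal_injective
  rw [sum_norm_sq_eq_trace, sum_norm_sq_eq_trace]
  simp only [conjTranspose_mul, conjTranspose_conjTranspose]
  have : U * S * Uᴴ * (U * (Sᴴ * Uᴴ)) = U * (S * Sᴴ * Uᴴ) := by
    simp only [mul_assoc]
    rw [← mul_assoc Uᴴ U, hU, one_mul]
  rw [this, trace_mul_comm, mul_assoc, hU, mul_one]

/-- Row by row from the top: once the rows above `i` are diagonal, column `i` has only its diagonal
entry. Normality equates the norms of row `i` and column `i`, so the rest of row `i` vanishes. -/
lemma eq_zero_of_triangular_of_normal {S : Matrix (Fin n) (Fin n) ℂ}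
    (hS : S.BlockTriangular id) (hn : Sᴴ * S = S * Sᴴ) {i j : Fin n} (hij : i ≠ j) :
    S i j = 0 := by
  have key : ∀ N : ℕ, ∀ i : Fin n, i.1 < N → ∀ j, i ≠ j → S i j = 0 := by
    intro N
    induction N with
    | zero => intro i hi; omega
    | succ N ih =>
      intro i hi j hij
      have hcol : ∀ k, k ≠ i → S k i = 0 := by
        intro k hk
        rcases lt_or_gt_of_ne hk with h | h
        · exact ih k (lt_of_lt_of_le h (Nat.lt_succ_iff.1 hi)) i hk
        · exact hS (i := k) (j := i) h
      have e := congrFun (congrFun hn i) i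
      rw [Matrix.mul_apply, Matrix.mul_apply] at e
      simp only [conjTranspose_apply, RCLike.star_def] at e
      have e2 : ∑ k, ‖S k i‖ ^ 2 = ∑ k, ‖S i k‖ ^ 2 := by
        apply Complex.ofReal_injective
        push_cast
        simpa [Complex.mul_conj, Complex.conj_mul', Complex.normSq_eq_norm_sq] using e
      rw [Finset.sum_eq_single i (fun k _ hk => by rw [hcol k hk]; simp) (by simp),
        ← Finset.add_sum_erase _ _ (Finset.mem_univ i)] at e2
      have e3 : ∑ k ∈ Finset.univ.erase i, ‖S i k‖ ^ 2 = 0 := by linarith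
      rw [Finset.sum_eq_zero_iff_of_nonneg fun _ _ => by positivity] at e3
      simpa using e3 j (Finset.mem_erase.2 ⟨hij.symm, Finset.mem_univ j⟩)
  exact key (i.1 + 1) i (Nat.lt_succ_self _) j hij

/-- Schur's inequality for a diagonalized matrix, with the case of equality. -/
lemma schur_inequality {R : Matrix (Fin n) (Fin n) ℂ} (hR : IsUnit R.det) (lam : Fin n → ℂ) :
    ∑ k, ‖lam k‖ ^ 2 ≤ ∑ i, ∑ j, ‖(R * diagonal lam * R⁻¹) i j‖ ^ 2 ∧
      (∑ i, ∑ j, ‖(R * diagonal lam * R⁻¹) i j‖ ^ 2 = ∑ k, ‖lam k‖ ^ 2 ↔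
        IsStarNormal (R * diagonal lam * R⁻¹)) := by
  obtain ⟨U, S, hU, hU', hT, hS, hdiag⟩ := exists_unitary_triangular hR lam
  rw [hT, sum_norm_sq_unitary_conj hU]
  have hsum : ∑ i, ∑ j, ‖S i j‖ ^ 2 =
      ∑ k, ‖lam k‖ ^ 2 + ∑ i, ∑ j ∈ Finset.univ.erase i, ‖S i j‖ ^ 2 := by
    rw [← Finset.sum_add_distrib]
    refine Finset.sum_congr rfl fun i _ => ?_
    rw [← Finset.add_sum_erase _ _ (Finset.mem_univ i), hdiag]
  have hnn : 0 ≤ ∑ i, ∑ j ∈ Finset.univ.erase i, ‖S i j‖ ^ 2 := by positivity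
  refine ⟨by linarith, ?_⟩
  have hnormal : IsStarNormal (U * S * Uᴴ) ↔ Sᴴ * S = S * Sᴴ := by
    have e1 : (U * S * Uᴴ)ᴴ * (U * S * Uᴴ) = U * (Sᴴ * S) * Uᴴ := by
      simp only [conjTranspose_mul, conjTranspose_conjTranspose, mul_assoc]
      rw [← mul_assoc Uᴴ U, hU, one_mul]
    have e2 : (U * S * Uᴴ) * (U * S * Uᴴ)ᴴ = U * (S * Sᴴ) * Uᴴ := by
      simp only [conjTranspose_mul, conjTranspose_conjTranspose, mul_assoc]
      rw [← mul_assoc Uᴴ U, hU, one_mul]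
    rw [isStarNormal_iff, Commute, SemiconjBy, star_eq_conjTranspose, e1, e2]
    refine ⟨fun h => ?_, fun h => by rw [h]⟩
    have := congrArg (fun M => Uᴴ * M * U) h
    simp only [mul_assoc, hU, mul_one] at this
    simpa only [← mul_assoc, hU, one_mul] using this
  rw [hnormal]
  constructor
  · intro h
    have h0 : ∑ i, ∑ j ∈ Finset.univ.erase i, ‖S i j‖ ^ 2 = 0 := by linarith
    have hSd : S = diagonal lam := by
      ext i j
      rcases eq_or_ne i j with rfl | hij
      · rw [hdiag, diagonal_apply_eq]
      rw [diagonal_apply_ne _ hij]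
      rw [Finset.sum_eq_zero_iff_of_nonneg fun _ _ => by positivity] at h0
      have h1 := h0 i (Finset.mem_univ i)
      rw [Finset.sum_eq_zero_iff_of_nonneg fun _ _ => by positivity] at h1
      simpa using h1 j (Finset.mem_erase.2 ⟨hij.symm, Finset.mem_univ j⟩)
    rw [hSd, diagonal_conjTranspose, diagonal_mul_diagonal, diagonal_mul_diagonal]
    congr 1
    funext i
    exact mul_comm _ _
  · intro h
    rw [hsum]
    have h0 : ∑ i, ∑ j ∈ Finset.univ.erase i, ‖S i j‖ ^ 2 = 0 := by
      refine Finset.sum_eq_zero fun i _ => Finset.sum_eq_zero fun j hj => ?_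
      rw [eq_zero_of_triangular_of_normal hS h (Finset.ne_of_mem_erase hj).symm]
      simp
    rw [h0, add_zero]

end Schur

lemma g_nonneg_and_eq_zero_iff {m : ℕ} {lam r : Fin (m + 1) → ℂ} (h : Admissible lam r) :
    0 ≤ g lam r ∧ (g lam r = 0 ↔ IsStarNormal (reconstruct lam r)) := by
  obtain ⟨a, b, hb, hs⟩ := h
  have hrec := reconstruct_eq hb hs
  obtain ⟨-, R, hR, hT, -, -⟩ := hs
  obtain ⟨h1, h2⟩ := schur_inequality hR lam
  rw [g, hrec, hT, ← h2]
  constructor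
  · linarith
  · constructor <;> intro h <;> linarith

/-! ### Invariance of `g` -/

lemma norm_tridiag_congr {m : ℕ} {a a' : Fin (m + 1) → ℂ} {b b' : Fin m → ℂ}
    (ha : ∀ k, ‖a k‖ = ‖a' k‖) (hb : ∀ k, ‖b k‖ = ‖b' k‖) (i j : Fin (m + 1)) :
    ‖tridiag a b i j‖ = ‖tridiag a' b' i j‖ := by
  simp only [tridiag, Matrix.of_apply]
  split_ifs
  · exact ha _
  · rfl
  · exact hb _
  · rfl

/-- Multiplying `lam` by `c` replaces `T` by `c D T D⁻¹` for a diagonal `D` of powers of `c`, chosen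
to keep the superdiagonal `1`. So `a` scales by `c` and `b` by `c ^ 2`, and for `‖c‖ = 1` no modulus
changes. The relation for `rPrev` carries a factor `c` on the left to avoid the exponent `j - 1` at
`j = 0`. -/
lemma recState_mul {n : ℕ} (lam r : Fin n → ℂ) {c : ℂ} (hc : c ≠ 0) (j : ℕ) :
    (∀ k, (recState (fun i => lam i * c) r j).rCur k = c ^ j * (recState lam r j).rCur k) ∧
    (∀ k, (recState (fun i => lam i * c) r j).lCur k = (c ^ j)⁻¹ * (recState lam r j).lCur k) ∧
    (∀ k, c * (recState (fun i => lam i * c) r j).rPrev k =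
      c ^ j * (recState lam r j).rPrev k) ∧
    (∀ k, (recState (fun i => lam i * c) r j).lPrev k =
      c * (c ^ j)⁻¹ * (recState lam r j).lPrev k) ∧
    (recState (fun i => lam i * c) r j).sub = c ^ 2 * (recState lam r j).sub ∧
    (recState (fun i => lam i * c) r j).diag (fun i => lam i * c) =
      c * (recState lam r j).diag lam := by
  induction j with
  | zero => simp [recState, RecState.diag, Finset.mul_sum, mul_comm, mul_left_comm]
  | succ j ih =>
    set s := recState lam r j with hs
    set s' := recState (fun i => lam i * c) r j with hs'
    obtain ⟨i1, i2, i3, i4, i5, i6⟩ := ih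
    have hn : recState lam r (j + 1) = s.next lam := rfl
    have hn' : recState (fun i => lam i * c) r (j + 1) = s'.next (fun i => lam i * c) := rfl
    have c1 : ∀ k, (recState (fun i => lam i * c) r (j + 1)).rCur k =
        c ^ (j + 1) * (recState lam r (j + 1)).rCur k := by
      intro k
      simp only [hn, hn', RecState.next, i6, i1, i5]
      linear_combination (-c * s.sub) * i3 k
    have c5 : (recState (fun i => lam i * c) r (j + 1)).sub =
        c ^ 2 * (recState lam r (j + 1)).sub := by
      have e : (recState lam r (j + 1)).sub =
        ∑ k, (recState lam r (j + 1)).rCur k * lam k * s.lCur k := rfl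
      have e' : (recState (fun i => lam i * c) r (j + 1)).sub =
        ∑ k, (recState (fun i => lam i * c) r (j + 1)).rCur k * (lam k * c) * s'.lCur k := rfl
      rw [e, e', Finset.mul_sum]
      refine Finset.sum_congr rfl fun k _ => ?_
      rw [c1, i2]
      field_simp
      ring
    have c2 : ∀ k, (recState (fun i => lam i * c) r (j + 1)).lCur k =
        (c ^ (j + 1))⁻¹ * (recState lam r (j + 1)).lCur k := by
      intro k
      have e : (recState lam r (j + 1)).lCur k =
        (lam k * s.lCur k - s.diag lam * s.lCur k - s.lPrev k) /
          (recState lam r (j + 1)).sub := rfl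
      have e' : (recState (fun i => lam i * c) r (j + 1)).lCur k =
        (lam k * c * s'.lCur k - s'.diag (fun i => lam i * c) * s'.lCur k - s'.lPrev k) /
          (recState (fun i => lam i * c) r (j + 1)).sub := rfl
      rw [e, e', c5, i6, i2, i4, div_eq_mul_inv, div_eq_mul_inv, mul_inv, pow_succ, mul_inv]
      field_simp
      ring
    refine ⟨c1, c2, fun k => ?_, fun k => ?_, c5, ?_⟩
    · simp only [hn, hn', RecState.next, i1]
      ring
    · simp only [hn, hn', RecState.next, i2]
      field_simp
      ring
    · simp only [RecState.diag, c1, c2, Finset.mul_sum]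
      refine Finset.sum_congr rfl fun k _ => ?_
      field_simp

lemma g_mul {m : ℕ} (lam r : Fin (m + 1) → ℂ) {c : ℂ} (hc : ‖c‖ = 1) :
    g (fun j => lam j * c) r = g lam r := by
  have hc0 : c ≠ 0 := fun h => by simp [h] at hc
  have h := recState_mul lam r hc0
  have hT : ∀ i j, ‖reconstruct (fun j => lam j * c) r i j‖ = ‖reconstruct lam r i j‖ := by
    refine norm_tridiag_congr (fun k => ?_) fun k => ?_
    · rw [(h _).2.2.2.2.2, norm_mul, hc, one_mul]
    · rw [(h _).2.2.2.2.1, norm_mul, norm_pow, hc, one_pow, one_mul]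
  simp only [g, hT, norm_mul, hc, mul_one]

/-- The recurrence acts on each node separately except through sums over all nodes, which do not see
their order. -/
lemma recState_comp_perm {n : ℕ} (lam r : Fin n → ℂ) (σ : Equiv.Perm (Fin n)) (j : ℕ) :
    (recState (lam ∘ σ) (r ∘ σ) j).rCur = (recState lam r j).rCur ∘ σ ∧
    (recState (lam ∘ σ) (r ∘ σ) j).lCur = (recState lam r j).lCur ∘ σ ∧
    (recState (lam ∘ σ) (r ∘ σ) j).rPrev = (recState lam r j).rPrev ∘ σ ∧
    (recState (lam ∘ σ) (r ∘ σ) j).lPrev = (recState lam r j).lPrev ∘ σ ∧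
    (recState (lam ∘ σ) (r ∘ σ) j).sub = (recState lam r j).sub ∧
    (recState (lam ∘ σ) (r ∘ σ) j).diag (lam ∘ σ) = (recState lam r j).diag lam := by
  induction j with
  | zero =>
    refine ⟨rfl, rfl, rfl, rfl, rfl, ?_⟩
    exact Equiv.sum_comp σ fun k => r k * lam k * (1 : Fin n → ℂ) k
  | succ j ih =>
    set s := recState lam r j with hs
    set s' := recState (lam ∘ σ) (r ∘ σ) j with hs'
    obtain ⟨i1, i2, i3, i4, i5, i6⟩ := ih
    have hn : recState lam r (j + 1) = s.next lam := rfl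
    have hn' : recState (lam ∘ σ) (r ∘ σ) (j + 1) = s'.next (lam ∘ σ) := rfl
    have c1 : (recState (lam ∘ σ) (r ∘ σ) (j + 1)).rCur = (recState lam r (j + 1)).rCur ∘ σ := by
      funext k
      simp only [hn, hn', RecState.next, i6, i1, i3, i5, Function.comp_apply]
    have c5 : (recState (lam ∘ σ) (r ∘ σ) (j + 1)).sub = (recState lam r (j + 1)).sub := by
      have e' : (recState (lam ∘ σ) (r ∘ σ) (j + 1)).sub =
        ∑ k, (recState (lam ∘ σ) (r ∘ σ) (j + 1)).rCur k * (lam ∘ σ) k * s'.lCur k := rfl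
      rw [e', c1, i2]
      exact Equiv.sum_comp σ fun k => (recState lam r (j + 1)).rCur k * lam k * s.lCur k
    have c2 : (recState (lam ∘ σ) (r ∘ σ) (j + 1)).lCur = (recState lam r (j + 1)).lCur ∘ σ := by
      funext k
      have e : (recState lam r (j + 1)).lCur (σ k) =
        (lam (σ k) * s.lCur (σ k) - s.diag lam * s.lCur (σ k) - s.lPrev (σ k)) /
          (recState lam r (j + 1)).sub := rfl
      have e' : (recState (lam ∘ σ) (r ∘ σ) (j + 1)).lCur k =
        ((lam ∘ σ) k * s'.lCur k - s'.diag (lam ∘ σ) * s'.lCur k - s'.lPrev k) /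
          (recState (lam ∘ σ) (r ∘ σ) (j + 1)).sub := rfl
      rw [Function.comp_apply, e, e', c5, i6, i2, i4]
      rfl
    refine ⟨c1, c2, i1, i2, c5, ?_⟩
    simp only [RecState.diag, c1, c2]
    exact Equiv.sum_comp σ fun k =>
      (recState lam r (j + 1)).rCur k * lam k * (recState lam r (j + 1)).lCur k

lemma g_comp_perm {m : ℕ} (lam r : Fin (m + 1) → ℂ) (σ : Equiv.Perm (Fin (m + 1))) :
    g (lam ∘ σ) (r ∘ σ) = g lam r := by
  have h := recState_comp_perm lam r σ
  have hT : reconstruct (lam ∘ σ) (r ∘ σ) = reconstruct lam r := by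
    unfold reconstruct
    congr 1
    · funext k
      exact (h _).2.2.2.2.2
    · funext k
      exact (h _).2.2.2.2.1
  simp only [g, hT, Function.comp_apply]
  rw [Equiv.sum_comp σ fun k => ‖lam k‖ ^ 2]

end

section

/-! ### Rationality of `g` -/

variable {m : ℕ}

/-- A real function of the spectral parameters that is rational in their real and imaginary parts,
with a denominator that does not vanish at admissible parameters. -/
def IsRational (φ : (Fin (m + 1) → ℂ) → (Fin (m + 1) → ℂ) → ℝ) : Prop :=
  ∃ p q : MvPolynomial (Fin 4 × Fin (m + 1)) ℝ, ∀ lam r, Admissible lam r →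
    MvPolynomial.eval (realCoords lam r) q ≠ 0 ∧
    φ lam r = MvPolynomial.eval (realCoords lam r) p / MvPolynomial.eval (realCoords lam r) q

variable {φ ψ : (Fin (m + 1) → ℂ) → (Fin (m + 1) → ℂ) → ℝ}

lemma IsRational.const (c : ℝ) :
    IsRational (fun _ _ => c : (Fin (m + 1) → ℂ) → (Fin (m + 1) → ℂ) → ℝ) :=
  ⟨MvPolynomial.C c, 1, fun _ _ _ => by simp⟩

lemma IsRational.coord (x : Fin 4 × Fin (m + 1)) : IsRational fun lam r => realCoords lam r x :=
  ⟨MvPolynomial.X x, 1, fun _ _ _ => by simp⟩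

lemma IsRational.add (h : IsRational φ) (h' : IsRational ψ) :
    IsRational fun lam r => φ lam r + ψ lam r := by
  obtain ⟨p, q, h⟩ := h
  obtain ⟨p', q', h'⟩ := h'
  refine ⟨p * q' + p' * q, q * q', fun lam r hA => ?_⟩
  obtain ⟨h1, h2⟩ := h lam r hA
  obtain ⟨h1', h2'⟩ := h' lam r hA
  refine ⟨by simp [h1, h1'], ?_⟩
  change φ lam r + ψ lam r = _
  rw [h2, h2', map_add, map_mul, map_mul, map_mul]
  field_simp

lemma IsRational.mul (h : IsRational φ) (h' : IsRational ψ) :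
    IsRational fun lam r => φ lam r * ψ lam r := by
  obtain ⟨p, q, h⟩ := h
  obtain ⟨p', q', h'⟩ := h'
  refine ⟨p * p', q * q', fun lam r hA => ?_⟩
  obtain ⟨h1, h2⟩ := h lam r hA
  obtain ⟨h1', h2'⟩ := h' lam r hA
  refine ⟨by simp [h1, h1'], ?_⟩
  change φ lam r * ψ lam r = _
  rw [h2, h2', map_mul, map_mul]
  field_simp

lemma IsRational.inv (h : IsRational φ) (h0 : ∀ lam r, Admissible lam r → φ lam r ≠ 0) :
    IsRational fun lam r => (φ lam r)⁻¹ := by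
  obtain ⟨p, q, h⟩ := h
  refine ⟨q, p, fun lam r hA => ?_⟩
  obtain ⟨h1, h2⟩ := h lam r hA
  have h3 := h0 lam r hA
  change _ ∧ (φ lam r)⁻¹ = _
  rw [h2] at h3 ⊢
  exact ⟨fun e => h3 (by rw [e, zero_div]), inv_div _ _⟩

lemma IsRational.neg (h : IsRational φ) : IsRational fun lam r => -φ lam r := by
  simpa using (IsRational.const (-1)).mul h

lemma IsRational.sub (h : IsRational φ) (h' : IsRational ψ) :
    IsRational fun lam r => φ lam r - ψ lam r := by
  simpa [sub_eq_add_neg] using h.add h'.neg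

lemma IsRational.sum {ι : Type*} (s : Finset ι)
    {φ : ι → (Fin (m + 1) → ℂ) → (Fin (m + 1) → ℂ) → ℝ} (h : ∀ i, IsRational (φ i)) :
    IsRational fun lam r => ∑ i ∈ s, φ i lam r := by
  classical
  induction s using Finset.induction_on with
  | empty => simpa using IsRational.const 0
  | insert i s hi ih => simpa [Finset.sum_insert hi] using (h i).add ih

/-- A complex function of the spectral parameters whose real and imaginary parts are rational. -/
def IsComplexRational (φ : (Fin (m + 1) → ℂ) → (Fin (m + 1) → ℂ) → ℂ) : Prop :=
  (IsRational fun lam r => (φ lam r).re) ∧ IsRational fun lam r => (φ lam r).im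

section

variable {φ ψ : (Fin (m + 1) → ℂ) → (Fin (m + 1) → ℂ) → ℂ}

lemma IsComplexRational.const (c : ℂ) :
    IsComplexRational (fun _ _ => c : (Fin (m + 1) → ℂ) → (Fin (m + 1) → ℂ) → ℂ) :=
  ⟨.const _, .const _⟩

lemma IsComplexRational.sub (h : IsComplexRational φ) (h' : IsComplexRational ψ) :
    IsComplexRational fun lam r => φ lam r - ψ lam r :=
  ⟨by simpa using h.1.sub h'.1, by simpa using h.2.sub h'.2⟩

lemma IsComplexRational.mul (h : IsComplexRational φ) (h' : IsComplexRational ψ) :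
    IsComplexRational fun lam r => φ lam r * ψ lam r :=
  ⟨by simpa using (h.1.mul h'.1).sub (h.2.mul h'.2),
    by simpa using (h.1.mul h'.2).add (h.2.mul h'.1)⟩

lemma IsComplexRational.normSq (h : IsComplexRational φ) :
    IsRational fun lam r => Complex.normSq (φ lam r) := by
  simpa [Complex.normSq_apply] using (h.1.mul h.1).add (h.2.mul h.2)

lemma IsComplexRational.div (h : IsComplexRational φ) (h' : IsComplexRational ψ)
    (h0 : ∀ lam r, Admissible lam r → ψ lam r ≠ 0) :
    IsComplexRational fun lam r => φ lam r / ψ lam r := by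
  have hn := h'.normSq.inv fun lam r hA => by simpa using h0 lam r hA
  have hi : IsComplexRational fun lam r => (ψ lam r)⁻¹ :=
    ⟨by simpa [Complex.inv_re, div_eq_mul_inv] using h'.1.mul hn,
      by simpa [Complex.inv_im, div_eq_mul_inv] using h'.2.neg.mul hn⟩
  simpa [div_eq_mul_inv] using h.mul hi

lemma IsComplexRational.sum {ι : Type*} (s : Finset ι)
    {φ : ι → (Fin (m + 1) → ℂ) → (Fin (m + 1) → ℂ) → ℂ} (h : ∀ i, IsComplexRational (φ i)) :
    IsComplexRational fun lam r => ∑ i ∈ s, φ i lam r :=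
  ⟨by simpa [Complex.re_sum] using IsRational.sum s fun i => (h i).1,
    by simpa [Complex.im_sum] using IsRational.sum s fun i => (h i).2⟩

end

lemma isComplexRational_lam (k : Fin (m + 1)) : IsComplexRational fun lam _ => lam k :=
  ⟨IsRational.coord (0, k), IsRational.coord (1, k)⟩

lemma isComplexRational_weight (k : Fin (m + 1)) : IsComplexRational fun _ r => r k :=
  ⟨IsRational.coord (2, k), IsRational.coord (3, k)⟩

/-- These are the only quantities by which the recurrence divides, so their nonvanishing keeps every
denominator nonzero at admissible parameters. -/
lemma Admissible.sub_ne_zero {lam r : Fin (m + 1) → ℂ} (h : Admissible lam r) {j : ℕ}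
    (hj : j < m) : (recState lam r (j + 1)).sub ≠ 0 := by
  obtain ⟨a, b, hb, hs⟩ := h
  obtain ⟨R, L, hRL, hLR, hT, h0, h1⟩ := hs.exists_inverse
  rw [(recState_spec hb hLR hT h0 h1 (j + 1) (by omega)).2.2.2.2.1 (Nat.succ_pos j)]
  exact hb _

lemma isComplexRational_recState (j : ℕ) (hj : j < m + 1) :
    (∀ k, IsComplexRational fun lam r : Fin (m + 1) → ℂ => (recState lam r j).rCur k) ∧
    (∀ k, IsComplexRational fun lam r : Fin (m + 1) → ℂ => (recState lam r j).lCur k) ∧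
    (∀ k, IsComplexRational fun lam r : Fin (m + 1) → ℂ => (recState lam r j).rPrev k) ∧
    (∀ k, IsComplexRational fun lam r : Fin (m + 1) → ℂ => (recState lam r j).lPrev k) ∧
    (IsComplexRational fun lam r : Fin (m + 1) → ℂ => (recState lam r j).sub) ∧
    IsComplexRational fun lam r : Fin (m + 1) → ℂ => (recState lam r j).diag lam := by
  induction j with
  | zero =>
    refine ⟨isComplexRational_weight, fun _ => .const 1, fun _ => .const 0, fun _ => .const 0,
      .const 0, ?_⟩
    exact .sum _ fun k => ((isComplexRational_weight k).mul (isComplexRational_lam k)).mul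
      (.const 1)
  | succ j ih =>
    obtain ⟨i1, i2, i3, i4, i5, i6⟩ := ih (by omega)
    have c1 : ∀ k, IsComplexRational fun lam r : Fin (m + 1) → ℂ =>
        (recState lam r (j + 1)).rCur k := fun k =>
      (((i1 k).mul (isComplexRational_lam k)).sub (i6.mul (i1 k))).sub (i5.mul (i3 k))
    have c5 : IsComplexRational fun lam r : Fin (m + 1) → ℂ => (recState lam r (j + 1)).sub :=
      .sum _ fun k => ((c1 k).mul (isComplexRational_lam k)).mul (i2 k)
    have c2 : ∀ k, IsComplexRational fun lam r : Fin (m + 1) → ℂ =>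
        (recState lam r (j + 1)).lCur k := fun k =>
      ((((isComplexRational_lam k).mul (i2 k)).sub (i6.mul (i2 k))).sub (i4 k)).div c5
        fun lam r hA => hA.sub_ne_zero (by omega)
    exact ⟨c1, c2, i1, i2, c5,
      .sum _ fun k => ((c1 k).mul (isComplexRational_lam k)).mul (c2 k)⟩

lemma isRational_g : IsRational (m := m) g := by
  have hT : ∀ i j, IsComplexRational fun lam r : Fin (m + 1) → ℂ => reconstruct lam r i j := by
    intro i j
    unfold reconstruct tridiag
    simp only [Matrix.of_apply]
    split_ifs
    · exact (isComplexRational_recState _ (Fin.is_lt _)).2.2.2.2.2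
    · exact .const 1
    · exact (isComplexRational_recState _ (by omega)).2.2.2.2.1
    · exact .const 0
  have h := (((IsRational.sum Finset.univ fun i => IsRational.sum Finset.univ fun j =>
    (hT i j).normSq).sub (IsRational.sum Finset.univ fun j =>
      (isComplexRational_lam j).normSq)).mul (IsRational.const (2⁻¹ : ℝ)))
  have e : (g : (Fin (m + 1) → ℂ) → (Fin (m + 1) → ℂ) → ℝ) = fun lam r =>
      ((∑ i, ∑ j, Complex.normSq (reconstruct lam r i j)) - ∑ j, Complex.normSq (lam j)) *
        2⁻¹ := by
    funext lam r
    simp only [g, Complex.normSq_eq_norm_sq, div_eq_mul_inv]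
  rw [e]
  exact h

end

section

/-! ### Growth of the matrix when one eigenvalue tends to infinity -/

open Polynomial

variable {m : ℕ} {lam r : Fin (m + 1) → ℂ}

/-- The functional obtained from `moment lam r` by removing the node `lam j`. -/
def momentErase (lam r : Fin (m + 1) → ℂ) (j : Fin (m + 1)) : ℂ[X] →ₗ[ℂ] ℂ :=
  moment lam (Function.update r j 0)

/-- Isolates the moving node: the functional is a fixed one plus a multiple of the evaluation at
`z`, a perturbation of rank one. -/
lemma moment_update (lam r : Fin (m + 1) → ℂ) (j : Fin (m + 1)) (z : ℂ) (p : ℂ[X]) :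
    moment (Function.update lam j z) r p = momentErase lam r j p + r j * p.eval z := by
  rw [momentErase, moment_apply, moment_apply, ← Finset.add_sum_erase _ _ (Finset.mem_univ j),
    ← Finset.add_sum_erase _ _ (Finset.mem_univ j)]
  rw [Function.update_self, Function.update_self, zero_mul, zero_add, add_comm]
  congr 1
  refine Finset.sum_congr rfl fun k hk => ?_
  rw [Function.update_of_ne (Finset.ne_of_mem_erase hk),
    Function.update_of_ne (Finset.ne_of_mem_erase hk)]

lemma moment_eq_erase (lam r : Fin (m + 1) → ℂ) (j : Fin (m + 1)) (p : ℂ[X]) :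
    moment lam r p = momentErase lam r j p + r j * p.eval (lam j) := by
  rw [← moment_update, Function.update_eq_self]

lemma momentErase_mul_eq_zero {j : Fin (m + 1)} {p q : ℂ[X]} {i : ℕ}
    (h : ∀ t < i, momentErase lam r j (p * X ^ t) = 0) (hq : q.degree < i) :
    momentErase lam r j (p * q) = 0 :=
  moment_mul_eq_zero h hq

/-- If `r j = 0`, the product of `X - lam k` over the other nodes has degree `m` and is orthogonal
to everything, so the Hankel matrix of size `m + 1` is singular. -/
lemma NonDegenerate.weight_ne_zero (h : NonDegenerate lam r) (j : Fin (m + 1)) : r j ≠ 0 := by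
  intro hj
  have h1 := hankel_det_ne_zero_iff.1 (h.2.2 (m + 1) le_rfl)
    (∏ k ∈ Finset.univ.erase j, (X - C (lam k))) ?_ ?_
  · refine Finset.prod_ne_zero_iff.2 (fun k _ => X_sub_C_ne_zero (lam k)) h1
  · rw [degree_prod]
    simp only [degree_X_sub_C, Finset.sum_const, Finset.card_erase_of_mem (Finset.mem_univ j),
      Finset.card_univ, Fintype.card_fin, nsmul_one, Nat.add_sub_cancel]
    exact_mod_cast Nat.lt_succ_self m
  · intro t _
    rw [moment_apply]
    refine Finset.sum_eq_zero fun k _ => ?_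
    rcases eq_or_ne k j with rfl | hk
    · rw [hj, zero_mul]
    · rw [eval_mul, eval_prod,
        Finset.prod_eq_zero (Finset.mem_erase.2 ⟨hk, Finset.mem_univ k⟩) (by simp)]
      simp

/-! ### Polynomials orthogonal for the functional with one node removed -/

section Erase

variable {j : Fin (m + 1)} {s : ℕ} {U V : ℂ[X]}

/-- The full and the reduced functional differ by evaluation at `lam j`, so such a `U` is orthogonal
for the full functional, which is nondegenerate. Thus the kernel of each Hankel form of the reduced
functional embeds in `ℂ` by evaluation at `lam j`. -/
lemma NonDegenerate.eq_zero_of_eval (h : NonDegenerate lam r) (hs : s ≤ m + 1)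
    (dU : U.degree < s) (hU : ∀ t < s, momentErase lam r j (U * X ^ t) = 0)
    (h0 : U.eval (lam j) = 0) : U = 0 :=
  hankel_det_ne_zero_iff.1 (h.2.2 s hs) U dU fun t ht => by
    rw [moment_eq_erase lam r j, hU t ht, eval_mul, h0, zero_mul, mul_zero, add_zero]

lemma NonDegenerate.smul_eq_smul (h : NonDegenerate lam r) (hs : s ≤ m + 1)
    (dU : U.degree < s) (hU : ∀ t < s, momentErase lam r j (U * X ^ t) = 0)
    (dV : V.degree < s) (hV : ∀ t < s, momentErase lam r j (V * X ^ t) = 0) :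
    C (V.eval (lam j)) * U = C (U.eval (lam j)) * V := by
  rw [← sub_eq_zero]
  refine h.eq_zero_of_eval hs (j := j) ?_ (fun t ht => ?_) ?_
  · refine lt_of_le_of_lt (degree_sub_le _ _) (max_lt ?_ ?_)
    · rw [← smul_eq_C_mul]
      exact lt_of_le_of_lt (degree_smul_le _ _) dU
    · rw [← smul_eq_C_mul]
      exact lt_of_le_of_lt (degree_smul_le _ _) dV
  · rw [sub_mul, mul_assoc, mul_assoc, ← smul_eq_C_mul, ← smul_eq_C_mul, map_sub, map_smul,
      map_smul, hU t ht, hV t ht]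
    simp
  · simp only [eval_sub, eval_mul, eval_C]
    ring

/-- The extra orthogonality of `U` makes `X * U` another element of the same kernel, which has
dimension at most one. Proportionality of `U` and `X * U` forces `U = 0`. -/
lemma NonDegenerate.eq_zero_of_shift (h : NonDegenerate lam r) (hs : s ≤ m + 1)
    (dU : (X * U : ℂ[X]).degree < s) (hU : ∀ t < s + 1, momentErase lam r j (U * X ^ t) = 0) :
    U = 0 := by
  by_contra hU0
  have dU' : U.degree < s := by
    refine lt_of_le_of_lt ?_ dU
    rw [degree_mul, degree_X]
    exact le_add_of_nonneg_left zero_le_one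
  have hU' : ∀ t < s, momentErase lam r j (U * X ^ t) = 0 := fun t ht => hU t (by omega)
  have h1 := h.smul_eq_smul hs (j := j) dU' hU' dU fun t ht => by
    have := hU (t + 1) (by omega)
    rwa [pow_succ, ← mul_assoc, mul_comm, ← mul_assoc] at this
  have h2 : C (U.eval (lam j)) * ((C (lam j) - X) * U) = 0 := by
    rw [eval_mul, eval_X, C_mul] at h1
    linear_combination h1
  rw [mul_eq_zero, mul_eq_zero, C_eq_zero] at h2
  rcases h2 with h2 | h2 | h2
  · exact hU0 (h.eq_zero_of_eval hs dU' hU' h2)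
  · rw [sub_eq_zero] at h2
    exact X_ne_C (lam j) h2.symm
  · exact hU0 h2

/-- Gains one order of orthogonality for `U`: the pairing of `U` with `V` vanishes because `V`
annihilates low degrees, while the terms of `V` below degree `s` are already annihilated by `U`. -/
lemma momentErase_mul_X_pow_eq_zero {s' : ℕ}
    (hU : ∀ t < s, momentErase lam r j (U * X ^ t) = 0)
    (hV : ∀ t < s', momentErase lam r j (V * X ^ t) = 0) (dU : U.degree < s')
    (dV : V.degree ≤ s) (hc : V.coeff s ≠ 0) : momentErase lam r j (U * X ^ s) = 0 := by
  have h1 : momentErase lam r j (U * V) = 0 := by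
    rw [mul_comm]
    exact momentErase_mul_eq_zero hV dU
  have h2 : momentErase lam r j (U * (V - C (V.coeff s) * X ^ s)) = 0 := by
    refine momentErase_mul_eq_zero hU ?_
    rw [degree_lt_iff_coeff_zero]
    intro k hk
    rcases hk.eq_or_lt with rfl | hk
    · simp
    · rw [coeff_sub, coeff_C_mul, coeff_X_pow, if_neg hk.ne', mul_zero, sub_zero]
      exact coeff_eq_zero_of_degree_lt (lt_of_le_of_lt dV (by exact_mod_cast hk))
  rw [mul_sub, map_sub, h1, zero_sub, mul_left_comm, ← smul_eq_C_mul, map_smul, neg_eq_zero,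
    smul_eq_mul] at h2
  exact (mul_eq_zero.1 h2).resolve_left hc

/-- The difference `(x - 1) q` for a sequence `q` of coefficients. -/
def shiftSub (q : ℕ → ℂ[X]) : ℕ → ℂ[X]
  | 0 => -q 0
  | c + 1 => q c - q (c + 1)

/-- The coefficient of `w ^ N` in `∑ c, shiftSub q c (w) * (w y) ^ c`, a polynomial in `y`. -/
def slice (q : ℕ → ℂ[X]) (i N : ℕ) : ℂ[X] :=
  ∑ c ∈ Finset.range (i + 2), C (if c ≤ N then (shiftSub q c).coeff (N - c) else 0) * X ^ c

lemma coeff_slice (q : ℕ → ℂ[X]) (i N c : ℕ) : (slice q i N).coeff c =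
    if c < i + 2 ∧ c ≤ N then (shiftSub q c).coeff (N - c) else 0 := by
  simp only [slice, finsetSum_coeff, coeff_C_mul, coeff_X_pow, mul_ite, mul_one, mul_zero,
    Finset.sum_ite_eq, Finset.mem_range]
  by_cases h1 : c < i + 2 <;> by_cases h2 : c ≤ N <;> simp [h1, h2]

lemma degree_slice_le (q : ℕ → ℂ[X]) (i N : ℕ) : (slice q i N).degree ≤ N := by
  rw [degree_le_iff_coeff_zero]
  intro c hc
  have hc' : N < c := by exact_mod_cast hc
  rw [coeff_slice, if_neg]
  omega

lemma coeff_slice_self (q : ℕ → ℂ[X]) {i N : ℕ} (hN : N < i + 2) :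
    (slice q i N).coeff N = (shiftSub q N).coeff 0 := by
  rw [coeff_slice, if_pos ⟨hN, le_rfl⟩, Nat.sub_self]

/-- Orthogonality, up to degree `i`, of `∑ c, q c (w) x ^ c` for the measure with an atom of mass
`r j` at `1` and atoms of mass `r k` at `w * lam k`. -/
def IsScaledOrthogonal (lam r : Fin (m + 1) → ℂ) (j : Fin (m + 1)) (i : ℕ) (q : ℕ → ℂ[X]) :
    Prop :=
  ∀ t < i, ∑ c ∈ Finset.range (i + 1),
    q c * (C (r j) + C (momentErase lam r j (X ^ (c + t))) * X ^ (c + t)) = 0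

/-- Subtracting the conditions for `t` and `t + 1` cancels the atom at `1`, whose moments are all `r
j`. After division by `X ^ t`, each coefficient of the remaining identity in the scaling variable is
an orthogonality relation for a slice under the reduced functional. -/
lemma momentErase_slice {i : ℕ} {q : ℕ → ℂ[X]} (hq : ∀ c, i < c → q c = 0)
    (horth : IsScaledOrthogonal lam r j i q) {N t : ℕ} (ht : t + 1 < i) :
    momentErase lam r j (slice q i N * X ^ t) = 0 := by
  set h : ℕ → ℂ := fun s => momentErase lam r j (X ^ s) with hh
  have e1 : X ^ t * ∑ c ∈ Finset.range (i + 2), shiftSub q c * (C (h (c + t)) * X ^ c) = 0 := by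
    have e2 := horth (t + 1) ht
    have e3 := horth t (by omega)
    have e4 : ∑ c ∈ Finset.range (i + 2), q c * (C (h (c + t)) * X ^ (c + t)) =
        ∑ c ∈ Finset.range (i + 1), q c * (C (h (c + t)) * X ^ (c + t)) := by
      rw [Finset.sum_range_succ, hq (i + 1) (Nat.lt_succ_self i), zero_mul, add_zero]
    have e5 : X ^ t * ∑ c ∈ Finset.range (i + 2), shiftSub q c * (C (h (c + t)) * X ^ c) =
        ∑ c ∈ Finset.range (i + 1), q c * (C (h (c + (t + 1))) * X ^ (c + (t + 1))) -
        ∑ c ∈ Finset.range (i + 2), q c * (C (h (c + t)) * X ^ (c + t)) := by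
      rw [Finset.sum_range_succ' (n := i + 1), Finset.sum_range_succ' (n := i + 1), ← sub_sub,
        ← Finset.sum_sub_distrib, mul_add, Finset.mul_sum]
      simp only [shiftSub, ← add_assoc, add_right_comm _ 1 t]
      rw [sub_eq_add_neg _ (q 0 * _)]
      refine congrArg₂ (· + ·) ?_ ?_
      · exact Finset.sum_congr rfl fun c _ => by ring
      · ring
    rw [e5, e4, ← sub_eq_zero.2 (e2.trans e3.symm), ← Finset.sum_sub_distrib,
      ← Finset.sum_sub_distrib]
    exact Finset.sum_congr rfl fun c _ => by ring
  have e2 := (mul_eq_zero.1 e1).resolve_left (pow_ne_zero _ X_ne_zero)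
  have e3 := congrArg (fun p => coeff p N) e2
  simp only [finsetSum_coeff, coeff_zero] at e3
  rw [← e3, slice, Finset.sum_mul, map_sum]
  refine Finset.sum_congr rfl fun c _ => ?_
  rw [mul_assoc, ← pow_add, ← smul_eq_C_mul, map_smul, smul_eq_mul, mul_left_comm, coeff_C_mul,
    coeff_mul_X_pow', mul_comm]

/-- The variable of the `q c` is `w = 1 / z`. If the leading coefficient vanished at `w = 0`, the
reduction `Q = ∑ (q c)(0) x ^ c` would have degree less than `i` and a zero at `1`. The slices of
`(x - 1) q` then have top coefficients given by `(x - 1) ^ 2 * (Q / (x - 1))`, and the first nonzero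
one has low degree and is orthogonal to too many powers for the reduced functional, against
`NonDegenerate.eq_zero_of_shift`. -/
lemma leading_coeff_ne_zero (h : NonDegenerate lam r) {i : ℕ} (hi : i ≤ m + 1) {q : ℕ → ℂ[X]}
    (hq : ∀ c, i < c → q c = 0) (hne : ∃ c, (q c).coeff 0 ≠ 0)
    (horth : IsScaledOrthogonal lam r j i q) : (q i).coeff 0 ≠ 0 := by
  intro hqi
  have hrj := h.weight_ne_zero j
  obtain ⟨c₀, hc₀⟩ := hne
  have hc₀i : c₀ < i := by
    rcases lt_trichotomy c₀ i with h | h | h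
    · exact h
    · rw [h] at hc₀
      exact absurd hqi hc₀
    · simp [hq c₀ h] at hc₀
  have hsum1 : momentErase lam r j 1 = 1 - r j := by
    have e := moment_eq_erase lam r j 1
    rw [moment_apply] at e
    simp only [eval_one, mul_one, h.2.1] at e
    linear_combination -e
  -- For `i = 1` the only condition, read at `w = 0`, says that the constant coefficient times the
  -- total mass `1` vanishes.
  rcases Nat.lt_or_ge i 2 with hi2 | hi2
  · obtain rfl : i = 1 := by omega
    obtain rfl : c₀ = 0 := by omega
    have e := congrArg (fun p => coeff p 0) (horth 0 (by omega))
    simp [Finset.sum_range_succ, hqi, mul_coeff_zero, hsum1] at e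
    exact hc₀ e
  -- the reduction of `q` at `w = 0` vanishes at `1`
  set Q : ℂ[X] := ∑ c ∈ Finset.range i, C ((q c).coeff 0) * X ^ c with hQ
  have hQc : ∀ c, Q.coeff c = (q c).coeff 0 := by
    intro c
    simp only [hQ, finsetSum_coeff, coeff_C_mul, coeff_X_pow, mul_ite, mul_one, mul_zero,
      Finset.sum_ite_eq, Finset.mem_range]
    split_ifs with hc
    · rfl
    · rcases (not_lt.1 hc).eq_or_lt with rfl | hc
      · exact hqi.symm
      · rw [hq c hc, coeff_zero]
  have hQ0 : Q ≠ 0 := fun e => hc₀ (by rw [← hQc, e, coeff_zero])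
  have hQd : Q.degree < i := by
    rw [degree_lt_iff_coeff_zero]
    intro c hc
    rw [hQc]
    rcases hc.eq_or_lt with rfl | hc
    · exact hqi
    · rw [hq c hc, coeff_zero]
  -- The condition for `t = 1` is used, since there every power of `w` has positive exponent and
  -- only the atom at `1` survives at `w = 0`.
  have hQ1 : Q.eval 1 = 0 := by
    have e := congrArg (fun p => coeff p 0) (horth 1 (by omega))
    simp only [finsetSum_coeff, mul_coeff_zero, coeff_add, coeff_C_zero, coeff_X_pow,
      coeff_zero] at e
    have e' : ∑ c ∈ Finset.range (i + 1), (q c).coeff 0 * r j = 0 := by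
      rw [← e]
      refine Finset.sum_congr rfl fun c _ => ?_
      simp
    rw [← Finset.sum_mul, Finset.sum_range_succ, hqi, add_zero] at e'
    rw [hQ, eval_finsetSum]
    simpa using (mul_eq_zero.1 e').resolve_right hrj
  obtain ⟨k, hk⟩ := dvd_iff_isRoot.2 (show IsRoot Q 1 from hQ1)
  have hk0 : k ≠ 0 := fun e => hQ0 (by rw [hk, e, mul_zero])
  have hkd : k.natDegree + 2 ≤ i := by
    have e1 : Q.natDegree < i := (natDegree_lt_iff_degree_lt hQ0).2 hQd
    rw [hk, (monic_X_sub_C (1 : ℂ)).natDegree_mul' hk0, natDegree_X_sub_C] at e1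
    omega
  have hshift : ∀ c, (shiftSub q c).coeff 0 = ((X - C 1) * Q).coeff c := by
    intro c
    rcases c with _ | c
    · simp [shiftSub, ← hQc]
    · simp [shiftSub, ← hQc, sub_mul]
  -- The slice of index `e` has degree exactly `e`; it is the polynomial to be shown zero. Only the
  -- top coefficients of the slices `e`, `e + 1`, `e + 2` are needed, and they are the first
  -- coefficients of `(x - 1) ^ 2 * k2`.
  set e := k.natTrailingDegree with he
  have hke : k.coeff e ≠ 0 := by
    rw [he]
    exact mt trailingCoeff_eq_zero.1 hk0
  have hlow : ∀ c, c < e → k.coeff c = 0 := fun c hc => coeff_eq_zero_of_lt_natTrailingDegree hc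
  have hhigh : ∀ c, i < c + 2 → k.coeff c = 0 := fun c hc =>
    coeff_eq_zero_of_natDegree_lt (by omega)
  have hei : e + 2 ≤ i := by
    by_contra h'
    exact hke (hhigh e (by omega))
  obtain ⟨k2, hk2⟩ := X_pow_dvd_iff.2 hlow
  have hk2c : ∀ c, k2.coeff c = k.coeff (c + e) := fun c => by rw [hk2, coeff_X_pow_mul]
  have hprod : (X - C 1) * Q = X ^ e * (X * (X * k2) - C 2 * (X * k2) + k2) := by
    rw [hk, hk2, show (C 2 : ℂ[X]) = 2 from rfl, C_1]
    ring
  have hc : ∀ c, (shiftSub q (c + e)).coeff 0 = (X * (X * k2) - C 2 * (X * k2) + k2).coeff c :=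
    fun c => by rw [hshift, hprod, coeff_X_pow_mul]
  have c0 : (slice q i e).coeff e = k2.coeff 0 := by
    rw [coeff_slice_self q (by omega)]
    simpa using hc 0
  have c1 : (slice q i (e + 1)).coeff (e + 1) = k2.coeff 1 - 2 * k2.coeff 0 := by
    rw [coeff_slice_self q (by omega), add_comm e 1, hc]
    simp [coeff_X_mul]
    ring
  have c2 : (slice q i (e + 2)).coeff (e + 2) =
      k2.coeff 0 - 2 * k2.coeff 1 + k2.coeff 2 := by
    rw [coeff_slice_self q (by omega), add_comm e 2, hc]
    simp [coeff_X_mul]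
  have hα : k2.coeff 0 ≠ 0 := by
    rw [hk2c, zero_add]
    exact hke
  have hU : ∀ N, ∀ t < i - 1, momentErase lam r j (slice q i N * X ^ t) = 0 :=
    fun N t ht => momentErase_slice hq horth (by omega)
  have hU0 : slice q i e ≠ 0 := fun e0 => hα (by rw [← c0, e0, coeff_zero])
  have hlt : ∀ N s : ℕ, N < s → (slice q i N).degree < s := fun N s hNs =>
    lt_of_le_of_lt (degree_slice_le q i N) (by exact_mod_cast hNs)
  have hXlt : ∀ s : ℕ, e + 1 < s → (X * slice q i e : ℂ[X]).degree < s := fun s hs => by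
    rw [degree_mul, degree_X, add_comm]
    refine lt_of_le_of_lt (add_le_add_left (degree_slice_le q i e) 1) ?_
    exact_mod_cast hs
  -- When `e + 3 < i` the known orthogonality to degrees below `i - 1` already exceeds what the
  -- shift argument needs. The two remaining cases gain further orders from the next slices.
  rcases lt_trichotomy (e + 3) i with hlt3 | heq3 | hgt3
  · refine hU0 (h.eq_zero_of_shift (s := i - 2) (j := j) (by omega) (hXlt _ (by omega)) ?_)
    exact fun t ht => hU e t (by omega)
  -- Here `k2` has degree at most `1`. Proportionality of the slices `e` and `e + 1` kills the top
  -- coefficient of the latter, and that of the slice `e + 2` must vanish too, as it would otherwise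
  -- supply the missing order. The two linear equations force `k2.coeff 0 = 0`.
  · have hz2 : k2.coeff 2 = 0 := by
      rw [hk2c]
      exact hhigh _ (by omega)
    have hi1 : i - 1 = e + 2 := by omega
    have h1 := congrArg (fun p => coeff p (e + 1)) (h.smul_eq_smul (s := i - 1) (j := j) (by omega)
      (hlt e _ (by omega)) (hU e) (hlt (e + 1) _ (by omega)) (hU (e + 1)))
    have hU1 : (slice q i e).coeff (e + 1) = 0 :=
      coeff_eq_zero_of_degree_lt (hlt e _ (Nat.lt_succ_self e))
    simp only [coeff_C_mul, hU1, mul_zero, c1] at h1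
    have hβ : k2.coeff 1 - 2 * k2.coeff 0 = 0 := by
      refine (mul_eq_zero.1 h1.symm).resolve_left fun h0 => hU0 ?_
      exact h.eq_zero_of_eval (s := i - 1) (by omega) (hlt e _ (by omega)) (hU e) h0
    have hα2 : k2.coeff 0 - 2 * k2.coeff 1 + k2.coeff 2 = 0 := by
      by_contra hne
      refine hU0 (h.eq_zero_of_shift (s := i - 1) (j := j) (by omega) (hXlt _ (by omega)) ?_)
      intro t ht
      rcases Nat.lt_succ_iff_lt_or_eq.1 ht with ht | rfl
      · exact hU e t ht
      rw [hi1]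
      refine momentErase_mul_X_pow_eq_zero (fun t ht => hU e t (by omega)) (hU (e + 2))
        (hlt e _ (by omega)) (degree_slice_le q i (e + 2)) ?_
      rwa [c2]
    apply hα
    rw [hz2] at hα2
    linear_combination (-1 / 3 : ℂ) * hα2 - (2 / 3 : ℂ) * hβ
  -- Now `k2` is a constant, so the top coefficients of the next two slices are `-2` and `1` times
  -- it. Both are nonzero, and each supplies one more order of orthogonality.
  · have hz1 : k2.coeff 1 = 0 := by
      rw [hk2c]
      exact hhigh _ (by omega)
    have hz2 : k2.coeff 2 = 0 := by
      rw [hk2c]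
      exact hhigh _ (by omega)
    have hi1 : i = e + 2 := by omega
    have o1 : momentErase lam r j (slice q i e * X ^ (e + 1)) = 0 := by
      refine momentErase_mul_X_pow_eq_zero (fun t ht => hU e t (by omega)) (hU (e + 1))
        (hlt e _ (by omega)) (degree_slice_le q i (e + 1)) ?_
      rw [c1, hz1]
      simpa using hα
    have o2 : momentErase lam r j (slice q i e * X ^ (e + 2)) = 0 := by
      refine momentErase_mul_X_pow_eq_zero (fun t ht => ?_) (hU (e + 2))
        (hlt e _ (by omega)) (degree_slice_le q i (e + 2)) ?_
      · rcases Nat.lt_succ_iff_lt_or_eq.1 ht with ht | rfl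
        · exact hU e t (by omega)
        · exact o1
      · rw [c2, hz1, hz2]
        simpa using hα
    refine hU0 (h.eq_zero_of_shift (s := i) (j := j) hi (hXlt _ (by omega)) ?_)
    intro t ht
    rcases lt_trichotomy t (e + 1) with ht' | rfl | ht'
    · exact hU e t (by omega)
    · exact o1
    · obtain rfl : t = e + 2 := by omega
      exact o2

end Erase

end

/-! ### Rescaled orthogonal polynomials and the growth of `g` -/

section

open Polynomial

variable {m : ℕ} {lam r : Fin (m + 1) → ℂ} {j : Fin (m + 1)}

/-- There are `i` homogeneous linear equations over `ℂ[X]` for `i + 1` unknowns, so a nonzero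
solution exists. Dividing out the common power of `X` makes it nonzero at `0`. -/
lemma exists_isScaledOrthogonal (lam r : Fin (m + 1) → ℂ) (j : Fin (m + 1)) (i : ℕ) :
    ∃ q : ℕ → ℂ[X], (∀ c, i < c → q c = 0) ∧ (∃ c, (q c).coeff 0 ≠ 0) ∧
      IsScaledOrthogonal lam r j i q := by
  have ex : ∃ q : ℕ → ℂ[X], (∀ c, i < c → q c = 0) ∧ (∃ c, q c ≠ 0) ∧
      IsScaledOrthogonal lam r j i q := by
    -- A zero row completes the system to a square one with vanishing determinant.
    set M : Matrix (Fin (i + 1)) (Fin (i + 1)) ℂ[X] := Matrix.of fun t c =>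
      if t.1 < i then C (r j) + C (momentErase lam r j (X ^ (c.1 + t.1))) * X ^ (c.1 + t.1)
      else 0 with hM
    have hdet : M.det = 0 :=
      Matrix.det_eq_zero_of_row_eq_zero (Fin.last i) fun c => by simp [hM]
    obtain ⟨v, hv, hMv⟩ := Matrix.exists_mulVec_eq_zero_iff.2 hdet
    obtain ⟨c, hc⟩ := Function.ne_iff.1 hv
    refine ⟨fun c => if h : c < i + 1 then v ⟨c, h⟩ else 0, fun c hc => ?_, ⟨c.1, ?_⟩, ?_⟩
    · simp only [dif_neg (show ¬ c < i + 1 by omega)]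
    · simp only [dif_pos c.2]
      exact hc
    · intro t ht
      have := congrFun hMv ⟨t, by omega⟩
      rw [Finset.sum_range]
      simp only [Matrix.mulVec, dotProduct, hM, Matrix.of_apply, if_pos ht, Pi.zero_apply] at this
      refine Eq.trans (Finset.sum_congr rfl fun c _ => ?_) this
      simp only [dif_pos c.2]
      rw [mul_comm]
  -- While all constant terms vanish, dividing every coefficient by `X` preserves the equations and
  -- lowers the total degree.
  have descent : ∀ N : ℕ, ∀ q : ℕ → ℂ[X], (∀ c, i < c → q c = 0) → (∃ c, q c ≠ 0) →
      IsScaledOrthogonal lam r j i q → ∑ c ∈ Finset.range (i + 1), (q c).natDegree ≤ N →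
      ∃ q : ℕ → ℂ[X], (∀ c, i < c → q c = 0) ∧ (∃ c, (q c).coeff 0 ≠ 0) ∧
      IsScaledOrthogonal lam r j i q := by
    intro N
    induction N with
    | zero =>
      intro q hq ⟨c, hc⟩ horth hN
      refine ⟨q, hq, ⟨c, fun h0 => hc ?_⟩, horth⟩
      have hci : c ∈ Finset.range (i + 1) := by
        by_contra h
        exact hc (hq c (by simpa using h))
      have hd := (Finset.sum_eq_zero_iff.1 (Nat.le_zero.1 hN)) c hci
      rw [eq_C_of_natDegree_eq_zero hd, h0, C_0]
    | succ N ih =>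
      intro q hq ⟨c, hc⟩ horth hN
      by_cases h0 : ∃ c, (q c).coeff 0 ≠ 0
      · exact ⟨q, hq, h0, horth⟩
      push Not at h0
      have hX : ∀ c, q c = X * (q c).divX := fun c => by
        conv_lhs => rw [← X_mul_divX_add (q c), h0 c, C_0, add_zero]
      have hci : c ∈ Finset.range (i + 1) := by
        by_contra h
        exact hc (hq c (by simpa using h))
      refine ih (fun c => (q c).divX) (fun c hc => by simp [hq c hc])
        ⟨c, fun h => hc (by rw [hX c, h, mul_zero])⟩ (fun t ht => ?_) ?_
      · have e := horth t ht
        have e2 : X * ∑ c ∈ Finset.range (i + 1), (q c).divX *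
            (C (r j) + C (momentErase lam r j (X ^ (c + t))) * X ^ (c + t)) = 0 := by
          rw [← e, Finset.mul_sum]
          refine Finset.sum_congr rfl fun c _ => ?_
          rw [← mul_assoc, ← hX]
        exact (mul_eq_zero.1 e2).resolve_left X_ne_zero
      · have hlt : ∑ c ∈ Finset.range (i + 1), (q c).divX.natDegree <
            ∑ c ∈ Finset.range (i + 1), (q c).natDegree := by
          refine Finset.sum_lt_sum (fun c _ => ?_) ⟨c, hci, ?_⟩
          · rw [natDegree_divX_eq_natDegree_tsub_one]
            omega
          · rw [natDegree_divX_eq_natDegree_tsub_one]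
            have : (q c).natDegree ≠ 0 := fun h => hc (by
              rw [eq_C_of_natDegree_eq_zero h, h0, C_0])
            omega
        omega
  obtain ⟨q, hq, hne, horth⟩ := ex
  exact descent _ q hq hne horth le_rfl

/-- The coefficients of the orthogonal polynomials grow at most like the corresponding powers of
the node that tends to infinity. -/
lemma exists_coeff_bound (h : NonDegenerate lam r) (j : Fin (m + 1)) {i : ℕ} (hi : i ≤ m + 1) :
    ∃ K : ℝ, ∀ᶠ z in Bornology.cobounded ℂ, NonDegenerate (Function.update lam j z) r →
      ∀ p : ℂ[X], p.Monic → p.natDegree = i →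
      (∀ t < i, moment (Function.update lam j z) r (p * X ^ t) = 0) →
      ∀ c ≤ i, ‖p.coeff c‖ ≤ K * ‖z‖ ^ (i - c) := by
  obtain ⟨q, hq, hne, horth⟩ := exists_isScaledOrthogonal lam r j i
  have hqi : (q i).eval 0 ≠ 0 := by
    rw [← coeff_zero_eq_eval_zero]
    exact leading_coeff_ne_zero h hi hq hne horth
  have hinv : Filter.Tendsto (fun z : ℂ => z⁻¹) (Bornology.cobounded ℂ) (nhds 0) :=
    Filter.tendsto_inv₀_cobounded
  have hlim : ∀ c, Filter.Tendsto (fun z : ℂ => ‖(q c).eval z⁻¹ / (q i).eval z⁻¹‖)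
      (Bornology.cobounded ℂ) (nhds ‖(q c).eval 0 / (q i).eval 0‖) := fun c =>
    ((((q c).continuous.tendsto 0).comp hinv).div (((q i).continuous.tendsto 0).comp hinv)
      hqi).norm
  have hbd : ∀ᶠ z in Bornology.cobounded ℂ, ∀ c ∈ Finset.range (i + 1),
      ‖(q c).eval z⁻¹ / (q i).eval z⁻¹‖ ≤ ‖(q c).eval 0 / (q i).eval 0‖ + 1 := by
    rw [Filter.eventually_all_finset]
    intro c _
    exact (hlim c).eventually_le_const (lt_add_one _)
  have hev : ∀ᶠ z in Bornology.cobounded ℂ, (q i).eval z⁻¹ ≠ 0 :=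
    (((q i).continuous.tendsto 0).comp hinv).eventually_ne hqi
  refine ⟨∑ c ∈ Finset.range (i + 1), (‖(q c).eval 0 / (q i).eval 0‖ + 1), ?_⟩
  filter_upwards [hbd, hev, Bornology.eventually_ne_cobounded (0 : ℂ)] with z hz hz' hz0
  intro hnd p hpm hpd hport c hc
  -- Undoes the rescaling: the solution at `w = z⁻¹`, made monic. The ratios stay bounded because
  -- the denominator has a nonzero limit, so only `z ^ (i - c)` grows.
  set ρ : ℕ → ℂ := fun c => (q c).eval z⁻¹ / (q i).eval z⁻¹ * z ^ (i - c) with hρ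
  set P : ℂ[X] := ∑ c ∈ Finset.range (i + 1), C (ρ c) * X ^ c with hP
  have hPc : ∀ c, P.coeff c = if c < i + 1 then ρ c else 0 := by
    intro c
    simp only [hP, finsetSum_coeff, coeff_C_mul, coeff_X_pow, mul_ite, mul_one, mul_zero,
      Finset.sum_ite_eq, Finset.mem_range]
  have hPorth : ∀ t < i, moment (Function.update lam j z) r (P * X ^ t) = 0 := by
    intro t ht
    have e := congrArg (Polynomial.eval z⁻¹) (horth t ht)
    rw [eval_finsetSum, eval_zero] at e
    rw [hP, Finset.sum_mul, map_sum, ← mul_zero (z ^ (i + t) / (q i).eval z⁻¹), ← e,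
      Finset.mul_sum]
    refine Finset.sum_congr rfl fun c hc => ?_
    rw [mul_assoc, ← pow_add, ← smul_eq_C_mul, map_smul, moment_update]
    simp only [eval_mul, eval_add, eval_C, eval_pow, eval_X, smul_eq_mul, hρ]
    have hci : c ≤ i := Nat.lt_succ_iff.1 (Finset.mem_range.1 hc)
    have e1 : z ^ (i + t) = z ^ (i - c) * z ^ (c + t) := by
      rw [← pow_add]
      congr 1
      omega
    have e2 : z ^ (c + t) * z⁻¹ ^ (c + t) = 1 := by
      rw [← mul_pow, mul_inv_cancel₀ hz0, one_pow]
    rw [e1]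
    linear_combination (-(q c).eval z⁻¹ / (q i).eval z⁻¹ * z ^ (i - c) *
      momentErase lam r j (X ^ (c + t))) * e2
  -- Two monic orthogonal polynomials of degree `i` differ by an element of the kernel of a
  -- nonsingular Hankel matrix.
  have hpP : p = P := by
    rw [← sub_eq_zero]
    refine hankel_det_ne_zero_iff.1 (hnd.2.2 i hi) _ ?_ fun t ht => ?_
    · rw [degree_lt_iff_coeff_zero]
      intro c hc
      rw [coeff_sub, hPc]
      rcases hc.eq_or_lt with rfl | hc
      · rw [if_pos (Nat.lt_succ_self _), hρ]
        simp only [Nat.sub_self, pow_zero, mul_one, div_self hz']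
        have := hpm.coeff_natDegree
        rw [hpd] at this
        rw [this, sub_self]
      · rw [if_neg (by omega), coeff_eq_zero_of_natDegree_lt (by omega), sub_zero]
    · rw [sub_mul, map_sub, hport t ht, hPorth t ht, sub_zero]
  rw [hpP, hPc, if_pos (by omega), hρ, norm_mul, norm_pow]
  refine mul_le_mul_of_nonneg_right ?_ (by positivity)
  have hcm : c ∈ Finset.range (i + 1) := Finset.mem_range.2 (by omega)
  exact (hz c hcm).trans (Finset.single_le_sum
    (f := fun c => ‖(q c).eval 0 / (q i).eval 0‖ + 1) (fun _ _ => by positivity) hcm)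

/-- Each Hankel determinant is a polynomial in the moving node, nonzero at `lam j`. So it has
finitely many roots, and these stay in a bounded set. -/
lemma NonDegenerate.eventually_update (h : NonDegenerate lam r) (j : Fin (m + 1)) :
    ∀ᶠ z in Bornology.cobounded ℂ, NonDegenerate (Function.update lam j z) r := by
  have hinj : ∀ᶠ z in Bornology.cobounded ℂ, Function.Injective (Function.update lam j z) := by
    have : ∀ᶠ z in Bornology.cobounded ℂ, ∀ k, z ≠ lam k := by
      rw [Filter.eventually_all]
      exact fun k => Bornology.eventually_ne_cobounded (lam k)
    filter_upwards [this] with z hz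
    intro k l hkl
    rcases eq_or_ne k j with hk | hk <;> rcases eq_or_ne l j with hl | hl
    · rw [hk, hl]
    · rw [hk, Function.update_self, Function.update_of_ne hl] at hkl
      exact absurd hkl (hz l)
    · rw [hl, Function.update_self, Function.update_of_ne hk] at hkl
      exact absurd hkl.symm (hz k)
    · rw [Function.update_of_ne hk, Function.update_of_ne hl] at hkl
      exact h.1 hkl
  have hdet : ∀ᶠ z in Bornology.cobounded ℂ, ∀ i ∈ Finset.range (m + 2),
      (hankel (Function.update lam j z) r i).det ≠ 0 := by
    rw [Filter.eventually_all_finset]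
    intro i hi
    set p : ℂ[X] := (Matrix.of fun s t : Fin i =>
      C (momentErase lam r j (X ^ (s.1 + t.1))) + C (r j) * X ^ (s.1 + t.1)).det with hp
    have hpe : ∀ z, p.eval z = (hankel (Function.update lam j z) r i).det := by
      intro z
      rw [hp, ← coe_evalRingHom, RingHom.map_det]
      congr 1
      ext s t
      have e := moment_update lam r j z (X ^ (s.1 + t.1))
      rw [moment_apply] at e
      simp only [eval_pow, eval_X] at e
      rw [hankel, Matrix.of_apply, e]
      simp
    have hp0 : p ≠ 0 := by
      intro h0
      have := hpe (lam j)
      rw [h0, Function.update_eq_self, eval_zero] at this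
      exact h.2.2 i (by simpa [Nat.lt_succ_iff] using hi) this.symm
    have hfin := (p.rootSet_finite ℂ).isBounded
    filter_upwards [Bornology.isBounded_def.1 hfin] with z hz
    rw [← hpe]
    intro h0
    apply hz
    rw [mem_rootSet]
    exact ⟨hp0, by rwa [coe_aeval_eq_eval]⟩
  filter_upwards [hinj, hdet] with z h1 h2
  exact ⟨h1, h.2.1, fun i hi => h2 i (Finset.mem_range.2 (by omega))⟩

lemma exists_coeff_bound_uniform (h : NonDegenerate lam r) (j : Fin (m + 1)) :
    ∃ K : ℝ, 0 ≤ K ∧ ∀ᶠ z in Bornology.cobounded ℂ, NonDegenerate (Function.update lam j z) r →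
      ∀ i ≤ m + 1, ∀ p : ℂ[X], p.Monic → p.natDegree = i →
      (∀ t < i, moment (Function.update lam j z) r (p * X ^ t) = 0) →
      ∀ c ≤ i, ‖p.coeff c‖ ≤ K * ‖z‖ ^ (i - c) := by
  choose K hK using fun i : Fin (m + 2) =>
    exists_coeff_bound h j (i := i.1) (Nat.lt_succ_iff.1 i.2)
  refine ⟨∑ i, |K i|, Finset.sum_nonneg fun i _ => abs_nonneg _, ?_⟩
  filter_upwards [Filter.eventually_all.2 hK] with z hz
  intro hnd i hi p hpm hpd hport c hc
  refine (hz ⟨i, by omega⟩ hnd p hpm hpd hport c hc).trans ?_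
  refine mul_le_mul_of_nonneg_right ?_ (by positivity)
  exact (le_abs_self _).trans (Finset.single_le_sum (f := fun i => |K i|)
    (fun _ _ => abs_nonneg _) (Finset.mem_univ _))

/-- The recurrence reads the entries off the top coefficients: `a` is a difference of two subleading
coefficients, of order `x`, and `b` comes from the next coefficients, of order `x ^ 2`. -/
lemma norm_entries_le_of_coeff_bound {a : Fin (m + 1) → ℂ} {b : Fin m → ℂ} {K x : ℝ}
    (hK : 0 ≤ K) (hx : 1 ≤ x)
    (h : ∀ i ≤ m + 1, ∀ c ≤ i, ‖(topPoly a b i).coeff c‖ ≤ K * x ^ (i - c)) :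
    (∀ k, ‖a k‖ ≤ 2 * K * x) ∧ ∀ k, ‖b k‖ ≤ (2 * K + 2 * K ^ 2) * x ^ 2 := by
  have htop : ∀ i, (topPoly a b i).coeff i = 1 := fun i => by
    have := (topPoly_monic a b i).coeff_natDegree
    rwa [natDegree_topPoly] at this
  have hz : ∀ i c, i < c → (topPoly a b i).coeff c = 0 := fun i c hic =>
    coeff_eq_zero_of_natDegree_lt (by rwa [natDegree_topPoly])
  have ha : ∀ i (hi : i < m + 1), ‖a (Fin.rev ⟨i, hi⟩)‖ ≤ 2 * K * x := by
    intro i hi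
    rcases i with _ | i
    · have h1 := h 1 (by omega) 0 (by omega)
      have e : (topPoly a b 1).coeff 0 = -a (Fin.rev 0) := by simp [topPoly]
      rw [e, norm_neg] at h1
      have : K * x ^ (1 - 0) = K * x := by norm_num
      refine h1.trans ?_
      rw [this]
      nlinarith
    · have e : (topPoly a b (i + 2)).coeff (i + 1) =
          (topPoly a b (i + 1)).coeff i - a (Fin.rev ⟨i + 1, hi⟩) := by
        simp only [topPoly, dif_pos hi, sub_mul, coeff_sub, coeff_C_mul, coeff_X_mul, htop,
          hz i (i + 1) (Nat.lt_succ_self i)]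
        ring
      have h1 := h (i + 2) (by omega) (i + 1) (by omega)
      have h2 := h (i + 1) (by omega) i (by omega)
      rw [show i + 2 - (i + 1) = 1 by omega, pow_one] at h1
      rw [show i + 1 - i = 1 by omega, pow_one] at h2
      have e2 : a (Fin.rev ⟨i + 1, hi⟩) =
          (topPoly a b (i + 1)).coeff i - (topPoly a b (i + 2)).coeff (i + 1) := by
        rw [e]
        ring
      rw [e2]
      refine (norm_sub_le _ _).trans ?_
      linarith
  have hb : ∀ i (hi : i < m), ‖b (Fin.rev ⟨i, hi⟩)‖ ≤ (2 * K + 2 * K ^ 2) * x ^ 2 := by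
    intro i hi
    have hi' : i + 1 < m + 1 := by omega
    -- `u` is the contribution of `X * topPoly a b (i + 1)`; it is zero when `i = 0`, there being no
    -- coefficient below the constant term.
    obtain ⟨u, hu, e⟩ : ∃ u : ℂ, ‖u‖ ≤ K * x ^ 2 ∧ (topPoly a b (i + 2)).coeff i =
        u - a (Fin.rev ⟨i + 1, hi'⟩) * (topPoly a b (i + 1)).coeff i - b (Fin.rev ⟨i, hi⟩) := by
      rcases i with _ | i
      · refine ⟨0, by simp; positivity, ?_⟩
        simp only [topPoly.eq_3, dif_pos hi, dif_pos hi', sub_mul, coeff_sub, coeff_C_mul, htop,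
          coeff_X_mul_zero, mul_one]
      · refine ⟨(topPoly a b (i + 2)).coeff i, ?_, ?_⟩
        · have := h (i + 2) (by omega) i (by omega)
          rwa [show i + 2 - i = 2 by omega] at this
        · simp only [topPoly.eq_3 (i := i + 1), dif_pos hi, dif_pos hi', sub_mul, coeff_sub,
            coeff_C_mul, htop, coeff_X_mul, mul_one]
    have h1 := h (i + 2) (by omega) i (by omega)
    have h2 := h (i + 1) (by omega) i (by omega)
    have h3 := ha (i + 1) hi'
    rw [show i + 2 - i = 2 by omega] at h1
    rw [show i + 1 - i = 1 by omega, pow_one] at h2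
    have e2 : b (Fin.rev ⟨i, hi⟩) = u - a (Fin.rev ⟨i + 1, hi'⟩) * (topPoly a b (i + 1)).coeff i -
        (topPoly a b (i + 2)).coeff i := by
      rw [e]
      ring
    have h4 : ‖a (Fin.rev ⟨i + 1, hi'⟩) * (topPoly a b (i + 1)).coeff i‖ ≤
        (2 * K * x) * (K * x) := by
      rw [norm_mul]
      exact mul_le_mul h3 h2 (norm_nonneg _) (by positivity)
    rw [e2]
    refine (norm_sub_le _ _).trans ?_
    have h5 := norm_sub_le u (a (Fin.rev ⟨i + 1, hi'⟩) * (topPoly a b (i + 1)).coeff i)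
    nlinarith
  refine ⟨fun k => ?_, fun k => ?_⟩
  · have := ha (Fin.rev k).1 (Fin.rev k).2
    rwa [Fin.eta, Fin.rev_rev] at this
  · have := hb (Fin.rev k).1 (Fin.rev k).2
    rwa [Fin.eta, Fin.rev_rev] at this

lemma isBigO_reconstruct (h : NonDegenerate lam r) (j i k : Fin (m + 1)) :
    (fun z : ℂ => reconstruct (Function.update lam j z) r i k)
      =O[Bornology.cobounded ℂ] fun z : ℂ => ‖z‖ ^ 2 := by
  obtain ⟨K, hK, hev⟩ := exists_coeff_bound_uniform h j
  refine Asymptotics.IsBigO.of_bound (2 * K + 2 * K ^ 2 + 1) ?_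
  filter_upwards [hev, h.eventually_update j,
    (tendsto_norm_cobounded_atTop (E := ℂ)).eventually_ge_atTop 1] with z hz hnd hz1
  obtain ⟨a, b, hb, hs⟩ := Admissible.of_nonDegenerate hnd
  rw [reconstruct_eq hb hs]
  obtain ⟨h1, h2⟩ := norm_entries_le_of_coeff_bound (a := a) (b := b) hK hz1
    fun i hi c hc => hz hnd i hi _ (topPoly_monic a b i) (natDegree_topPoly a b i)
      (moment_topPoly_mul_X_pow hs hi) c hc
  rw [norm_pow, norm_norm]
  have hz2 : ‖z‖ ≤ ‖z‖ ^ 2 := by nlinarith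
  have hz3 : 1 ≤ ‖z‖ ^ 2 := by nlinarith
  simp only [tridiag, Matrix.of_apply]
  split_ifs
  · refine (h1 _).trans ?_
    nlinarith [mul_le_mul_of_nonneg_left hz2 hK, mul_nonneg (sq_nonneg K) (sq_nonneg ‖z‖)]
  · rw [norm_one]
    nlinarith [mul_nonneg hK (sq_nonneg ‖z‖), mul_nonneg (sq_nonneg K) (sq_nonneg ‖z‖)]
  · refine (h2 _).trans ?_
    nlinarith
  · rw [norm_zero]
    positivity

lemma isBigO_g (h : NonDegenerate lam r) (j : Fin (m + 1)) :
    (fun z : ℂ => g (Function.update lam j z) r) =O[Bornology.cobounded ℂ]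
      fun z : ℂ => ‖z‖ ^ 4 := by
  have e : (fun z : ℂ => g (Function.update lam j z) r) = fun z => (2 : ℝ)⁻¹ *
      ((∑ i, ∑ k, ‖reconstruct (Function.update lam j z) r i k‖ ^ 2) -
        ∑ k, ‖Function.update lam j z k‖ ^ 2) := by
    funext z
    rw [g, div_eq_inv_mul]
  have e4 : (fun z : ℂ => ‖z‖ ^ 4) = fun z => (‖z‖ ^ 2) ^ 2 := by
    funext z
    rw [← pow_mul]
  rw [e, e4]
  refine Asymptotics.IsBigO.const_mul_left (Asymptotics.IsBigO.sub ?_ ?_) _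
  · exact Asymptotics.IsBigO.fun_sum fun i _ => Asymptotics.IsBigO.fun_sum fun k _ =>
      ((isBigO_reconstruct h j i k).norm_left).pow 2
  · refine Asymptotics.IsBigO.fun_sum fun k _ => Asymptotics.IsBigO.pow ?_ 2
    refine Asymptotics.IsBigO.of_bound (‖lam k‖ + 1) ?_
    filter_upwards [(tendsto_norm_cobounded_atTop (E := ℂ)).eventually_ge_atTop 1]
      with z hz1
    rw [norm_norm, norm_pow, norm_norm]
    have hz2 : ‖z‖ ≤ ‖z‖ ^ 2 := by nlinarith
    have hz3 : 1 ≤ ‖z‖ ^ 2 := by nlinarith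
    rcases eq_or_ne k j with rfl | hk
    · rw [Function.update_self]
      nlinarith [norm_nonneg (lam k)]
    · rw [Function.update_of_ne hk]
      nlinarith [norm_nonneg (lam k)]

end

section

/-! ### Measurability of the exponent -/

section Measurability

variable {m n : ℕ}

lemma measurable_recState (j : ℕ) :
    (∀ k, Measurable fun p : (Fin n → ℂ) × (Fin n → ℂ) => (recState p.1 p.2 j).rPrev k) ∧
    (∀ k, Measurable fun p : (Fin n → ℂ) × (Fin n → ℂ) => (recState p.1 p.2 j).rCur k) ∧
    (∀ k, Measurable fun p : (Fin n → ℂ) × (Fin n → ℂ) => (recState p.1 p.2 j).lPrev k) ∧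
    (∀ k, Measurable fun p : (Fin n → ℂ) × (Fin n → ℂ) => (recState p.1 p.2 j).lCur k) ∧
    Measurable fun p : (Fin n → ℂ) × (Fin n → ℂ) => (recState p.1 p.2 j).sub := by
  have hl : ∀ k, Measurable fun p : (Fin n → ℂ) × (Fin n → ℂ) => p.1 k := fun k =>
    (measurable_pi_apply k).comp measurable_fst
  have hr : ∀ k, Measurable fun p : (Fin n → ℂ) × (Fin n → ℂ) => p.2 k := fun k =>
    (measurable_pi_apply k).comp measurable_snd
  induction j with
  | zero =>
    exact ⟨fun k => measurable_const, hr, fun k => measurable_const, fun k => measurable_const,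
      measurable_const⟩
  | succ j ih =>
    obtain ⟨h1, h2, h3, h4, h5⟩ := ih
    have hd : Measurable fun p : (Fin n → ℂ) × (Fin n → ℂ) =>
        (recState p.1 p.2 j).diag p.1 :=
      Finset.measurable_fun_sum _ fun k _ => ((h2 k).mul (hl k)).mul (h4 k)
    have h6 : ∀ k, Measurable fun p : (Fin n → ℂ) × (Fin n → ℂ) =>
        (recState p.1 p.2 (j + 1)).rCur k := fun k =>
      (((h2 k).mul (hl k)).sub (hd.mul (h2 k))).sub (h5.mul (h1 k))
    have h7 : Measurable fun p : (Fin n → ℂ) × (Fin n → ℂ) =>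
        (recState p.1 p.2 (j + 1)).sub :=
      Finset.measurable_fun_sum Finset.univ fun k _ => ((h6 k).mul (hl k)).mul (h4 k)
    exact ⟨h2, h6, h4, fun k =>
      ((((hl k).mul (h4 k)).sub (hd.mul (h4 k))).sub (h3 k)).div h7, h7⟩

lemma measurable_diag_recState (j : ℕ) :
    Measurable fun p : (Fin n → ℂ) × (Fin n → ℂ) => (recState p.1 p.2 j).diag p.1 :=
  Finset.measurable_fun_sum _ fun k _ => (((measurable_recState j).2.1 k).mul
    ((measurable_pi_apply k).comp measurable_fst)).mul ((measurable_recState j).2.2.2.1 k)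

lemma measurable_reconstruct (i j : Fin (m + 1)) :
    Measurable fun p : (Fin (m + 1) → ℂ) × (Fin (m + 1) → ℂ) => reconstruct p.1 p.2 i j := by
  simp only [reconstruct, tridiag, Matrix.of_apply]
  split_ifs
  · exact measurable_diag_recState _
  · exact measurable_const
  · exact (measurable_recState _).2.2.2.2
  · exact measurable_const

lemma measurable_g :
    Measurable fun p : (Fin (m + 1) → ℂ) × (Fin (m + 1) → ℂ) => g p.1 p.2 := by
  refine Measurable.div_const (Measurable.sub ?_ ?_) 2
  · exact Finset.measurable_fun_sum _ fun i _ => Finset.measurable_fun_sum _ fun j _ =>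
      ((measurable_reconstruct i j).norm).pow_const 2
  · exact Finset.measurable_fun_sum _ fun j _ =>
      (((measurable_pi_apply j).comp measurable_fst).norm).pow_const 2

lemma measurable_complete : Measurable (complete : (Fin m → ℂ) → Fin (m + 1) → ℂ) :=
  continuous_complete.measurable

lemma measurable_fIntegrand (β : ℝ) :
    Measurable fun p : (Fin (m + 1) → ℂ) × (Fin m → ℂ) => fIntegrand β p.1 p.2 := by
  have hc : Measurable fun p : (Fin (m + 1) → ℂ) × (Fin m → ℂ) => complete p.2 :=
    measurable_complete.comp measurable_snd
  refine Measurable.mul (Real.measurable_exp.comp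
    (measurable_g.comp (measurable_fst.prodMk hc)).neg) ?_
  exact Finset.measurable_fun_prod _ fun k _ =>
    (((measurable_pi_apply k).comp hc).norm).pow_const _

end Measurability

/-! ### Permutations of the weights -/

section Permutation

variable {m : ℕ}

lemma sum_complete_comp (r : Fin m → ℂ) (σ : Equiv.Perm (Fin (m + 1))) :
    ∑ k, complete r (σ k) = 1 := by
  rw [Equiv.sum_comp σ (complete r), sum_complete]

/-- The action of a permutation of the weights on the first `m` weights. -/
def permWeights (σ : Equiv.Perm (Fin (m + 1))) (r : Fin m → ℂ) : Fin m → ℂ :=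
  fun k => complete r (σ k.castSucc)

lemma complete_permWeights (σ : Equiv.Perm (Fin (m + 1))) (r : Fin m → ℂ) :
    complete (permWeights σ r) = complete r ∘ σ := by
  funext k
  refine Fin.lastCases ?_ (fun k => ?_) k
  · have h := sum_complete_comp r σ
    rw [Fin.sum_univ_castSucc] at h
    simp only [complete, Fin.snoc_last, Function.comp_apply]
    rw [sub_eq_iff_eq_add']
    exact h.symm
  · simp only [complete, Fin.snoc_castSucc, Function.comp_apply, permWeights]

lemma complete_injective : Function.Injective (complete : (Fin m → ℂ) → Fin (m + 1) → ℂ) := by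
  intro r r' h
  funext k
  have := congrFun h k.castSucc
  simpa only [complete, Fin.snoc_castSucc] using this

lemma permWeights_mul (σ τ : Equiv.Perm (Fin (m + 1))) (r : Fin m → ℂ) :
    permWeights (σ * τ) r = permWeights τ (permWeights σ r) := by
  apply complete_injective
  rw [complete_permWeights, complete_permWeights, complete_permWeights]
  rfl

lemma permWeights_one (r : Fin m → ℂ) : permWeights 1 r = r := by
  apply complete_injective
  rw [complete_permWeights]
  rfl

/-- The linear part of `permWeights`. -/
def permWeightsLinear (σ : Equiv.Perm (Fin (m + 1))) : (Fin m → ℂ) →ₗ[ℝ] (Fin m → ℂ) where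
  toFun r := permWeights σ r - permWeights σ 0
  map_add' r r' := by
    funext k
    simp only [permWeights, complete, Pi.sub_apply, Pi.add_apply]
    refine Fin.lastCases ?_ (fun l => ?_) (σ k.castSucc)
    · simp only [Fin.snoc_last, Finset.sum_add_distrib, Pi.zero_apply,
        Finset.sum_const_zero]
      ring
    · simp only [Fin.snoc_castSucc, Pi.add_apply, Pi.zero_apply]
      ring
  map_smul' c r := by
    funext k
    simp only [permWeights, complete, Pi.sub_apply, Pi.smul_apply, RingHom.id_apply]
    refine Fin.lastCases ?_ (fun l => ?_) (σ k.castSucc)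
    · simp only [Fin.snoc_last, ← Finset.smul_sum, Pi.zero_apply,
        Finset.sum_const_zero, smul_sub, smul_zero]
      ring
    · simp only [Fin.snoc_castSucc, Pi.smul_apply, Pi.zero_apply, sub_zero]

lemma permWeights_eq (σ : Equiv.Perm (Fin (m + 1))) (r : Fin m → ℂ) :
    permWeights σ r = permWeightsLinear σ r + permWeights σ 0 :=
  (sub_add_cancel _ _).symm

lemma permWeightsLinear_mul (σ τ : Equiv.Perm (Fin (m + 1))) :
    permWeightsLinear (σ * τ) = permWeightsLinear τ ∘ₗ permWeightsLinear σ := by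
  refine LinearMap.ext fun r => ?_
  have h1 : permWeightsLinear (σ * τ) r = permWeights (σ * τ) r - permWeights (σ * τ) 0 := rfl
  rw [h1, permWeights_mul, permWeights_mul, permWeights_eq σ r, permWeights_eq τ,
    permWeights_eq τ (permWeights σ 0), map_add, LinearMap.comp_apply]
  abel

lemma permWeightsLinear_one :
    permWeightsLinear (1 : Equiv.Perm (Fin (m + 1))) = LinearMap.id := by
  refine LinearMap.ext fun r => ?_
  change permWeights 1 r - permWeights 1 0 = r
  rw [permWeights_one, permWeights_one, sub_zero]

lemma det_permWeightsLinear_pow (σ : Equiv.Perm (Fin (m + 1))) (k : ℕ) :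
    LinearMap.det (permWeightsLinear (σ ^ k)) = LinearMap.det (permWeightsLinear σ) ^ k := by
  induction k with
  | zero => rw [pow_zero, pow_zero, permWeightsLinear_one, LinearMap.det_id]
  | succ k ih => rw [pow_succ, permWeightsLinear_mul, LinearMap.det_comp, ih, pow_succ, mul_comm]

/-- A permutation has finite order and the determinant is multiplicative, so a power of the
determinant is `1`. -/
lemma abs_det_permWeightsLinear (σ : Equiv.Perm (Fin (m + 1))) :
    |LinearMap.det (permWeightsLinear σ)| = 1 := by
  have h := det_permWeightsLinear_pow σ (orderOf σ)
  rw [pow_orderOf_eq_one, permWeightsLinear_one, LinearMap.det_id] at h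
  have h2 : |LinearMap.det (permWeightsLinear σ)| ^ orderOf σ = 1 := by
    rw [← abs_pow, ← h, abs_one]
  exact (pow_eq_one_iff_of_nonneg (abs_nonneg _) (orderOf_pos σ).ne').1 h2

lemma measurePreserving_permWeights (σ : Equiv.Perm (Fin (m + 1))) :
    MeasurePreserving (permWeights σ : (Fin m → ℂ) → Fin m → ℂ) := by
  have hdet : LinearMap.det (permWeightsLinear σ) ≠ 0 := by
    intro h
    have := abs_det_permWeightsLinear σ
    rw [h, abs_zero] at this
    exact zero_ne_one this
  have h1 : MeasurePreserving (permWeightsLinear σ : (Fin m → ℂ) → Fin m → ℂ) := by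
    refine ⟨(permWeightsLinear σ).continuous_of_finiteDimensional.measurable, ?_⟩
    rw [Measure.map_linearMap_addHaar_eq_smul_addHaar _ hdet, abs_inv,
      abs_det_permWeightsLinear, inv_one, ENNReal.ofReal_one, one_smul]
  have h2 := (measurePreserving_add_right (volume : Measure (Fin m → ℂ))
    (permWeights σ 0)).comp h1
  rwa [show (permWeights σ : (Fin m → ℂ) → Fin m → ℂ) =
    (fun x => x + permWeights σ 0) ∘ permWeightsLinear σ from funext (permWeights_eq σ)]

end Permutation

end

section

/-! ### Integrability of the eigenvector integrand -/

section Bound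

open Matrix

variable {m : ℕ} {lam : Fin (m + 1) → ℂ}

lemma norm_pow_entry_le {n : ℕ} {T : Matrix (Fin n) (Fin n) ℂ} {B : ℝ}
    (hB : ∀ i j, ‖T i j‖ ≤ B) (t : ℕ) (i j : Fin n) : ‖(T ^ t) i j‖ ≤ (n * B) ^ t := by
  induction t generalizing i j with
  | zero =>
    rw [pow_zero, pow_zero, Matrix.one_apply]
    split_ifs <;> simp
  | succ t ih =>
    rw [pow_succ, Matrix.mul_apply]
    refine (norm_sum_le _ _).trans ?_
    have : ∀ k ∈ Finset.univ, ‖(T ^ t) i k * T k j‖ ≤ (n * B) ^ t * B := fun k _ => by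
      rw [norm_mul]
      exact mul_le_mul (ih i k) (hB k j) (norm_nonneg _) ((norm_nonneg _).trans (ih i k))
    refine (Finset.sum_le_sum this).trans (le_of_eq ?_)
    rw [Finset.sum_const, Finset.card_univ, Fintype.card_fin, nsmul_eq_mul]
    ring

lemma pow_mul_diagonal_mul {n : ℕ} {R L : Matrix (Fin n) (Fin n) ℂ} (hLR : L * R = 1)
    (hRL : R * L = 1) (lam : Fin n → ℂ) (t : ℕ) :
    (R * Matrix.diagonal lam * L) ^ t = R * Matrix.diagonal (lam ^ t) * L := by
  induction t with
  | zero => rw [pow_zero, pow_zero, Matrix.diagonal_one', Matrix.mul_one, hRL]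
  | succ t ih =>
    rw [pow_succ, ih]
    calc _ = R * Matrix.diagonal (lam ^ t) * (L * R) * Matrix.diagonal lam * L := by
          simp only [Matrix.mul_assoc]
      _ = _ := by
          rw [hLR, Matrix.mul_one, Matrix.mul_assoc R, Matrix.diagonal_mul_diagonal]
          rfl

/-- `T ^ t = R Λ ^ t R⁻¹`, read in the corner where `R` has row `r` and `R⁻¹` has column `1`. This
links the weights to the size of the matrix. -/
lemma Admissible.sum_mul_pow {r : Fin (m + 1) → ℂ} (h : Admissible lam r) (t : ℕ) :
    ∑ k, r k * lam k ^ t = (reconstruct lam r ^ t) 0 0 := by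
  obtain ⟨a, b, hb, hs⟩ := h
  rw [reconstruct_eq hb hs]
  obtain ⟨R, L, hRL, hLR, hT, h0, h1⟩ := hs.exists_inverse
  rw [hT, pow_mul_diagonal_mul hLR hRL, Matrix.mul_apply]
  refine Finset.sum_congr rfl fun k _ => ?_
  rw [Matrix.mul_diagonal, h0, h1, mul_one]
  rfl

lemma norm_reconstruct_le (lam r : Fin (m + 1) → ℂ) (i j : Fin (m + 1)) :
    ‖reconstruct lam r i j‖ ≤ 1 + 2 * g lam r + ∑ j, ‖lam j‖ ^ 2 := by
  have h1 : ‖reconstruct lam r i j‖ ^ 2 ≤ ∑ i, ∑ j, ‖reconstruct lam r i j‖ ^ 2 :=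
    (Finset.single_le_sum (f := fun j => ‖reconstruct lam r i j‖ ^ 2)
      (fun j _ => sq_nonneg _) (Finset.mem_univ j)).trans
      (Finset.single_le_sum (f := fun i => ∑ j, ‖reconstruct lam r i j‖ ^ 2)
      (fun i _ => Finset.sum_nonneg fun j _ => sq_nonneg _) (Finset.mem_univ i))
  have h2 : ∑ i, ∑ j, ‖reconstruct lam r i j‖ ^ 2 = 2 * g lam r + ∑ j, ‖lam j‖ ^ 2 := by
    rw [g]
    ring
  nlinarith [sq_nonneg (‖reconstruct lam r i j‖ - 1)]

/-- The first `m + 1` moments are corner entries of powers of the matrix up to the `m`-th, and the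
matrix entries are bounded by a multiple of `1 + g` for fixed `lam`. The inverse Vandermonde matrix
turns moments back into weights. -/
lemma exists_weight_bound (hlam : Function.Injective lam) :
    ∃ C : ℝ, ∀ r, Admissible lam r → ∀ k, 1 + ‖r k‖ ≤ C * (1 + g lam r) ^ m := by
  set V := Matrix.vandermonde lam with hV
  have hdet : IsUnit V.det := (Matrix.det_vandermonde_ne_zero_iff.2 hlam).isUnit
  set S := ∑ j, ‖lam j‖ ^ 2 with hS
  have hS0 : 0 ≤ S := Finset.sum_nonneg fun _ _ => sq_nonneg _
  set D : ℝ := (((m + 1 : ℕ) : ℝ) * (2 + S)) ^ m with hD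
  have hD0 : 0 ≤ D := by positivity
  refine ⟨1 + ∑ t, ∑ k, D * ‖V⁻¹ t k‖, fun r h k => ?_⟩
  have hg := (g_nonneg_and_eq_zero_iff h).1
  have hB : ∀ i j, ‖reconstruct lam r i j‖ ≤ (2 + S) * (1 + g lam r) := fun i j =>
    (norm_reconstruct_le lam r i j).trans (by nlinarith)
  have h1 : (1 : ℝ) ≤ (m + 1 : ℕ) * ((2 + S) * (1 + g lam r)) := by
    have : (1 : ℝ) ≤ (m + 1 : ℕ) := by exact_mod_cast Nat.succ_le_succ (Nat.zero_le m)
    nlinarith [mul_nonneg hS0 hg]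
  have hr : r = (fun t : Fin (m + 1) => (reconstruct lam r ^ t.1) 0 0) ᵥ* V⁻¹ := by
    have : (fun t : Fin (m + 1) => (reconstruct lam r ^ t.1) 0 0) = r ᵥ* V := by
      funext t
      rw [← h.sum_mul_pow]
      rfl
    rw [this, Matrix.vecMul_vecMul, Matrix.mul_nonsing_inv V hdet, Matrix.vecMul_one]
  have h2 : ‖r k‖ ≤ ∑ t, D * (1 + g lam r) ^ m * ‖V⁻¹ t k‖ := by
    conv_lhs => rw [hr]
    rw [Matrix.vecMul, dotProduct]
    refine (norm_sum_le _ _).trans (Finset.sum_le_sum fun t _ => ?_)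
    rw [norm_mul]
    refine mul_le_mul_of_nonneg_right ((norm_pow_entry_le hB t.1 0 0).trans ?_) (norm_nonneg _)
    refine (pow_le_pow_right₀ h1 (Nat.lt_succ_iff.1 t.2)).trans (le_of_eq ?_)
    rw [hD, ← mul_pow]
    ring
  have h3 : ∑ t, D * (1 + g lam r) ^ m * ‖V⁻¹ t k‖ =
      (∑ t, D * ‖V⁻¹ t k‖) * (1 + g lam r) ^ m := by
    rw [Finset.sum_mul]
    exact Finset.sum_congr rfl fun t _ => by ring
  have h4 : ∑ t, D * ‖V⁻¹ t k‖ ≤ ∑ t, ∑ k, D * ‖V⁻¹ t k‖ :=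
    Finset.sum_le_sum fun t _ => Finset.single_le_sum (f := fun k => D * ‖V⁻¹ t k‖)
      (fun k _ => mul_nonneg hD0 (norm_nonneg _)) (Finset.mem_univ k)
  have h5 : 1 ≤ (1 + g lam r) ^ m := one_le_pow₀ (by linarith)
  rw [add_mul, one_mul]
  refine add_le_add h5 (h2.trans (h3.trans_le ?_))
  exact mul_le_mul_of_nonneg_right h4 (zero_le_one.trans h5)

lemma exp_neg_mul_one_add_pow_le {x : ℝ} (hx : 0 ≤ x) (M : ℕ) :
    Real.exp (-x) * (1 + x) ^ M ≤ M.factorial * Real.exp 1 := by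
  have h := Real.pow_div_factorial_le_exp _ (add_nonneg zero_le_one hx) M
  rw [div_le_iff₀ (by positivity), Real.exp_add] at h
  calc Real.exp (-x) * (1 + x) ^ M ≤
      Real.exp (-x) * (Real.exp 1 * Real.exp x * M.factorial) :=
        mul_le_mul_of_nonneg_left h (Real.exp_pos _).le
    _ = (Real.exp (-x) * Real.exp x) * (M.factorial * Real.exp 1) := by ring
    _ = _ := by rw [← Real.exp_add, neg_add_cancel, Real.exp_zero, one_mul]

end Bound

/-! ### An integrable weight on the plane -/

section Dominating

/-- The weight `|z|^{s-2} (1 + |z|)^{-(s+1)}`, which is integrable on `ℂ` for `s > 0`. -/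
def decayWeight (s : ℝ) (z : ℂ) : ℝ := ‖z‖ ^ (s - 2) * (1 + ‖z‖) ^ (-(s + 1))

lemma decayWeight_nonneg (s : ℝ) (z : ℂ) : 0 ≤ decayWeight s z := by
  unfold decayWeight
  positivity

lemma measurable_decayWeight (s : ℝ) : Measurable (decayWeight s) :=
  (measurable_norm.pow_const _).mul ((measurable_norm.const_add 1).pow_const _)

lemma integrable_decayWeight {s : ℝ} (hs : 0 < s) : Integrable (decayWeight s) := by
  have h1 : Integrable fun z : ℂ => ‖z‖ ^ (s - 2) * Real.exp (-‖z‖ ^ (1 : ℝ)) := by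
    -- A function that is not integrable has integral `0` by convention, whereas the closed formula
    -- for this integral is positive.
    by_contra h
    have h2 := Complex.integral_rpow_mul_exp_neg_rpow (le_refl (1 : ℝ))
      (show -2 < s - 2 by linarith)
    rw [integral_undef h] at h2
    have h3 : 0 < Real.Gamma ((s - 2 + 2) / 1) := Real.Gamma_pos_of_pos (by linarith)
    have : 0 < (2 * Real.pi / 1) * Real.Gamma ((s - 2 + 2) / 1) := by positivity
    exact this.ne h2
  have h2 : Integrable fun z : ℂ => (1 + ‖z‖) ^ (-(3 : ℝ)) :=
    integrable_one_add_norm (by rw [Complex.finrank_real_complex]; norm_num)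
  refine ((h1.const_mul (Real.exp 1)).add (h2.const_mul 4)).mono'
    (measurable_decayWeight s).aestronglyMeasurable (Filter.Eventually.of_forall fun z => ?_)
  rw [Real.norm_of_nonneg (decayWeight_nonneg s z), decayWeight]
  simp only [Pi.add_apply, Real.rpow_one]
  have hx : 0 ≤ ‖z‖ := norm_nonneg z
  set x := ‖z‖
  rcases le_or_gt x 1 with h | h
  · have e1 : (1 + x) ^ (-(s + 1)) ≤ 1 :=
      Real.rpow_le_one_of_one_le_of_nonpos (by linarith) (by linarith)
    have e2 : 1 ≤ Real.exp 1 * Real.exp (-x) := by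
      rw [← Real.exp_add]
      exact Real.one_le_exp (by linarith)
    have e3 : 0 ≤ x ^ (s - 2) := by positivity
    have e4 : 0 ≤ 4 * (1 + x) ^ (-(3 : ℝ)) := by positivity
    nlinarith [mul_le_mul_of_nonneg_left e1 e3, mul_le_mul_of_nonneg_left e2 e3]
  · have hx0 : 0 < x := by linarith
    have e1 : x ^ (s - 2) * (1 + x) ^ (-(s + 1)) ≤ 4 * (1 + x) ^ (-(3 : ℝ)) := by
      rw [Real.rpow_sub hx0, Real.rpow_neg (by linarith), Real.rpow_neg (by linarith),
        Real.rpow_add (by linarith), Real.rpow_one]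
      norm_cast
      have hA : 0 < x ^ s := by positivity
      have hAB : x ^ s ≤ (1 + x) ^ s := Real.rpow_le_rpow hx (by linarith) hs.le
      have hB : 0 < (1 + x) ^ s := hA.trans_le hAB
      rw [← div_eq_mul_inv, ← div_eq_mul_inv, div_div, div_le_div_iff₀ (by positivity)
        (by positivity)]
      have : (1 + x) ^ 3 ≤ 4 * (x ^ 2 * (1 + x)) := by nlinarith [sq_nonneg (x - 1)]
      calc x ^ s * (1 + x) ^ 3 ≤ (1 + x) ^ s * (4 * (x ^ 2 * (1 + x))) :=
            mul_le_mul hAB this (by positivity) hB.le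
        _ = _ := by ring
    have e2 : 0 ≤ Real.exp 1 * (x ^ (s - 2) * Real.exp (-x)) := by positivity
    linarith

lemma rpow_mul_inv_le (s : ℝ) (z : ℂ) :
    ‖z‖ ^ (s - 1) * ‖z‖⁻¹ ≤ decayWeight s z * (1 + ‖z‖) ^ (s + 1) := by
  rw [decayWeight, mul_assoc, ← Real.rpow_add (by positivity), neg_add_cancel, Real.rpow_zero,
    mul_one]
  rcases (norm_nonneg z).eq_or_lt with h | h
  · rw [← h, inv_zero, mul_zero]
    positivity
  · rw [← Real.rpow_neg_one, ← Real.rpow_add h]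
    exact le_of_eq (by congr 1; ring)

lemma rpow_mul_inv_le_of_le {s c : ℝ} (hs : 0 < s) (hc : 0 < c) {z : ℂ} (hz : c ≤ ‖z‖) :
    ‖z‖ ^ (s - 1) * ‖z‖⁻¹ ≤ (c ^ 2)⁻¹ * (1 + ‖z‖) ^ (s + 1) := by
  have h : 0 < ‖z‖ := hc.trans_le hz
  rw [Real.rpow_sub h, Real.rpow_one, div_eq_mul_inv, mul_assoc, ← mul_inv, ← sq, mul_comm]
  refine mul_le_mul (inv_anti₀ (by positivity) (pow_le_pow_left₀ hc.le hz 2)) ?_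
    (by positivity) (by positivity)
  exact (Real.rpow_le_rpow h.le (by linarith) hs.le).trans
    (Real.rpow_le_rpow_of_exponent_le (by linarith) (by linarith))

end Dominating

/-! ### Domination of the eigenvector integrand -/

section Integrability

variable {m : ℕ} {lam : Fin (m + 1) → ℂ}

lemma exists_norm_complete_ge (r : Fin m → ℂ) :
    ∃ k, ((m + 1 : ℕ) : ℝ)⁻¹ ≤ ‖complete r k‖ := by
  by_contra! h
  have h1 : ‖∑ k, complete r k‖ < 1 := by
    refine (norm_sum_le _ _).trans_lt ((Finset.sum_lt_sum_of_nonempty Finset.univ_nonempty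
      fun k _ => h k).trans_eq ?_)
    rw [Finset.sum_const, Finset.card_univ, Fintype.card_fin, nsmul_eq_mul]
    exact mul_inv_cancel₀ (by positivity)
  rw [sum_complete, norm_one] at h1
  exact lt_irrefl _ h1

/-- Since the weights sum to `1`, one of them has modulus at least `1 / (m + 1)`; its singular
factor is harmless, and a transposition moves it to the last place so that the others are free
coordinates. The factors `(1 + ‖r k‖) ^ (s + 1)` lost in passing to `decayWeight` are absorbed by
`exp (-g)`. Summing over `k` covers all choices of the large weight. -/
lemma exists_integrand_bound (hlam : Function.Injective lam) {s : ℝ} (hs : 0 < s) :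
    ∃ C : ℝ, 0 ≤ C ∧ ∀ r : Fin m → ℂ, Admissible lam (complete r) →
      Real.exp (-g lam (complete r)) *
        ∏ k, (‖complete r k‖ ^ (s - 1) * ‖complete r k‖⁻¹) ≤
      C * ∑ k, ∏ l, decayWeight s (permWeights (Equiv.swap (Fin.last m) k) r l) := by
  obtain ⟨C, hC⟩ := exists_weight_bound hlam
  -- A natural exponent above `s + 1`, so that the product of the `m + 1` factors is bounded by a
  -- power of `1 + g` with natural exponent `M = m * N * (m + 1)`.
  set N := ⌈s + 1⌉₊
  set c : ℝ := ((m + 1 : ℕ) : ℝ)⁻¹ with hc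
  have hc0 : 0 < c := by positivity
  set M := m * (N * (m + 1))
  refine ⟨(c ^ 2)⁻¹ * (|C| ^ (N * (m + 1)) * (M.factorial * Real.exp 1)), by positivity,
    fun r h => ?_⟩
  obtain ⟨k, hk⟩ := exists_norm_complete_ge r
  have hg := (g_nonneg_and_eq_zero_iff h).1
  have hsum : ∏ l, decayWeight s (permWeights (Equiv.swap (Fin.last m) k) r l) ≤
      ∑ k, ∏ l, decayWeight s (permWeights (Equiv.swap (Fin.last m) k) r l) :=
    Finset.single_le_sum (f := fun k => ∏ l, decayWeight s
      (permWeights (Equiv.swap (Fin.last m) k) r l))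
      (fun k _ => Finset.prod_nonneg fun l _ => decayWeight_nonneg _ _) (Finset.mem_univ k)
  refine le_trans ?_ (mul_le_mul_of_nonneg_left hsum (by positivity))
  set σ := Equiv.swap (Fin.last m) k with hσ
  have hσl : σ (Fin.last m) = k := Equiv.swap_apply_left _ _
  have h1 : ∏ k, (‖complete r k‖ ^ (s - 1) * ‖complete r k‖⁻¹) ≤
      (c ^ 2)⁻¹ * (∏ k, (1 + ‖complete r k‖) ^ (s + 1)) *
        ∏ l, decayWeight s (permWeights σ r l) := by
    rw [← Equiv.prod_comp σ, ← Equiv.prod_comp σ (fun k => (1 + ‖complete r k‖) ^ (s + 1)),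
      Fin.prod_univ_castSucc, Fin.prod_univ_castSucc, hσl]
    have e1 : ∏ l : Fin m, (‖complete r (σ l.castSucc)‖ ^ (s - 1) *
        ‖complete r (σ l.castSucc)‖⁻¹) ≤ (∏ l : Fin m, decayWeight s (permWeights σ r l)) *
        ∏ l : Fin m, (1 + ‖complete r (σ l.castSucc)‖) ^ (s + 1) := by
      rw [← Finset.prod_mul_distrib]
      exact Finset.prod_le_prod (fun l _ => by positivity) fun l _ => rpow_mul_inv_le s _
    refine (mul_le_mul e1 (rpow_mul_inv_le_of_le hs hc0 hk) (by positivity) ?_).trans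
      (le_of_eq (by ring))
    exact mul_nonneg (Finset.prod_nonneg fun l _ => decayWeight_nonneg _ _) (by positivity)
  have h2 : ∏ k, (1 + ‖complete r k‖) ^ (s + 1) ≤
      |C| ^ (N * (m + 1)) * (1 + g lam (complete r)) ^ M := by
    have e1 : ∀ k ∈ Finset.univ, (1 + ‖complete r k‖) ^ (s + 1) ≤
        (|C| * (1 + g lam (complete r)) ^ m) ^ N := fun k _ => by
      refine (Real.rpow_le_rpow_of_exponent_le (by linarith [norm_nonneg (complete r k)])
        (Nat.le_ceil (s + 1))).trans ?_
      rw [Real.rpow_natCast]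
      refine pow_le_pow_left₀ (by positivity) ((hC _ h k).trans ?_) N
      exact mul_le_mul_of_nonneg_right (le_abs_self C) (by positivity)
    refine (Finset.prod_le_prod (fun k _ => by positivity) e1).trans (le_of_eq ?_)
    rw [Finset.prod_const, Finset.card_univ, Fintype.card_fin, ← pow_mul, mul_pow, ← pow_mul]
  have hD : 0 ≤ ∏ l, decayWeight s (permWeights σ r l) :=
    Finset.prod_nonneg fun l _ => decayWeight_nonneg _ _
  calc _ ≤ Real.exp (-g lam (complete r)) * ((c ^ 2)⁻¹ *
        (|C| ^ (N * (m + 1)) * (1 + g lam (complete r)) ^ M) *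
        ∏ l, decayWeight s (permWeights σ r l)) := by
        refine mul_le_mul_of_nonneg_left (h1.trans ?_) (Real.exp_pos _).le
        exact mul_le_mul_of_nonneg_right (mul_le_mul_of_nonneg_left h2 (by positivity)) hD
    _ = (c ^ 2)⁻¹ * (|C| ^ (N * (m + 1)) * (Real.exp (-g lam (complete r)) *
        (1 + g lam (complete r)) ^ M)) * ∏ l, decayWeight s (permWeights σ r l) := by ring
    _ ≤ _ := by
        refine mul_le_mul_of_nonneg_right (mul_le_mul_of_nonneg_left ?_ (by positivity)) hD
        exact mul_le_mul_of_nonneg_left (exp_neg_mul_one_add_pow_le hg M) (by positivity)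

lemma measurable_eigenvectorDensity :
    Measurable fun r : Fin m → ℂ => ∏ k, ENNReal.ofReal ‖complete r k‖⁻¹ :=
  Finset.measurable_fun_prod _ fun k _ =>
    (((measurable_pi_apply k).comp measurable_complete).norm.inv).ennreal_ofReal

lemma integrable_fIntegrand (hlam : Function.Injective lam) {β : ℝ} (hβ : 0 < β) :
    Integrable (fIntegrand β lam) (eigenvectorMeasure m) := by
  have hlt : ∀ r : Fin m → ℂ, ∏ k, ENNReal.ofReal ‖complete r k‖⁻¹ < ⊤ := fun r =>
    ENNReal.prod_lt_top fun k _ => ENNReal.ofReal_lt_top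
  rw [eigenvectorMeasure, integrable_withDensity_iff_integrable_smul'
    measurable_eigenvectorDensity (Filter.Eventually.of_forall hlt)]
  obtain ⟨C, hC0, hC⟩ := exists_integrand_bound hlam (s := β / 2) (by linarith)
  have hint : Integrable fun r : Fin m → ℂ => C * ∑ k, ∏ l,
      decayWeight (β / 2) (permWeights (Equiv.swap (Fin.last m) k) r l) := by
    refine (integrable_finsetSum _ fun k _ => ?_).const_mul C
    exact (measurePreserving_permWeights (Equiv.swap (Fin.last m) k)).integrable_comp_of_integrable
      (g := fun r : Fin m → ℂ => ∏ l, decayWeight (β / 2) (r l))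
      (Integrable.fintype_prod fun _ => integrable_decayWeight (by linarith))
  refine hint.mono' ?_ ?_
  · exact (measurable_eigenvectorDensity.ennreal_toReal.smul
      ((measurable_fIntegrand β).comp measurable_prodMk_left)).aestronglyMeasurable
  · filter_upwards [ae_admissible hlam] with r hr
    refine le_trans (le_of_eq ?_) (hC r hr)
    have h0 : 0 ≤ fIntegrand β lam r := by
      unfold fIntegrand
      positivity
    rw [norm_smul, Real.norm_of_nonneg h0, Real.norm_of_nonneg ENNReal.toReal_nonneg,
      ENNReal.toReal_prod, Finset.prod_mul_distrib, fIntegrand]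
    simp only [ENNReal.toReal_ofReal (inv_nonneg.2 (norm_nonneg _))]
    ring

end Integrability

end

section

/-! ### The entries as coordinates on pairs of consecutive characteristic polynomials -/

section Coefficients

variable {m n : ℕ}

/-- The coefficients of `(x - a) p(x) - b q(x)`, where `p` and `q` are monic polynomials given by
their lower coefficients. -/
def coeffStep (p : Fin (m + 1) → ℂ) (q : Fin m → ℂ) (a b : ℂ) : Fin (m + 2) → ℂ :=
  fun c => Fin.cons (α := fun _ => ℂ) 0 p c - a * Fin.snoc (α := fun _ => ℂ) p 1 c -
    b * Fin.snoc (α := fun _ => ℂ) (Fin.snoc (α := fun _ => ℂ) q 1) 0 c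

/-- The coefficients of the characteristic polynomials of `tridiag a b` and of its lower right
block of size `m`. -/
def charCoeffs : {m : ℕ} → (Fin (m + 1) → ℂ) × (Fin m → ℂ) → (Fin (m + 1) → ℂ) × (Fin m → ℂ)
  | 0, x => (fun _ => -x.1 0, Fin.elim0)
  | m + 1, x => (coeffStep
      (charCoeffs (Fin.init (α := fun _ => ℂ) x.1, Fin.init (α := fun _ => ℂ) x.2)).1
      (charCoeffs (Fin.init (α := fun _ => ℂ) x.1, Fin.init (α := fun _ => ℂ) x.2)).2
      (x.1 (Fin.last (m + 1))) (x.2 (Fin.last m)),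
      (charCoeffs (Fin.init (α := fun _ => ℂ) x.1, Fin.init (α := fun _ => ℂ) x.2)).1)

lemma continuous_snoc : Continuous fun x : (Fin n → ℂ) × ℂ =>
    (Fin.snoc (α := fun _ => ℂ) x.1 x.2 : Fin (n + 1) → ℂ) := by
  refine continuous_pi fun k => ?_
  refine Fin.lastCases ?_ (fun k => ?_) k
  · simp only [Fin.snoc_last]
    exact continuous_snd
  · simp only [Fin.snoc_castSucc]
    exact (continuous_apply k).comp continuous_fst

lemma continuous_init : Continuous fun x : Fin (n + 1) → ℂ => Fin.init (α := fun _ => ℂ) x :=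
  continuous_pi fun k => continuous_apply k.castSucc

lemma continuous_coeffStep :
    Continuous fun x : ((Fin (m + 1) → ℂ) × (Fin m → ℂ)) × ℂ × ℂ =>
      coeffStep x.1.1 x.1.2 x.2.1 x.2.2 := by
  refine continuous_pi fun c => Continuous.sub (Continuous.sub ?_ ?_) ?_
  · refine Fin.cases ?_ (fun c => ?_) c
    · exact continuous_const
    · simp only [Fin.cons_succ]
      fun_prop
  · refine Continuous.mul (by fun_prop) ?_
    exact (continuous_apply c).comp (continuous_snoc.comp
      (Continuous.prodMk (continuous_fst.comp continuous_fst) continuous_const))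
  · refine Continuous.mul (by fun_prop) ?_
    exact (continuous_apply c).comp (continuous_snoc.comp (Continuous.prodMk (continuous_snoc.comp
      (Continuous.prodMk (continuous_snd.comp continuous_fst) continuous_const))
      continuous_const))

lemma continuous_charCoeffs :
    Continuous (charCoeffs : (Fin (m + 1) → ℂ) × (Fin m → ℂ) → _) := by
  induction m with
  | zero =>
    refine Continuous.prodMk (continuous_pi fun _ => ?_) continuous_const
    fun_prop
  | succ m ih =>
    have h : Continuous fun x : (Fin (m + 2) → ℂ) × (Fin (m + 1) → ℂ) =>
        charCoeffs (Fin.init (α := fun _ => ℂ) x.1, Fin.init (α := fun _ => ℂ) x.2) :=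
      ih.comp (Continuous.prodMk (continuous_init.comp continuous_fst)
        (continuous_init.comp continuous_snd))
    have h' : Continuous fun x : (Fin (m + 2) → ℂ) × (Fin (m + 1) → ℂ) =>
        (x.1 (Fin.last (m + 1)), x.2 (Fin.last m)) := by fun_prop
    exact Continuous.prodMk (continuous_coeffStep.comp (h.prodMk h'))
      (continuous_fst.comp h)

/-- Displays the triangular structure: the top coefficient involves only `a`, the next one also `b`,
and the rest are a translate of `-b * q`. Injectivity and the Jacobian both follow from it. -/
lemma coeffStep_eq_snoc (p : Fin (m + 1) → ℂ) (q : Fin m → ℂ) (a b : ℂ) :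
    coeffStep p q a b = Fin.snoc (α := fun _ => ℂ) (Fin.snoc (α := fun _ => ℂ)
      (fun c : Fin m => Fin.cons (α := fun _ => ℂ) 0 p c.castSucc.castSucc - a * p c.castSucc -
        b * q c)
      (Fin.cons (α := fun _ => ℂ) 0 p (Fin.last m).castSucc - a * p (Fin.last m) - b))
      (p (Fin.last m) - a) := by
  funext c
  refine Fin.lastCases ?_ (fun c => ?_) c
  · simp only [coeffStep, Fin.snoc_last]
    rw [← Fin.succ_last, Fin.cons_succ]
    ring
  · refine Fin.lastCases ?_ (fun c => ?_) c
    · simp only [coeffStep, Fin.snoc_last, Fin.snoc_castSucc]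
      ring
    · simp only [coeffStep, Fin.snoc_castSucc]

lemma coeffStep_injective {p : Fin (m + 1) → ℂ} {q q' : Fin m → ℂ} {a a' b b' : ℂ} (hb : b ≠ 0)
    (h : coeffStep p q a b = coeffStep p q' a' b') : q = q' ∧ a = a' ∧ b = b' := by
  rw [coeffStep_eq_snoc, coeffStep_eq_snoc] at h
  have h1 := congrFun h (Fin.last _)
  simp only [Fin.snoc_last, sub_right_inj] at h1
  have h2 := congrFun h (Fin.last _).castSucc
  simp only [Fin.snoc_castSucc, Fin.snoc_last, h1, sub_right_inj] at h2
  refine ⟨funext fun c => ?_, h1, h2⟩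
  have h3 := congrFun h c.castSucc.castSucc
  simp only [Fin.snoc_castSucc, h1, h2, sub_right_inj] at h3
  exact mul_left_cancel₀ (h2 ▸ hb) h3

/-- The entries are peeled off from the top. Given `p`, the pair `(a, b)` is read off the two
highest coefficients, and then `q` is recovered by dividing by `b`. -/
lemma charCoeffs_injOn : Set.InjOn (charCoeffs : (Fin (m + 1) → ℂ) × (Fin m → ℂ) → _)
    {x | ∀ k, x.2 k ≠ 0} := by
  induction m with
  | zero =>
    rintro ⟨a, b⟩ - ⟨a', b'⟩ - h
    have h1 : a 0 = a' 0 := neg_injective (congrFun (congrArg Prod.fst h) 0)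
    refine Prod.ext (funext fun k => ?_) (Subsingleton.elim _ _)
    rw [Fin.fin_one_eq_zero k]
    exact h1
  | succ m ih =>
    rintro ⟨a, b⟩ hb ⟨a', b'⟩ hb' h
    have h1 := congrArg Prod.fst h
    have h2 := congrArg Prod.snd h
    simp only [charCoeffs] at h1 h2
    rw [h2] at h1
    obtain ⟨h3, h4, h5⟩ := coeffStep_injective (hb _) h1
    have h6 := ih (x₁ := (Fin.init (α := fun _ => ℂ) a, Fin.init (α := fun _ => ℂ) b))
      (x₂ := (Fin.init (α := fun _ => ℂ) a', Fin.init (α := fun _ => ℂ) b'))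
      (fun k => hb k.castSucc) (fun k => hb' k.castSucc) (Prod.ext h2 h3)
    rw [Prod.mk.injEq] at h6
    refine Prod.ext ?_ ?_
    · change a = a'
      rw [← Fin.snoc_init_self a, ← Fin.snoc_init_self a', h6.1]
      exact congrArg _ h4
    · change b = b'
      rw [← Fin.snoc_init_self b, ← Fin.snoc_init_self b', h6.2]
      exact congrArg _ h5

end Coefficients

/-! ### The Jacobian from the entries to the coefficients -/

section Integrals

variable {m n : ℕ}

lemma lintegral_pi_snoc {H : (Fin (n + 1) → ℂ) → ENNReal} (hH : Measurable H) :
    ∫⁻ p, H p = ∫⁻ z : ℂ, ∫⁻ x : Fin n → ℂ, H (Fin.snoc (α := fun _ => ℂ) x z) := by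
  have h := (volume_preserving_piFinSuccAbove (fun _ : Fin (n + 1) => ℂ) (Fin.last n)).symm
  rw [← h.lintegral_comp hH, Measure.volume_eq_prod, lintegral_prod]
  · refine lintegral_congr fun z => lintegral_congr fun x => ?_
    congr 1
    exact Fin.insertNth_last' z x
  · exact (hH.comp (MeasurableEquiv.measurable _)).aemeasurable

lemma measurable_snoc : Measurable fun x : (Fin n → ℂ) × ℂ =>
    (Fin.snoc (α := fun _ => ℂ) x.1 x.2 : Fin (n + 1) → ℂ) :=
  continuous_snoc.measurable

lemma map_complexLinearMap (f : (Fin n → ℂ) →ₗ[ℂ] (Fin n → ℂ)) (hf : LinearMap.det f ≠ 0) :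
    Measure.map f volume = (ENNReal.ofReal (‖LinearMap.det f‖ ^ 2))⁻¹ • volume := by
  have h1 : LinearMap.det (f.restrictScalars ℝ) = ‖LinearMap.det f‖ ^ 2 := by
    rw [LinearMap.det_restrictScalars, Algebra.norm_complex_eq]
    exact Complex.normSq_eq_norm_sq _
  have h2 : LinearMap.det (f.restrictScalars ℝ) ≠ 0 := by
    rw [h1]
    exact pow_ne_zero 2 (norm_ne_zero_iff.2 hf)
  have h3 := Measure.map_linearMap_addHaar_eq_smul_addHaar (volume : Measure (Fin n → ℂ)) h2
  rw [h1, abs_inv, abs_of_nonneg (sq_nonneg _), ENNReal.ofReal_inv_of_pos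
    (pow_pos (norm_pos_iff.2 hf) 2)] at h3
  exact h3

lemma lintegral_comp_complexLinearMap (f : (Fin n → ℂ) →ₗ[ℂ] (Fin n → ℂ))
    (hf : LinearMap.det f ≠ 0) {H : (Fin n → ℂ) → ENNReal} (hH : Measurable H) :
    ∫⁻ x, H x = ENNReal.ofReal (‖LinearMap.det f‖ ^ 2) * ∫⁻ x, H (f x) := by
  have h1 : Measurable f := f.continuous_of_finiteDimensional.measurable
  have h2 : 0 < ‖LinearMap.det f‖ ^ 2 := pow_pos (norm_pos_iff.2 hf) 2
  rw [← lintegral_map hH h1, map_complexLinearMap f hf, lintegral_smul_measure, smul_eq_mul,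
    ← mul_assoc, ENNReal.mul_inv_cancel (ENNReal.ofReal_pos.2 h2).ne' ENNReal.ofReal_ne_top,
    one_mul]

lemma lintegral_sub_mul {H : (Fin n → ℂ) → ENNReal} (hH : Measurable H) (v : Fin n → ℂ)
    {b : ℂ} (hb : b ≠ 0) :
    (∫⁻ q : Fin n → ℂ, H fun c => v c - b * q c) * ENNReal.ofReal (‖b‖ ^ (2 * n)) =
      ∫⁻ x, H x := by
  have hdet : LinearMap.det (b • (LinearMap.id : (Fin n → ℂ) →ₗ[ℂ] (Fin n → ℂ))) = b ^ n := by
    rw [LinearMap.det_smul, LinearMap.det_id, mul_one, Module.finrank_pi, Fintype.card_fin]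
  have h := lintegral_sub_left_eq_self (μ := volume) H v
  have hm : Measurable fun x => H (v - x) := hH.comp (measurable_const_sub v)
  rw [← h, lintegral_comp_complexLinearMap
    (b • (LinearMap.id : (Fin n → ℂ) →ₗ[ℂ] (Fin n → ℂ))) (by rw [hdet]; exact pow_ne_zero n hb)
    hm, hdet, norm_pow, ← pow_mul, mul_comm n, mul_comm]
  rfl

/-- For fixed `p` the changes in `a` and `b` are reflections and translations. The only scaling is
that of `q ∈ ℂ ^ m` by `b`, with real Jacobian `‖b‖ ^ (2 * m)`. -/
lemma lintegral_coeffStep {H : (Fin (m + 2) → ℂ) → ENNReal} (hH : Measurable H)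
    (p : Fin (m + 1) → ℂ) :
    ∫⁻ a : ℂ, ∫⁻ b : ℂ, (∫⁻ q : Fin m → ℂ, H (coeffStep p q a b)) *
      ENNReal.ofReal (‖b‖ ^ (2 * m)) = ∫⁻ x, H x := by
  have h1 := lintegral_sub_left_eq_self (μ := volume)
    (fun z : ℂ => ∫⁻ x : Fin (m + 1) → ℂ, H (Fin.snoc (α := fun _ => ℂ) x z)) (p (Fin.last m))
  rw [lintegral_pi_snoc hH, ← h1]
  refine lintegral_congr fun a => ?_
  have hm : Measurable fun x : Fin (m + 1) → ℂ =>
      H (Fin.snoc (α := fun _ => ℂ) x (p (Fin.last m) - a)) :=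
    hH.comp (measurable_snoc.comp (measurable_id.prodMk measurable_const))
  have h2 := lintegral_sub_left_eq_self (μ := volume)
    (fun y : ℂ => ∫⁻ x : Fin m → ℂ, H (Fin.snoc (α := fun _ => ℂ)
      (Fin.snoc (α := fun _ => ℂ) x y) (p (Fin.last m) - a)))
    (Fin.cons (α := fun _ => ℂ) 0 p (Fin.last m).castSucc - a * p (Fin.last m))
  rw [lintegral_pi_snoc hm, ← h2]
  have h0 : ∀ᵐ b : ℂ, b ≠ 0 := by
    simp [ae_iff]
  refine lintegral_congr_ae (h0.mono fun b hb => ?_)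
  simp only [coeffStep_eq_snoc]
  exact lintegral_sub_mul (hm.comp (measurable_snoc.comp (measurable_id.prodMk measurable_const)))
    (fun c : Fin m => Fin.cons (α := fun _ => ℂ) 0 p c.castSucc.castSucc - a * p c.castSucc) hb

/-- Tonelli bookkeeping for the induction step: the new entries `z, w` are moved inside so that the
induction hypothesis applies to the old ones, and then `p` is moved outside. -/
lemma lintegral_interchange {X Y U V : Type*} [MeasureSpace X] [MeasureSpace Y] [MeasureSpace U]
    [MeasureSpace V] [SigmaFinite (volume : Measure X)] [SigmaFinite (volume : Measure Y)]
    [SigmaFinite (volume : Measure U)] [SigmaFinite (volume : Measure V)]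
    {Φ : X × Y → U × V} (hΦ : Measurable Φ) {W : Y → ENNReal} (hW : Measurable W)
    (h : ∀ G : U × V → ENNReal, Measurable G →
      ∫⁻ a, ∫⁻ b, G (Φ (a, b)) * W b = ∫⁻ p, ∫⁻ q, G (p, q))
    {K : (ℂ × ℂ) × (U × V) → ENNReal} (hK : Measurable K) :
    ∫⁻ z : ℂ, ∫⁻ a, ∫⁻ w : ℂ, ∫⁻ b, K ((z, w), Φ (a, b)) * W b =
      ∫⁻ p, ∫⁻ z : ℂ, ∫⁻ w : ℂ, ∫⁻ q, K ((z, w), (p, q)) := by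
  have e2 : ∀ z, ∫⁻ a, ∫⁻ w : ℂ, ∫⁻ b, K ((z, w), Φ (a, b)) * W b =
      ∫⁻ w : ℂ, ∫⁻ p, ∫⁻ q, K ((z, w), (p, q)) := fun z => by
    rw [lintegral_lintegral_swap]
    · exact lintegral_congr fun w => h (fun s => K ((z, w), s)) (hK.comp measurable_prodMk_left)
    · refine Measurable.aemeasurable (Measurable.lintegral_prod_right' (f := fun x :
        (X × ℂ) × Y => K ((z, x.1.2), Φ (x.1.1, x.2)) * W x.2)
        (Measurable.mul ?_ (hW.comp measurable_snd)))
      exact hK.comp ((measurable_const.prodMk (measurable_snd.comp measurable_fst)).prodMk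
        (hΦ.comp ((measurable_fst.comp measurable_fst).prodMk measurable_snd)))
  have hK2 : Measurable fun x : (ℂ × ℂ) × U => ∫⁻ q, K (x.1, (x.2, q)) :=
    Measurable.lintegral_prod_right' (f := fun x : ((ℂ × ℂ) × U) × V =>
      K (x.1.1, (x.1.2, x.2))) (hK.comp ((measurable_fst.comp measurable_fst).prodMk
        ((measurable_snd.comp measurable_fst).prodMk measurable_snd)))
  have e3 : ∀ z, ∫⁻ w : ℂ, ∫⁻ p, ∫⁻ q, K ((z, w), (p, q)) =
      ∫⁻ p, ∫⁻ w : ℂ, ∫⁻ q, K ((z, w), (p, q)) := fun z => by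
    refine lintegral_lintegral_swap (Measurable.aemeasurable ?_)
    exact hK2.comp ((measurable_const.prodMk measurable_fst).prodMk measurable_snd)
  simp only [e2, e3]
  refine lintegral_lintegral_swap (Measurable.aemeasurable ?_)
  exact Measurable.lintegral_prod_right' (f := fun x : (ℂ × U) × ℂ =>
    ∫⁻ q, K ((x.1.1, x.2), (x.1.2, q))) (hK2.comp
      (((measurable_fst.comp measurable_fst).prodMk measurable_snd).prodMk
      (measurable_snd.comp measurable_fst)))

/-- Induction on the size. Adding a row at the top replaces the pair `(p, q)` by `((X - a) p - b q,
p)`, so each step contributes the Jacobian of `lintegral_coeffStep` with the then current `m`. -/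
lemma lintegral_charCoeffs {G : (Fin (m + 1) → ℂ) × (Fin m → ℂ) → ENNReal} (hG : Measurable G) :
    ∫⁻ a : Fin (m + 1) → ℂ, ∫⁻ b : Fin m → ℂ, G (charCoeffs (a, b)) *
      ∏ k, ENNReal.ofReal (‖b k‖ ^ (2 * k.1)) = ∫⁻ p, ∫⁻ q, G (p, q) := by
  induction m with
  | zero =>
    have h : ∀ a : Fin 1 → ℂ, ∫⁻ b : Fin 0 → ℂ, G (charCoeffs (a, b)) *
        ∏ k, ENNReal.ofReal (‖b k‖ ^ (2 * k.1)) = ∫⁻ q : Fin 0 → ℂ, G (-a, q) := fun a => by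
      refine lintegral_congr fun b => ?_
      rw [Finset.univ_eq_empty, Finset.prod_empty, mul_one]
      congr 1
      exact Prod.ext (funext fun k => by rw [Fin.fin_one_eq_zero k]; rfl) (Subsingleton.elim _ _)
    simp only [h]
    exact lintegral_neg_eq_self (μ := volume) fun a : Fin 1 → ℂ => ∫⁻ q : Fin 0 → ℂ, G (a, q)
  | succ m ih =>
    have hW : ∀ k, Measurable fun b : Fin k → ℂ => ∏ k, ENNReal.ofReal (‖b k‖ ^ (2 * k.1)) :=
      fun k => Finset.measurable_fun_prod _ fun i _ =>
        ((measurable_pi_apply i).norm.pow_const _).ennreal_ofReal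
    have hF : Measurable fun x : (Fin (m + 2) → ℂ) × (Fin (m + 1) → ℂ) =>
        G (charCoeffs x) * ∏ k, ENNReal.ofReal (‖x.2 k‖ ^ (2 * k.1)) :=
      (hG.comp continuous_charCoeffs.measurable).mul ((hW _).comp measurable_snd)
    have hK : Measurable fun x : (ℂ × ℂ) × ((Fin (m + 1) → ℂ) × (Fin m → ℂ)) =>
        G (coeffStep x.2.1 x.2.2 x.1.1 x.1.2, x.2.1) * ENNReal.ofReal (‖x.1.2‖ ^ (2 * m)) :=
      (hG.comp ((continuous_coeffStep.measurable.comp (measurable_snd.prodMk measurable_fst)).prodMk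
        (measurable_fst.comp measurable_snd))).mul
        ((measurable_snd.comp measurable_fst).norm.pow_const _).ennreal_ofReal
    have e1 : ∀ z a, ∫⁻ b : Fin (m + 1) → ℂ, G (charCoeffs (Fin.snoc (α := fun _ => ℂ) a z, b)) *
        ∏ k, ENNReal.ofReal (‖b k‖ ^ (2 * k.1)) =
        ∫⁻ w : ℂ, ∫⁻ b : Fin m → ℂ, G (coeffStep (charCoeffs (a, b)).1 (charCoeffs (a, b)).2 z w,
          (charCoeffs (a, b)).1) * ENNReal.ofReal (‖w‖ ^ (2 * m)) *
          ∏ k, ENNReal.ofReal (‖b k‖ ^ (2 * k.1)) := fun z a => by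
      have hm : Measurable fun b : Fin (m + 1) → ℂ =>
          G (charCoeffs (Fin.snoc (α := fun _ => ℂ) a z, b)) *
          ∏ k, ENNReal.ofReal (‖b k‖ ^ (2 * k.1)) := hF.comp measurable_prodMk_left
      rw [lintegral_pi_snoc hm]
      refine lintegral_congr fun w => lintegral_congr fun b => ?_
      simp only [charCoeffs, Fin.init_snoc, Fin.snoc_last, Fin.prod_univ_castSucc,
        Fin.snoc_castSucc, Fin.val_last, Fin.val_castSucc]
      ring
    have e2 : ∀ p : Fin (m + 1) → ℂ, ∫⁻ z : ℂ, ∫⁻ w : ℂ, ∫⁻ q : Fin m → ℂ,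
        G (coeffStep p q z w, p) * ENNReal.ofReal (‖w‖ ^ (2 * m)) =
        ∫⁻ x : Fin (m + 2) → ℂ, G (x, p) := fun p => by
      have hGp : Measurable fun x : Fin (m + 2) → ℂ => G (x, p) := hG.comp measurable_prodMk_right
      rw [← lintegral_coeffStep hGp p]
      exact lintegral_congr fun z => lintegral_congr fun w =>
        lintegral_mul_const' _ _ ENNReal.ofReal_ne_top
    rw [lintegral_pi_snoc (Measurable.lintegral_prod_right' hF)]
    simp only [e1]
    rw [lintegral_interchange continuous_charCoeffs.measurable (hW m) (fun G hG => ih hG) hK]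
    simp only [e2]
    exact lintegral_lintegral_swap (f := fun p x => G (x, p))
      (hG.comp measurable_swap).aemeasurable

end Integrals

end

section

/-! ### Characteristic polynomials of tridiagonal matrices -/

section CharPoly

open Polynomial

variable {m n : ℕ}

/-- The polynomial with coefficients `v`. -/
def polyOf (v : Fin n → ℂ) : ℂ[X] := ∑ i, C (v i) * X ^ i.1

/-- The monic polynomial of degree `n` with lower coefficients `v`. -/
def monicPoly (v : Fin n → ℂ) : ℂ[X] := X ^ n + polyOf v

lemma polyOf_snoc (v : Fin n → ℂ) (z : ℂ) :
    polyOf (Fin.snoc (α := fun _ => ℂ) v z) = polyOf v + C z * X ^ n := by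
  simp only [polyOf, Fin.sum_univ_castSucc, Fin.snoc_castSucc, Fin.snoc_last, Fin.val_castSucc,
    Fin.val_last]

lemma polyOf_cons (v : Fin n → ℂ) :
    polyOf (Fin.cons (α := fun _ => ℂ) 0 v) = X * polyOf v := by
  simp only [polyOf, Fin.sum_univ_succ, Fin.cons_zero, Fin.cons_succ, C_0, zero_mul, zero_add,
    Finset.mul_sum, Fin.val_succ, pow_succ']
  exact Finset.sum_congr rfl fun i _ => by ring

lemma monicPoly_coeffStep (p : Fin (m + 1) → ℂ) (q : Fin m → ℂ) (a b : ℂ) :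
    monicPoly (coeffStep p q a b) = (X - C a) * monicPoly p - C b * monicPoly q := by
  have h : polyOf (coeffStep p q a b) = polyOf (Fin.cons (α := fun _ => ℂ) 0 p) -
      C a * polyOf (Fin.snoc (α := fun _ => ℂ) p 1) -
      C b * polyOf (Fin.snoc (α := fun _ => ℂ) (Fin.snoc (α := fun _ => ℂ) q 1) 0) := by
    simp only [polyOf, coeffStep, C_sub, C_mul, sub_mul, Finset.sum_sub_distrib, Finset.mul_sum,
      mul_assoc]
  rw [monicPoly, h, polyOf_cons, polyOf_snoc, polyOf_snoc, polyOf_snoc, monicPoly, monicPoly, C_0,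
    C_1]
  ring



lemma coeff_polyOf (v : Fin n → ℂ) (i : Fin n) : (polyOf v).coeff i = v i := by
  rw [polyOf, finsetSum_coeff, Finset.sum_eq_single i]
  · rw [coeff_C_mul_X_pow, if_pos rfl]
  · intro j _ hj
    rw [coeff_C_mul_X_pow, if_neg fun h => hj (Fin.ext h.symm)]
  · exact fun h => absurd (Finset.mem_univ i) h

lemma coeff_monicPoly (v : Fin n → ℂ) (i : Fin n) : (monicPoly v).coeff i = v i := by
  rw [monicPoly, coeff_add, coeff_polyOf, coeff_X_pow, if_neg i.2.ne, zero_add]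

lemma monicPoly_injective : Function.Injective (monicPoly : (Fin n → ℂ) → ℂ[X]) := by
  intro v w h
  funext i
  rw [← coeff_monicPoly v, h, coeff_monicPoly]

lemma monicPoly_coeff {P : ℂ[X]} (hP : P.Monic) (hn : P.natDegree = n) :
    monicPoly (fun i : Fin n => P.coeff i) = P := by
  conv_rhs => rw [hP.as_sum, hn]
  rw [monicPoly, polyOf, Finset.sum_range]

lemma det_of_tridiagonal {R : Type*} [CommRing R] (M : Matrix (Fin (n + 2)) (Fin (n + 2)) R)
    (h1 : ∀ j : Fin n, M 0 j.succ.succ = 0) (h2 : ∀ i : Fin n, M i.succ.succ 0 = 0) :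
    M.det = M 0 0 * (M.submatrix Fin.succ Fin.succ).det -
      M 0 1 * M 1 0 * ((M.submatrix Fin.succ Fin.succ).submatrix Fin.succ Fin.succ).det := by
  have h3 : (M.submatrix Fin.succ (Fin.succAbove 1)).det =
      M 1 0 * ((M.submatrix Fin.succ Fin.succ).submatrix Fin.succ Fin.succ).det := by
    rw [Matrix.det_succ_column_zero, Fin.sum_univ_succ, Finset.sum_eq_zero]
    · simp only [Fin.val_zero, pow_zero, one_mul, add_zero, Matrix.submatrix_apply]
      congr 1
    · intro i _
      have : M.submatrix Fin.succ (Fin.succAbove 1) i.succ 0 = 0 := h2 i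
      rw [this, mul_zero, zero_mul]
  rw [Matrix.det_succ_row_zero, Fin.sum_univ_succ, Fin.sum_univ_succ, Finset.sum_eq_zero]
  · simp only [Fin.val_zero, pow_zero, one_mul, add_zero, Fin.succ_zero_eq_one, Fin.val_one,
      pow_one, h3]
    rw [Fin.succAbove_zero]
    ring
  · intro j _
    rw [h1, mul_zero, zero_mul]

lemma tridiag_submatrix (a : Fin (m + 2) → ℂ) (b : Fin (m + 1) → ℂ) :
    (tridiag a b).submatrix Fin.succ Fin.succ =
      tridiag (Fin.init (α := fun _ => ℂ) a) (Fin.init (α := fun _ => ℂ) b) := by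
  ext i j
  simp only [tridiag, Matrix.of_apply, Matrix.submatrix_apply, Fin.succ_inj, Fin.val_succ,
    Nat.add_right_cancel_iff]
  split_ifs with h1 h2 h3
  · rw [Fin.rev_succ]
    rfl
  · rfl
  · change b _ = b _
    congr 1
    ext
    simp [Fin.rev, Nat.add_sub_add_right]
  · rfl

lemma charmatrix_tridiag_submatrix (a : Fin (m + 2) → ℂ) (b : Fin (m + 1) → ℂ) :
    (tridiag a b).charmatrix.submatrix Fin.succ Fin.succ =
      (tridiag (Fin.init (α := fun _ => ℂ) a) (Fin.init (α := fun _ => ℂ) b)).charmatrix := by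
  rw [← tridiag_submatrix]
  ext1 i j
  simp only [Matrix.charmatrix_apply, Matrix.submatrix_apply, Matrix.diagonal_apply,
    Fin.succ_inj]

/-- The squared Frobenius norm of a tridiagonal matrix of the model. -/
lemma sum_norm_sq_tridiag (a : Fin (m + 1) → ℂ) (b : Fin m → ℂ) :
    ∑ i, ∑ j, ‖tridiag a b i j‖ ^ 2 = ∑ j, ‖a j‖ ^ 2 + ∑ j, ‖b j‖ ^ 2 + m := by
  induction m with
  | zero =>
    simp only [Finset.univ_eq_empty, Finset.sum_empty]
    simp
    rw [tridiag_self]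
    rfl
  | succ m ih =>
    have h1 := ih (Fin.init (α := fun _ => ℂ) a) (Fin.init (α := fun _ => ℂ) b)
    rw [← tridiag_submatrix] at h1
    simp only [Matrix.submatrix_apply, Fin.init] at h1
    have e1 : ∑ j : Fin (m + 1), ‖tridiag a b 0 j.succ‖ ^ 2 = 1 := by
      rw [Fin.sum_univ_succ, Finset.sum_eq_zero, tridiag_succ a b (by simp), norm_one, one_pow,
        add_zero]
      intro j _
      rw [tridiag_eq_zero, norm_zero, zero_pow two_ne_zero]
      all_goals simp [Fin.ext_iff]
    have e2 : ∑ i : Fin (m + 1), ‖tridiag a b i.succ 0‖ ^ 2 = ‖b (Fin.last m)‖ ^ 2 := by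
      rw [Fin.sum_univ_succ, Finset.sum_eq_zero, tridiag_pred a b (by simp), add_zero]
      · rfl
      · intro j _
        rw [tridiag_eq_zero, norm_zero, zero_pow two_ne_zero]
        all_goals simp [Fin.ext_iff]
    rw [Fin.sum_univ_succ, Fin.sum_univ_succ]
    simp only [Fin.sum_univ_succ (fun j => ‖tridiag a b (Fin.succ _) j‖ ^ 2),
      Finset.sum_add_distrib]
    rw [h1, e1, e2, tridiag_self, Fin.rev_zero, Fin.sum_univ_castSucc (fun j => ‖a j‖ ^ 2),
      Fin.sum_univ_castSucc (fun j => ‖b j‖ ^ 2)]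
    push_cast
    ring

/-- Laplace expansion along the first row and column: `P = (X - a) P' - b P''`, where `P'` and `P''`
belong to the blocks with one and two rows removed at the top. This is the recursion defining
`charCoeffs`. -/
lemma charpoly_tridiag_and_minor (a : Fin (m + 1) → ℂ) (b : Fin m → ℂ) :
    (tridiag a b).charpoly = monicPoly (charCoeffs (a, b)).1 ∧
    ((tridiag a b).charmatrix.submatrix Fin.succ Fin.succ).det =
      monicPoly (charCoeffs (a, b)).2 := by
  induction m with
  | zero =>
    constructor
    · rw [Matrix.charpoly, Matrix.det_fin_one, Matrix.charmatrix_apply_eq, tridiag_self, monicPoly,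
        polyOf, Fin.sum_univ_one]
      simp only [charCoeffs, C_neg, Fin.val_zero, pow_zero, mul_one, Fin.rev_zero]
      exact (sub_eq_add_neg _ _).trans (congrArg₂ _ (pow_one X).symm rfl)
    · rw [Matrix.det_isEmpty, monicPoly, polyOf, Finset.univ_eq_empty, Finset.sum_empty, pow_zero,
        add_zero]
  | succ m ih =>
    obtain ⟨h1, h2⟩ := ih (Fin.init (α := fun _ => ℂ) a) (Fin.init (α := fun _ => ℂ) b)
    have h3 := charmatrix_tridiag_submatrix a b
    refine ⟨?_, by rw [h3]; exact h1⟩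
    rw [Matrix.charpoly, det_of_tridiagonal, h3, h2]
    · rw [Matrix.charpoly] at h1
      rw [h1, Matrix.charmatrix_apply_eq, Matrix.charmatrix_apply_ne _ _ _ (by simp),
        Matrix.charmatrix_apply_ne _ _ _ (by simp)]
      simp only [charCoeffs, monicPoly_coeffStep]
      have e1 : tridiag a b 0 0 = a (Fin.last _) := by rw [tridiag_self, Fin.rev_zero]
      have e2 : tridiag a b 0 1 = 1 := tridiag_succ a b rfl
      have e3 : tridiag a b 1 0 = b (Fin.last _) := by
        simp [tridiag]
      rw [e1, e2, e3, C_1]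
      ring
    · intro j
      rw [Matrix.charmatrix_apply_ne _ _ _ (Fin.succ_ne_zero _).symm, tridiag_eq_zero, C_0, neg_zero]
      all_goals simp [Fin.ext_iff]
    · intro j
      rw [Matrix.charmatrix_apply_ne _ _ _ (Fin.succ_ne_zero _), tridiag_eq_zero, C_0, neg_zero]
      all_goals simp [Fin.ext_iff]

/-- The lower right minor of `X - T` of size `m` in terms of the spectral parameters. -/
def minorPoly (lam r : Fin (m + 1) → ℂ) : ℂ[X] :=
  ∑ k, C (r k) * ∏ j ∈ Finset.univ.erase k, (X - C (lam j))

lemma adjugate_mul_diagonal_mul {n R : Type*} [Fintype n] [DecidableEq n] [CommRing R]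
    {A B D : Matrix n n R} (hAB : A * B = 1) :
    (A * D * B).adjugate = A * D.adjugate * B := by
  have hBA : B * A = 1 := mul_eq_one_comm.1 hAB
  have hd : A.det * B.det = 1 := by rw [← Matrix.det_mul, hAB, Matrix.det_one]
  have hA : A.adjugate = A.det • B := by
    calc A.adjugate = A.adjugate * (A * B) := by rw [hAB, Matrix.mul_one]
      _ = _ := by rw [← Matrix.mul_assoc, Matrix.adjugate_mul, Matrix.smul_mul, Matrix.one_mul]
  have hB : B.adjugate = B.det • A := by
    calc B.adjugate = B.adjugate * (B * A) := by rw [hBA, Matrix.mul_one]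
      _ = _ := by rw [← Matrix.mul_assoc, Matrix.adjugate_mul, Matrix.smul_mul, Matrix.one_mul]
  rw [Matrix.adjugate_mul_distrib, Matrix.adjugate_mul_distrib, hA, hB, Matrix.smul_mul,
    Matrix.mul_smul, Matrix.mul_smul, smul_smul, mul_comm, hd, one_smul, Matrix.mul_assoc]

lemma IsSpectralData.charmatrix_eq {T : Matrix (Fin (m + 1)) (Fin (m + 1)) ℂ}
    {lam : Fin (m + 1) → ℂ} {R L : Matrix (Fin (m + 1)) (Fin (m + 1)) ℂ} (hRL : R * L = 1)
    (hT : T = R * Matrix.diagonal lam * L) :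
    R.map C * L.map C = 1 ∧
    T.charmatrix = R.map C * Matrix.diagonal (fun k => X - C (lam k)) * L.map C := by
  have h1 : R.map C * L.map C = 1 := by
    rw [← Matrix.map_mul, hRL, Matrix.map_one _ C_0 C_1]
  refine ⟨h1, ?_⟩
  have h2 : Matrix.diagonal (fun k => X - C (lam k)) =
      Matrix.scalar (Fin (m + 1)) (X : ℂ[X]) - (Matrix.diagonal lam).map C := by
    rw [Matrix.diagonal_map C_0, Matrix.scalar_apply, Matrix.diagonal_sub]
  have h3 : R.map C * Matrix.scalar (Fin (m + 1)) (X : ℂ[X]) =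
      Matrix.scalar (Fin (m + 1)) (X : ℂ[X]) * R.map C :=
    ((Matrix.scalar_commute _ (fun _ => Commute.all _ _) _).eq).symm
  rw [h2, mul_sub, sub_mul, h3, Matrix.mul_assoc, h1, Matrix.mul_one, ← Matrix.map_mul,
    ← Matrix.map_mul, ← hT]
  rfl

lemma IsSpectralData.listsEigenvalues {T : Matrix (Fin (m + 1)) (Fin (m + 1)) ℂ}
    {lam r : Fin (m + 1) → ℂ} (h : IsSpectralData T lam r) : ListsEigenvalues T lam := by
  obtain ⟨R, L, hRL, hLR, hT, h0, h1⟩ := h.exists_inverse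
  obtain ⟨h2, h3⟩ := IsSpectralData.charmatrix_eq hRL hT
  rw [ListsEigenvalues, Matrix.charpoly, h3, Matrix.det_mul, Matrix.det_mul, mul_right_comm,
    ← Matrix.det_mul, h2, Matrix.det_one, one_mul, Matrix.det_diagonal]

/-- The minor is the corner entry of the adjugate of `X - T`, and `adj (X - T) = R * adj (X - Λ) *
R⁻¹` with a diagonal middle factor. In the corner, `R` contributes `r` and `R⁻¹` contributes ones.
-/
lemma IsSpectralData.minor_eq {T : Matrix (Fin (m + 1)) (Fin (m + 1)) ℂ}
    {lam r : Fin (m + 1) → ℂ} (h : IsSpectralData T lam r) :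
    (T.charmatrix.submatrix Fin.succ Fin.succ).det = minorPoly lam r := by
  obtain ⟨R, L, hRL, hLR, hT, h0, h1⟩ := h.exists_inverse
  obtain ⟨h2, h3⟩ := IsSpectralData.charmatrix_eq hRL hT
  have h4 := Matrix.adjugate_fin_succ_eq_det_submatrix T.charmatrix 0 0
  simp only [Fin.val_zero, add_zero, pow_zero, one_mul, Fin.succAbove_zero] at h4
  rw [← h4, h3, adjugate_mul_diagonal_mul h2, Matrix.adjugate_diagonal, Matrix.mul_apply]
  refine Finset.sum_congr rfl fun k _ => ?_
  rw [Matrix.mul_diagonal, Matrix.map_apply, Matrix.map_apply, h0, h1, C_1, mul_one]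

lemma IsSpectralData.monicPoly_charCoeffs {a : Fin (m + 1) → ℂ} {b : Fin m → ℂ}
    {lam r : Fin (m + 1) → ℂ} (h : IsSpectralData (tridiag a b) lam r) :
    monicPoly (charCoeffs (a, b)).1 = ∏ j, (X - C (lam j)) ∧
    monicPoly (charCoeffs (a, b)).2 = minorPoly lam r := by
  obtain ⟨h1, h2⟩ := charpoly_tridiag_and_minor a b
  exact ⟨h1 ▸ h.listsEigenvalues, h2 ▸ h.minor_eq⟩

end CharPoly

end

section

/-! ### Roots and residues as coordinates -/

section Roots

open Polynomial

variable {m n : ℕ}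

/-- The lower coefficients of the monic polynomial with roots `lam`. -/
def rootCoeffs (lam : Fin n → ℂ) : Fin n → ℂ := fun i => (∏ j, (X - C (lam j))).coeff i

lemma monicPoly_rootCoeffs (lam : Fin n → ℂ) :
    monicPoly (rootCoeffs lam) = ∏ j, (X - C (lam j)) := by
  refine monicPoly_coeff (monic_prod_of_monic _ _ fun j _ => monic_X_sub_C _) ?_
  rw [natDegree_prod_of_monic _ _ fun j _ => monic_X_sub_C _]
  simp

lemma eval_monicPoly (v : Fin n → ℂ) (x : ℂ) :
    (monicPoly v).eval x = x ^ n + ∑ i, v i * x ^ i.1 := by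
  simp [monicPoly, polyOf, eval_finsetSum]

lemma differentiable_coeff_prod (s : Finset (Fin n)) (i : ℕ) :
    Differentiable ℂ fun lam : Fin n → ℂ => (∏ j ∈ s, (X - C (lam j))).coeff i := by
  induction s using Finset.induction_on generalizing i with
  | empty => simp only [Finset.prod_empty]; exact differentiable_const _
  | insert k s hk ih =>
    simp only [Finset.prod_insert hk, sub_mul, coeff_sub, coeff_C_mul]
    refine Differentiable.sub ?_ (Differentiable.mul (by fun_prop) (ih i))
    cases i with
    | zero => simp only [coeff_X_mul_zero]; exact differentiable_const _
    | succ i => simp only [coeff_X_mul]; exact ih i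

lemma differentiable_rootCoeffs : Differentiable ℂ (rootCoeffs : (Fin n → ℂ) → Fin n → ℂ) :=
  differentiable_pi.2 fun i => differentiable_coeff_prod Finset.univ i

/-- Differentiate, in `μ` at `μ = lam`, the identity that evaluates the monic polynomial with roots
`μ` at the fixed point `lam l`. All terms of the product rule but one contain the vanishing factor
`lam l - lam l`. -/
lemma sum_fderiv_rootCoeffs (lam δ : Fin n → ℂ) (l : Fin n) :
    ∑ i, lam l ^ i.1 * fderiv ℂ rootCoeffs lam δ i =
      -(∏ j ∈ Finset.univ.erase l, (lam l - lam j)) * δ l := by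
  have h1 : HasFDerivAt (fun μ : Fin n → ℂ => lam l ^ n + ∑ i, lam l ^ i.1 * rootCoeffs μ i)
      (∑ i, lam l ^ i.1 • (ContinuousLinearMap.proj (R := ℂ) (φ := fun _ => ℂ) i).comp
        (fderiv ℂ rootCoeffs lam)) lam := by
    refine HasFDerivAt.const_add _ (HasFDerivAt.fun_sum fun i _ => HasFDerivAt.const_mul ?_ _)
    exact (hasFDerivAt_pi'.1 (differentiable_rootCoeffs lam).hasFDerivAt) i
  have h2 : HasFDerivAt (fun μ : Fin n → ℂ => ∏ j, (lam l - μ j))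
      (∑ k, (∏ j ∈ Finset.univ.erase k, (lam l - lam j)) •
        (-(ContinuousLinearMap.proj (R := ℂ) (φ := fun _ => ℂ) k) : (Fin n → ℂ) →L[ℂ] ℂ)) lam :=
    HasFDerivAt.finsetProd fun k _ => (hasFDerivAt_apply k lam).const_sub _
  have h3 : (fun μ : Fin n → ℂ => lam l ^ n + ∑ i, lam l ^ i.1 * rootCoeffs μ i) =
      fun μ => ∏ j, (lam l - μ j) := by
    funext μ
    have := congrArg (eval (lam l)) (monicPoly_rootCoeffs μ)
    rw [eval_monicPoly, eval_prod] at this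
    simp only [eval_sub, eval_X, eval_C] at this
    simp only [← this, mul_comm]
  rw [h3] at h1
  have h4 := congrArg (fun A : (Fin n → ℂ) →L[ℂ] ℂ => A δ) (h1.unique h2)
  simp only [_root_.sum_apply, _root_.smul_apply,
    ContinuousLinearMap.comp_apply, ContinuousLinearMap.proj_apply, _root_.neg_apply,
    smul_eq_mul] at h4
  rw [h4, Finset.sum_eq_single l]
  · ring
  · intro k _ hk
    rw [Finset.prod_eq_zero (Finset.mem_erase.2 ⟨hk.symm, Finset.mem_univ l⟩) (sub_self _),
      zero_mul]
  · exact fun h => absurd (Finset.mem_univ l) h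

lemma norm_prod_prod_erase (lam : Fin n → ℂ) :
    ‖∏ l, ∏ j ∈ Finset.univ.erase l, (lam l - lam j)‖ = ‖(Matrix.vandermonde lam).det‖ ^ 2 := by
  have h1 : ∀ l : Fin n, ∏ j ∈ Finset.univ.erase l, ‖lam l - lam j‖ =
      (∏ j ∈ Finset.Ioi l, ‖lam j - lam l‖) * ∏ j ∈ Finset.Iio l, ‖lam l - lam j‖ := fun l => by
    have : Finset.univ.erase l = Finset.Ioi l ∪ Finset.Iio l := by
      ext j
      simp only [Finset.mem_erase, Finset.mem_univ, and_true, Finset.mem_union, Finset.mem_Ioi,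
        Finset.mem_Iio]
      exact ne_comm.trans lt_or_lt_iff_ne.symm
    rw [this, Finset.prod_union]
    · simp only [norm_sub_rev]
    · rw [Finset.disjoint_left]
      intro j hj hj'
      exact lt_asymm (Finset.mem_Ioi.1 hj) (Finset.mem_Iio.1 hj')
  have h2 : ∏ l : Fin n, ∏ j ∈ Finset.Iio l, ‖lam l - lam j‖ =
      ∏ j, ∏ l ∈ Finset.Ioi j, ‖lam l - lam j‖ :=
    Finset.prod_comm' fun x y => by simp
  simp only [norm_prod, h1, Finset.prod_mul_distrib, h2, Matrix.det_vandermonde, sq]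

/-- By the preceding formulas, the Vandermonde matrix times the derivative is diagonal with
determinant of modulus `‖V‖ ^ 2`; one factor `V` cancels. -/
lemma norm_det_fderiv_rootCoeffs {lam : Fin n → ℂ} (hlam : Function.Injective lam) :
    ‖LinearMap.det (fderiv ℂ rootCoeffs lam : (Fin n → ℂ) →ₗ[ℂ] (Fin n → ℂ))‖ =
      ‖(Matrix.vandermonde lam).det‖ := by
  have h0 : ‖(Matrix.vandermonde lam).det‖ ≠ 0 :=
    norm_ne_zero_iff.2 (Matrix.det_vandermonde_ne_zero_iff.2 hlam)
  have h1 : Matrix.toLin' (Matrix.vandermonde lam) ∘ₗ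
      (fderiv ℂ rootCoeffs lam : (Fin n → ℂ) →ₗ[ℂ] (Fin n → ℂ)) =
      Matrix.toLin' (Matrix.diagonal fun l => -∏ j ∈ Finset.univ.erase l, (lam l - lam j)) := by
    refine LinearMap.ext fun δ => funext fun l => ?_
    rw [LinearMap.comp_apply, Matrix.toLin'_apply, Matrix.toLin'_apply, Matrix.mulVec_diagonal]
    exact sum_fderiv_rootCoeffs lam δ l
  have h2 := congrArg (fun A => ‖LinearMap.det A‖) h1
  simp only [LinearMap.det_comp, LinearMap.det_toLin', Matrix.det_diagonal, Finset.prod_neg,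
    norm_mul, norm_pow, norm_neg, norm_one, one_pow, one_mul, norm_prod_prod_erase, sq] at h2
  exact mul_left_cancel₀ h0 h2

/-- Vectors whose entries have strictly increasing real parts. -/
def reOrdered (n : ℕ) : Set (Fin n → ℂ) := {lam | StrictMono fun i => (lam i).re}

lemma injective_of_mem_reOrdered {lam : Fin n → ℂ} (h : lam ∈ reOrdered n) :
    Function.Injective lam := fun _ _ hij => h.injective (congrArg Complex.re hij)

lemma measurableSet_reOrdered : MeasurableSet (reOrdered n) := by
  have : reOrdered n = ⋂ i, ⋂ j, ⋂ _ : i < j, {lam | (lam i).re < (lam j).re} := by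
    ext lam
    simp only [reOrdered, Set.mem_iInter, Set.mem_ofPred_eq]
    exact Iff.rfl
  rw [this]
  refine MeasurableSet.iInter fun i => MeasurableSet.iInter fun j => MeasurableSet.iInter fun _ =>
    measurableSet_lt ?_ ?_
  · exact Complex.measurable_re.comp (measurable_pi_apply i)
  · exact Complex.measurable_re.comp (measurable_pi_apply j)

lemma exists_perm_of_rootCoeffs_eq {lam μ : Fin n → ℂ} (hμ : Function.Injective μ)
    (h : rootCoeffs lam = rootCoeffs μ) : ∃ σ : Equiv.Perm (Fin n), lam = μ ∘ σ := by
  have h1 : ∏ j, (X - C (lam j)) = ∏ j, (X - C (μ j)) := by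
    rw [← monicPoly_rootCoeffs, ← monicPoly_rootCoeffs, h]
  have h2 : ∀ ν : Fin n → ℂ, (∏ j, (X - C (ν j))).roots =
      Multiset.map ν Finset.univ.val := fun ν => by
    rw [← roots_multiset_prod_X_sub_C (Multiset.map ν Finset.univ.val), Multiset.map_map]
    rfl
  have h3 := congrArg roots h1
  rw [h2, h2] at h3
  have hlam : Function.Injective lam := by
    rw [← Fintype.nodup_map_univ_iff_injective, h3, Fintype.nodup_map_univ_iff_injective]
    exact hμ
  have h4 : Set.range lam = Set.range μ := by
    ext z
    have h5 : z ∈ Multiset.map lam Finset.univ.val ↔ z ∈ Multiset.map μ Finset.univ.val := by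
      rw [h3]
    simpa using h5
  refine ⟨(Equiv.ofInjective lam hlam).trans ((Equiv.setCongr h4).trans
    (Equiv.ofInjective μ hμ).symm), funext fun i => ?_⟩
  simp only [Function.comp_apply, Equiv.trans_apply, Equiv.apply_ofInjective_symm,
    Equiv.setCongr_apply, Equiv.ofInjective_apply]

lemma exists_comp_mem_reOrdered {lam : Fin n → ℂ}
    (h : ∀ i j, i ≠ j → (lam i).re ≠ (lam j).re) :
    ∃ σ : Equiv.Perm (Fin n), lam ∘ σ ∈ reOrdered n := by
  refine ⟨Tuple.sort fun i => (lam i).re, ?_⟩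
  refine (Tuple.monotone_sort fun i => (lam i).re).strictMono_of_injective fun i j hij => ?_
  by_contra hne
  exact h _ _ ((Tuple.sort fun i => (lam i).re).injective.ne hne) hij

lemma perm_eq_of_mem_reOrdered {lam : Fin n → ℂ} {σ τ : Equiv.Perm (Fin n)}
    (hσ : lam ∘ σ ∈ reOrdered n) (hτ : lam ∘ τ ∈ reOrdered n) : σ = τ := by
  have h1 : (fun i => ((lam ∘ σ) i).re) = fun i => ((lam ∘ τ) i).re := by
    refine (StrictMono.range_inj hσ hτ).1 ?_
    have h2 : ∀ ρ : Equiv.Perm (Fin n), Set.range (fun i => ((lam ∘ ρ) i).re) =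
        Set.range fun i => (lam i).re := fun ρ =>
      ρ.surjective.range_comp fun i => (lam i).re
    rw [h2, h2]
  have h3 : Function.Injective fun i => (lam i).re := fun i j hij => by
    have h4 := hσ.injective (a₁ := σ.symm i) (a₂ := σ.symm j)
      (by simpa only [Function.comp_apply, Equiv.apply_symm_apply] using hij)
    exact σ.symm.injective h4
  exact Equiv.ext fun i => h3 (congrFun h1 i)

lemma injOn_rootCoeffs : Set.InjOn rootCoeffs (reOrdered n) := by
  intro lam hlam μ hμ h
  obtain ⟨σ, rfl⟩ := exists_perm_of_rootCoeffs_eq (injective_of_mem_reOrdered hμ) h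
  rw [perm_eq_of_mem_reOrdered (τ := 1) hlam hμ]
  rfl

lemma exists_eq_prod_X_sub_C {P : ℂ[X]} (hP : P.Monic) (hn : P.natDegree = n) :
    ∃ lam : Fin n → ℂ, P = ∏ j, (X - C (lam j)) := by
  have h1 := (IsAlgClosed.splits P).eq_prod_roots_of_monic hP
  have h2 : P.roots.card = n := by rw [← hn, (IsAlgClosed.splits P).natDegree_eq_card_roots]
  obtain ⟨L, hL⟩ : ∃ L : List ℂ, (L : Multiset ℂ) = P.roots := ⟨_, P.roots.coe_toList⟩
  rw [← hL] at h1 h2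
  rw [Multiset.coe_card] at h2
  subst h2
  refine ⟨fun i => L[i], h1.trans ?_⟩
  rw [Multiset.map_coe, Multiset.prod_coe]
  exact (Fin.prod_univ_fun_getElem L fun z => X - C z).symm

lemma exists_rootCoeffs_eq (p : Fin n → ℂ) : ∃ lam, rootCoeffs lam = p := by
  have h1 : (polyOf p).degree < n := by
    rw [polyOf]
    refine (degree_sum_le _ _).trans_lt ((Finset.sup_lt_iff (WithBot.bot_lt_coe n)).2 fun i _ => ?_)
    exact (degree_C_mul_X_pow_le _ _).trans_lt (WithBot.coe_lt_coe.2 i.2)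
  have h2 : (monicPoly p).Monic := monic_X_pow_add h1
  have h3 : (monicPoly p).natDegree = n := by
    refine natDegree_eq_of_degree_eq_some ?_
    rw [monicPoly, degree_add_eq_left_of_degree_lt (by rwa [degree_X_pow]), degree_X_pow]
  obtain ⟨lam, hlam⟩ := exists_eq_prod_X_sub_C h2 h3
  refine ⟨lam, monicPoly_injective ?_⟩
  rw [monicPoly_rootCoeffs, hlam]

lemma ae_re_ne : ∀ᵐ lam : Fin n → ℂ, ∀ i j, i ≠ j → (lam i).re ≠ (lam j).re := by
  rw [ae_all_iff]
  intro i
  rw [ae_all_iff]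
  intro j
  by_cases hij : i = j
  · exact Filter.Eventually.of_forall fun _ h => absurd hij h
  let φ : (Fin n → ℂ) →ₗ[ℝ] ℝ := Complex.reLm ∘ₗ (LinearMap.proj (R := ℝ) (φ := fun _ : Fin n => ℂ) i -
    LinearMap.proj j)
  have h1 : LinearMap.ker φ ≠ ⊤ := by
    intro h
    have h2 : (Pi.single i 1 : Fin n → ℂ) ∈ LinearMap.ker φ := h ▸ Submodule.mem_top
    rw [LinearMap.mem_ker] at h2
    simp [φ, Pi.single_eq_of_ne' hij] at h2
  have h2 := Measure.addHaar_submodule (volume : Measure (Fin n → ℂ)) (LinearMap.ker φ) h1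
  rw [ae_iff]
  refine measure_mono_null (fun lam hlam => ?_) h2
  simp only [Set.mem_ofPred_eq, not_forall, ne_eq, not_not] at hlam
  obtain ⟨-, h3⟩ := hlam
  change (lam i - lam j).re = 0
  rw [Complex.sub_re, h3, sub_self]

/-- Every coefficient vector has roots, and they can be sorted unless two real parts coincide. That
exceptional set is null, and a differentiable map sends it to a null set. -/
lemma ae_mem_image_rootCoeffs : ∀ᵐ p : Fin n → ℂ, p ∈ rootCoeffs '' reOrdered n := by
  have h1 : volume (rootCoeffs '' {lam : Fin n → ℂ | ¬ ∀ i j, i ≠ j → (lam i).re ≠ (lam j).re}) =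
      0 := by
    refine addHaar_image_eq_zero_of_differentiableOn_of_addHaar_eq_zero _ ?_ (ae_iff.1 ae_re_ne)
    exact (differentiable_rootCoeffs.restrictScalars ℝ).differentiableOn
  rw [ae_iff]
  refine measure_mono_null (fun p hp => ?_) h1
  obtain ⟨lam, rfl⟩ := exists_rootCoeffs_eq p
  refine ⟨lam, fun hlam => hp ?_, rfl⟩
  obtain ⟨σ, hσ⟩ := exists_comp_mem_reOrdered hlam
  refine ⟨lam ∘ σ, hσ, monicPoly_injective ?_⟩
  rw [monicPoly_rootCoeffs, monicPoly_rootCoeffs]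
  exact Equiv.prod_comp σ fun j => X - C (lam j)

/-- Ordering the roots by real part makes the coefficient map injective. Its complex Jacobian
determinant has modulus `‖V‖`, so the real one is `‖V‖ ^ 2`. -/
lemma lintegral_rootCoeffs (G : (Fin n → ℂ) → ENNReal) :
    ∫⁻ p, G p = ∫⁻ lam in reOrdered n,
      ENNReal.ofReal (‖(Matrix.vandermonde lam).det‖ ^ 2) * G (rootCoeffs lam) := by
  have h1 : ∫⁻ p, G p = ∫⁻ p in rootCoeffs '' reOrdered n, G p := by
    rw [Measure.restrict_eq_self_of_ae_mem ae_mem_image_rootCoeffs]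
  rw [h1, lintegral_image_eq_lintegral_abs_det_fderiv_mul volume measurableSet_reOrdered
    (fun lam _ => ((differentiable_rootCoeffs lam).hasFDerivAt.restrictScalars ℝ).hasFDerivWithinAt)
    injOn_rootCoeffs]
  refine setLIntegral_congr_fun measurableSet_reOrdered fun lam hlam => ?_
  have h2 := LinearMap.det_restrictScalars (R := ℝ)
    (f := (fderiv ℂ rootCoeffs lam : (Fin n → ℂ) →ₗ[ℂ] (Fin n → ℂ)))
  rw [Algebra.norm_complex_apply, Complex.normSq_eq_norm_sq,
    norm_det_fderiv_rootCoeffs (injective_of_mem_reOrdered hlam)] at h2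
  simp only [ContinuousLinearMap.det, ContinuousLinearMap.coe_restrictScalars, h2, abs_sq]

end Roots

end

/-! ### The weights as coordinates on the minor polynomial -/

section

section Residues

open Polynomial

variable {m n : ℕ}

/-- The matrix of the coefficients of the polynomials `∏_{j ≠ k} (X - lam j)`. -/
def residueMatrix (lam : Fin n → ℂ) : Matrix (Fin n) (Fin n) ℂ :=
  Matrix.of fun i k => (∏ j ∈ Finset.univ.erase k, (X - C (lam j))).coeff i

lemma vandermonde_mul_residueMatrix (lam : Fin n → ℂ) :
    Matrix.vandermonde lam * residueMatrix lam =
      Matrix.diagonal fun l => ∏ j ∈ Finset.univ.erase l, (lam l - lam j) := by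
  ext l k
  have hdeg : (∏ j ∈ Finset.univ.erase k, (X - C (lam j))).natDegree < n := by
    rw [natDegree_prod_of_monic _ _ fun j _ => monic_X_sub_C _]
    simp only [natDegree_X_sub_C, Finset.sum_const, smul_eq_mul, mul_one,
      Finset.card_erase_of_mem (Finset.mem_univ k), Finset.card_univ, Fintype.card_fin]
    exact Nat.sub_lt (Nat.pos_of_ne_zero fun h => by subst h; exact k.elim0) one_pos
  have h := eval_eq_sum_range' hdeg (lam l)
  rw [Finset.sum_range, eval_prod] at h
  simp only [eval_sub, eval_X, eval_C] at h
  rw [Matrix.mul_apply, Matrix.diagonal_apply]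
  simp only [Matrix.vandermonde_apply, residueMatrix, Matrix.of_apply, mul_comm (lam l ^ _)]
  rw [← h]
  split_ifs with hlk
  · rw [hlk]
  · exact Finset.prod_eq_zero (Finset.mem_erase.2 ⟨hlk, Finset.mem_univ l⟩) (sub_self _)

lemma norm_det_residueMatrix {lam : Fin n → ℂ} (hlam : Function.Injective lam) :
    ‖(residueMatrix lam).det‖ = ‖(Matrix.vandermonde lam).det‖ := by
  have h0 : ‖(Matrix.vandermonde lam).det‖ ≠ 0 :=
    norm_ne_zero_iff.2 (Matrix.det_vandermonde_ne_zero_iff.2 hlam)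
  have h := congrArg (fun A => ‖A.det‖) (vandermonde_mul_residueMatrix lam)
  simp only [Matrix.det_mul, Matrix.det_diagonal, norm_mul, norm_prod_prod_erase, sq] at h
  exact mul_left_cancel₀ h0 h

/-- The lower coefficients of the polynomial `∑ k, r k ∏_{j ≠ k} (X - lam j)`. -/
def residueCoeffs (lam r : Fin (m + 1) → ℂ) : Fin m → ℂ := fun i => (minorPoly lam r).coeff i

/-- The linear part of `r ↦ residueCoeffs lam (complete r)`. -/
def residueLinear (lam : Fin (m + 1) → ℂ) : Matrix (Fin m) (Fin m) ℂ :=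
  Matrix.of fun i k => residueMatrix lam i.castSucc k.castSucc -
    residueMatrix lam i.castSucc (Fin.last m)

lemma residueCoeffs_complete (lam : Fin (m + 1) → ℂ) (r : Fin m → ℂ) :
    residueCoeffs lam (complete r) = Matrix.toLin' (residueLinear lam) r +
      fun i => residueMatrix lam i.castSucc (Fin.last m) := by
  funext i
  have h : residueCoeffs lam (complete r) i =
      ∑ k, residueMatrix lam i.castSucc k * complete r k := by
    rw [residueCoeffs, minorPoly, finsetSum_coeff]
    refine Finset.sum_congr rfl fun k _ => ?_
    rw [coeff_C_mul, mul_comm]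
    rfl
  rw [h, Fin.sum_univ_castSucc]
  simp only [complete, Fin.snoc_castSucc, Fin.snoc_last, Pi.add_apply, Matrix.toLin'_apply,
    Matrix.mulVec, dotProduct, residueLinear, Matrix.of_apply, sub_mul, Finset.sum_sub_distrib,
    ← Finset.mul_sum]
  ring

lemma residueMatrix_last (lam : Fin (m + 1) → ℂ) (k : Fin (m + 1)) :
    residueMatrix lam (Fin.last m) k = 1 := by
  have h := monic_prod_of_monic (Finset.univ.erase k) (fun j => X - C (lam j))
    fun j _ => monic_X_sub_C _
  have hdeg : (∏ j ∈ Finset.univ.erase k, (X - C (lam j))).natDegree = m := by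
    rw [natDegree_prod_of_monic _ _ fun j _ => monic_X_sub_C _]
    simp only [natDegree_X_sub_C, Finset.sum_const, smul_eq_mul, mul_one,
      Finset.card_erase_of_mem (Finset.mem_univ k), Finset.card_univ, Fintype.card_fin]
    rfl
  rw [Monic, leadingCoeff, hdeg] at h
  exact h

/-- The polynomials `∏_{j ≠ k} (X - lam j)` are monic of degree `m`, so the bottom row of the
residue matrix is all ones. Subtracting the last column from the others, as eliminating the last
weight does, reduces that row to its last entry. -/
lemma det_residueLinear (lam : Fin (m + 1) → ℂ) :
    (residueLinear lam).det = (residueMatrix lam).det := by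
  set B : Matrix (Fin (m + 1)) (Fin (m + 1)) ℂ := Matrix.of fun i j =>
    residueMatrix lam i j - if j = Fin.last m then 0 else residueMatrix lam i (Fin.last m) with hB
  have h1 : (residueMatrix lam).det = B.det := by
    rw [← Matrix.det_transpose, ← Matrix.det_transpose B]
    refine Matrix.det_eq_of_forall_row_eq_smul_add_const
      (fun j => if j = Fin.last m then 0 else 1) (Fin.last m) (if_pos rfl) fun i j => ?_
    simp only [hB, Matrix.transpose_apply, Matrix.of_apply, if_true, sub_zero]
    split_ifs <;> ring
  have h2 : ∀ j, B (Fin.last m) j = if j = Fin.last m then 1 else 0 := fun j => by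
    simp only [hB, Matrix.of_apply, residueMatrix_last]
    split_ifs <;> ring
  rw [h1, Matrix.det_succ_row B (Fin.last m), Finset.sum_eq_single (Fin.last m)]
  · rw [h2, if_pos rfl, mul_one, Even.neg_one_pow ⟨_, rfl⟩, one_mul]
    congr 1
    ext i k
    simp only [residueLinear, Matrix.of_apply, hB, Matrix.submatrix_apply, Fin.succAbove_last,
      if_neg (Fin.castSucc_lt_last k).ne]
  · intro j _ hj
    rw [h2, if_neg hj, mul_zero, zero_mul]
  · exact fun h => absurd (Finset.mem_univ _) h

lemma lintegral_residueCoeffs {lam : Fin (m + 1) → ℂ} (hlam : Function.Injective lam)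
    {G : (Fin m → ℂ) → ENNReal} (hG : Measurable G) :
    ∫⁻ q, G q = ENNReal.ofReal (‖(Matrix.vandermonde lam).det‖ ^ 2) *
      ∫⁻ r, G (residueCoeffs lam (complete r)) := by
  set v : Fin m → ℂ := fun i => residueMatrix lam i.castSucc (Fin.last m) with hv
  have h1 : ‖LinearMap.det (Matrix.toLin' (residueLinear lam))‖ =
      ‖(Matrix.vandermonde lam).det‖ := by
    rw [LinearMap.det_toLin', det_residueLinear, norm_det_residueMatrix hlam]
  have h2 : LinearMap.det (Matrix.toLin' (residueLinear lam)) ≠ 0 := by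
    rw [← norm_ne_zero_iff, h1]
    exact norm_ne_zero_iff.2 (Matrix.det_vandermonde_ne_zero_iff.2 hlam)
  have hm : Measurable fun q => G (q + v) := hG.comp (measurable_add_const v)
  rw [← lintegral_add_right_eq_self G v, lintegral_comp_complexLinearMap _ h2 hm, h1]
  simp only [residueCoeffs_complete, hv]

lemma IsSpectralData.charCoeffs_eq {a : Fin (m + 1) → ℂ} {b : Fin m → ℂ}
    {lam r : Fin (m + 1) → ℂ} (h : IsSpectralData (tridiag a b) lam r) :
    charCoeffs (a, b) = (rootCoeffs lam, residueCoeffs lam r) := by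
  obtain ⟨h1, h2⟩ := h.monicPoly_charCoeffs
  refine Prod.ext (monicPoly_injective (h1.trans (monicPoly_rootCoeffs lam).symm))
    (funext fun i => ?_)
  rw [← coeff_monicPoly (charCoeffs (a, b)).2 i, h2]
  rfl

/-- The change of variables from the entries of the matrix to the spectral parameters. -/
lemma lintegral_charCoeffs_eq {G : (Fin (m + 1) → ℂ) × (Fin m → ℂ) → ENNReal}
    (hG : Measurable G) :
    ∫⁻ a : Fin (m + 1) → ℂ, ∫⁻ b : Fin m → ℂ, G (charCoeffs (a, b)) *
      ∏ k, ENNReal.ofReal (‖b k‖ ^ (2 * k.1)) =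
    ∫⁻ lam in reOrdered (m + 1), ENNReal.ofReal (‖(Matrix.vandermonde lam).det‖ ^ 4) *
      ∫⁻ r, G (rootCoeffs lam, residueCoeffs lam (complete r)) := by
  rw [lintegral_charCoeffs hG, lintegral_rootCoeffs]
  refine setLIntegral_congr_fun measurableSet_reOrdered fun lam hlam => ?_
  have hm : Measurable fun q => G (rootCoeffs lam, q) := hG.comp measurable_prodMk_left
  rw [lintegral_residueCoeffs (injective_of_mem_reOrdered hlam) hm, ← mul_assoc,
    ← ENNReal.ofReal_mul (by positivity), ← pow_add]

end Residues

end

section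

/-! ### The law of the entries -/

section Laws

variable {m n : ℕ}

/-- Density of the law of the diagonal entries. -/
def diagDensity (z : ℂ) : ℝ := (2 * Real.pi)⁻¹ * Real.exp (-‖z‖ ^ 2 / 2)

/-- Normalization of the density of the law of the subdiagonal entries. -/
def subdiagConst (α : ℝ) : ℝ := 2 ^ (1 - α / 2) / Real.Gamma (α / 2) * (2 * Real.pi)⁻¹

/-- Density of the law of the subdiagonal entries. -/
def subdiagDensity (α : ℝ) (z : ℂ) : ℝ :=
  subdiagConst α * (‖z‖ ^ (α - 2) * Real.exp (-‖z‖ ^ 2 / 2))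

lemma subdiagConst_pos {α : ℝ} (hα : 0 < α) : 0 < subdiagConst α := by
  have := Real.Gamma_pos_of_pos (half_pos hα)
  have := Real.pi_pos
  unfold subdiagConst
  positivity

lemma measurable_diagDensity : Measurable diagDensity := by
  unfold diagDensity
  fun_prop

lemma measurable_subdiagDensity (α : ℝ) : Measurable (subdiagDensity α) := by
  unfold subdiagDensity
  fun_prop

lemma complexGaussian_eq :
    complexGaussian = volume.withDensity fun z => ENNReal.ofReal (diagDensity z) := by
  have hmk : Measurable fun p : ℝ × ℝ => (⟨p.1, p.2⟩ : ℂ) :=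
    Complex.measurableEquivRealProd.symm.measurable
  have hg : Measurable fun x => gaussianPDF 0 1 x := measurable_gaussianPDF 0 1
  refine Measure.ext_of_lintegral _ fun φ hφ => ?_
  have hdens : Measurable fun z => ENNReal.ofReal (diagDensity z) :=
    measurable_diagDensity.ennreal_ofReal
  have hφ' : Measurable fun p : ℝ × ℝ => φ ⟨p.1, p.2⟩ := hφ.comp hmk
  rw [complexGaussian, lintegral_map hφ hmk, gaussianReal_of_var_ne_zero 0 one_ne_zero,
    prod_withDensity hg hg, lintegral_withDensity_eq_lintegral_mul _ (by fun_prop) hφ',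
    lintegral_withDensity_eq_lintegral_mul _ hdens hφ,
    ← (Complex.volume_preserving_equiv_real_prod.symm).lintegral_comp (hdens.mul hφ)]
  refine lintegral_congr fun p => ?_
  simp only [Pi.mul_apply]
  congr 1
  rw [gaussianPDF, gaussianPDF, ← ENNReal.ofReal_mul (gaussianPDFReal_nonneg _ _ _)]
  congr 1
  have h2 : ‖(⟨p.1, p.2⟩ : ℂ)‖ ^ 2 = p.1 ^ 2 + p.2 ^ 2 := by
    rw [← Complex.normSq_eq_norm_sq, Complex.normSq_mk]
    ring
  change _ = diagDensity ⟨p.1, p.2⟩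
  have h3 : (√(2 * Real.pi))⁻¹ * (√(2 * Real.pi))⁻¹ = (2 * Real.pi)⁻¹ := by
    rw [← mul_inv, Real.mul_self_sqrt (by positivity)]
  simp only [gaussianPDFReal, diagDensity, h2, NNReal.coe_one, mul_one, sub_zero]
  rw [mul_mul_mul_comm, h3, ← Real.exp_add]
  congr 2
  ring

/-- The phase is uniform on `[0, 2π)` while polar coordinates use `(-π, π)`; up to null sets both
are fundamental domains for the period `2π`. -/
lemma setLIntegral_exp_mul_I (φ : ℂ → ENNReal) (ρ : ℝ) :
    ∫⁻ θ in Set.Ico 0 (2 * Real.pi), φ ((ρ : ℂ) * Complex.exp ((θ : ℂ) * Complex.I)) =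
      ∫⁻ θ in Set.Ioo (-Real.pi) Real.pi, φ ((ρ : ℂ) * Complex.exp ((θ : ℂ) * Complex.I)) := by
  have h1 := isAddFundamentalDomain_Ioc Real.two_pi_pos 0
  have h2 := isAddFundamentalDomain_Ioc Real.two_pi_pos (-Real.pi)
  rw [zero_add] at h1
  rw [show -Real.pi + 2 * Real.pi = Real.pi by ring] at h2
  rw [setLIntegral_congr Ico_ae_eq_Ioc, setLIntegral_congr Ioo_ae_eq_Ioc]
  refine h1.setLIntegral_eq h2 _ fun g x => ?_
  obtain ⟨_, k, rfl⟩ := g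
  congr 2
  change Complex.exp (((k • (2 * Real.pi) + x : ℝ) : ℂ) * Complex.I) = _
  rw [Complex.ofReal_add, add_mul, Complex.exp_add]
  have : Complex.exp (((k • (2 * Real.pi) : ℝ) : ℂ) * Complex.I) = 1 := by
    rw [Complex.exp_eq_one_iff]
    refine ⟨k, ?_⟩
    push_cast [zsmul_eq_mul]
    ring
  rw [this, one_mul]

/-- In polar coordinates the area element carries a factor `ρ`, which lowers the exponent `α - 1` of
the chi density to `α - 2`; the uniform phase contributes `(2π)⁻¹`. -/
lemma subdiagLaw_eq (α : ℝ) :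
    subdiagLaw α = volume.withDensity fun z => ENNReal.ofReal (subdiagDensity α z) := by
  have hmk : Measurable fun p : ℝ × ℝ => (p.1 : ℂ) * Complex.exp ((p.2 : ℂ) * Complex.I) := by
    fun_prop
  have hchi : Measurable fun x => ENNReal.ofReal (chiPDF α x) := by
    refine Measurable.ennreal_ofReal ?_
    unfold chiPDF
    refine Measurable.ite measurableSet_Ici ?_ measurable_const
    fun_prop
  refine Measure.ext_of_lintegral _ fun φ hφ => ?_
  have hdens : Measurable fun z => ENNReal.ofReal (subdiagDensity α z) :=
    (measurable_subdiagDensity α).ennreal_ofReal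

  have hvol : volume (Set.Ico 0 (2 * Real.pi)) = ENNReal.ofReal (2 * Real.pi) := by
    rw [Real.volume_Ico, sub_zero]
  have hI : Measurable fun ρ : ℝ => ∫⁻ θ in Set.Ico 0 (2 * Real.pi),
      φ ((ρ : ℂ) * Complex.exp ((θ : ℂ) * Complex.I)) :=
    Measurable.lintegral_prod_right' (f := fun p : ℝ × ℝ =>
      φ ((p.1 : ℂ) * Complex.exp ((p.2 : ℂ) * Complex.I))) (hφ.comp hmk)
  have hleft : ∫⁻ z, φ z ∂subdiagLaw α = ∫⁻ ρ in Set.Ioi (0 : ℝ),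
      ENNReal.ofReal (chiPDF α ρ) * ((ENNReal.ofReal (2 * Real.pi))⁻¹ *
        ∫⁻ θ in Set.Ico 0 (2 * Real.pi), φ ((ρ : ℂ) * Complex.exp ((θ : ℂ) * Complex.I))) := by
    have hφ' : Measurable fun p : ℝ × ℝ => φ ((p.1 : ℂ) * Complex.exp ((p.2 : ℂ) * Complex.I)) :=
      hφ.comp hmk
    rw [subdiagLaw, lintegral_map hφ hmk, chiLaw, ProbabilityTheory.cond, hvol,
      lintegral_prod _ hφ'.aemeasurable, lintegral_withDensity_eq_lintegral_mul _ hchi]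
    · simp only [Pi.mul_apply, lintegral_smul_measure, smul_eq_mul]
      rw [← lintegral_indicator measurableSet_Ioi]
      refine lintegral_congr_ae ?_
      have h0 : ∀ᵐ ρ : ℝ, ρ ≠ 0 := by simp [ae_iff]
      filter_upwards [h0] with ρ hρ
      rcases lt_or_gt_of_ne hρ with h | h
      · rw [Set.indicator_of_notMem (by simpa using h.le), chiPDF, if_neg (not_le.2 h),
          ENNReal.ofReal_zero, zero_mul]
      · rw [Set.indicator_of_mem (by simpa using h)]
    · simp only [lintegral_smul_measure, smul_eq_mul]
      exact hI.const_mul _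
  have hright : ∫⁻ z, φ z ∂(volume.withDensity fun z => ENNReal.ofReal (subdiagDensity α z)) =
      ∫⁻ ρ in Set.Ioi (0 : ℝ), ∫⁻ θ in Set.Ioo (-Real.pi) Real.pi,
        ENNReal.ofReal ρ * (ENNReal.ofReal (subdiagDensity α ρ) *
          φ ((ρ : ℂ) * Complex.exp ((θ : ℂ) * Complex.I))) := by
    rw [lintegral_withDensity_eq_lintegral_mul _ hdens hφ,
      ← Complex.lintegral_comp_polarCoord_symm, polarCoord_target, Measure.volume_eq_prod,
      ← Measure.prod_restrict, lintegral_prod]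
    · refine lintegral_congr fun ρ => lintegral_congr fun θ => ?_
      have h1 : Complex.polarCoord.symm (ρ, θ) =
          (ρ : ℂ) * Complex.exp ((θ : ℂ) * Complex.I) := by
        rw [Complex.polarCoord_symm_apply, Complex.exp_mul_I]
        simp
      have h2 : subdiagDensity α ((ρ : ℂ) * Complex.exp ((θ : ℂ) * Complex.I)) =
          subdiagDensity α ρ := by
        rw [subdiagDensity, norm_mul, Complex.norm_exp_ofReal_mul_I, mul_one]
        rfl
      rw [h1, Pi.mul_apply, h2, smul_eq_mul]
    · refine Measurable.aemeasurable ?_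
      have : Measurable fun p : ℝ × ℝ => Complex.polarCoord.symm p := by
        simp only [Complex.polarCoord_symm_apply]
        fun_prop
      exact (by fun_prop : Measurable fun p : ℝ × ℝ => ENNReal.ofReal p.1).smul
        ((hdens.mul hφ).comp this)
  rw [hleft, hright]
  refine setLIntegral_congr_fun measurableSet_Ioi fun ρ hρ => ?_
  have hρ0 : 0 < ρ := hρ
  rw [setLIntegral_exp_mul_I, lintegral_const_mul' _ _ ENNReal.ofReal_ne_top,
    lintegral_const_mul' _ _ ENNReal.ofReal_ne_top, ← mul_assoc, ← mul_assoc]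
  congr 1
  rw [← ENNReal.ofReal_inv_of_pos Real.two_pi_pos, ← ENNReal.ofReal_mul hρ0.le,
    mul_comm, ← ENNReal.ofReal_mul (by positivity)]
  congr 1
  rw [chiPDF, if_pos hρ0.le, subdiagDensity, subdiagConst, Complex.norm_real,
    Real.norm_of_nonneg hρ0.le, show α - 1 = α - 2 + 1 by ring, Real.rpow_add hρ0, Real.rpow_one]
  ring

lemma lintegral_pi_prod (g : Fin n → ℂ → ENNReal) (hg : ∀ k, Measurable (g k)) :
    ∫⁻ x : Fin n → ℂ, ∏ k, g k (x k) = ∏ k, ∫⁻ z, g k z := by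
  induction n with
  | zero =>
    simp only [Finset.univ_eq_empty, Finset.prod_empty, lintegral_one]
    rw [volume_pi, Measure.pi_of_empty]
    simp
  | succ n ih =>
    have hm : Measurable fun x : Fin (n + 1) → ℂ => ∏ k, g k (x k) :=
      Finset.measurable_fun_prod _ fun k _ => (hg k).comp (measurable_pi_apply k)
    have hm' : Measurable fun x : Fin n → ℂ => ∏ k, g k.castSucc (x k) :=
      Finset.measurable_fun_prod _ fun k _ => (hg _).comp (measurable_pi_apply k)
    rw [lintegral_pi_snoc hm, Fin.prod_univ_castSucc, ← ih (fun k => g k.castSucc) fun k => hg _,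
      ← lintegral_const_mul _ (hg _)]
    refine lintegral_congr fun z => ?_
    rw [← lintegral_mul_const _ hm']
    refine lintegral_congr fun x => ?_
    simp only [Fin.prod_univ_castSucc, Fin.snoc_castSucc, Fin.snoc_last]

lemma pi_eq_withDensity (μ : Fin n → Measure ℂ) [∀ k, SigmaFinite (μ k)]
    (g : Fin n → ℂ → ENNReal) (hg : ∀ k, Measurable (g k))
    (h : ∀ k, μ k = volume.withDensity (g k)) :
    Measure.pi μ = volume.withDensity fun x => ∏ k, g k (x k) := by
  refine Measure.pi_eq fun s hs => ?_
  rw [withDensity_apply _ (MeasurableSet.univ_pi hs),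
    ← lintegral_indicator (MeasurableSet.univ_pi hs)]
  have h1 : (Set.univ.pi s).indicator (fun x : Fin n → ℂ => ∏ k, g k (x k)) =
      fun x => ∏ k, (s k).indicator (g k) (x k) := by
    funext x
    by_cases hx : x ∈ Set.univ.pi s
    · rw [Set.indicator_of_mem hx]
      exact Finset.prod_congr rfl fun k _ =>
        (Set.indicator_of_mem (hx k (Set.mem_univ k)) _).symm
    · rw [Set.indicator_of_notMem hx]
      simp only [Set.mem_pi, Set.mem_univ, true_implies, not_forall] at hx
      obtain ⟨k, hk⟩ := hx
      exact (Finset.prod_eq_zero (Finset.mem_univ k) (Set.indicator_of_notMem hk _)).symm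
  rw [h1, lintegral_pi_prod _ fun k => (hg k).indicator (hs k)]
  refine Finset.prod_congr rfl fun k _ => ?_
  rw [lintegral_indicator (hs k), h k, withDensity_apply _ (hs k)]

lemma IsModel.lintegral_eq {Ω : Type*} [MeasurableSpace Ω] {β : ℝ} {P : Measure Ω}
    [IsProbabilityMeasure P] {a : Fin (m + 1) → Ω → ℂ} {b : Fin m → Ω → ℂ}
    (h : IsModel β P a b) {H : (Fin (m + 1) → ℂ) × (Fin m → ℂ) → ENNReal} (hH : Measurable H) :
    ∫⁻ ω, H (fun j => a j ω, fun j => b j ω) ∂P =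
      ∫⁻ x : Fin (m + 1) → ℂ, ∫⁻ y : Fin m → ℂ, H (x, y) *
        ((∏ j, ENNReal.ofReal (diagDensity (x j))) *
          ∏ j : Fin m, ENNReal.ofReal (subdiagDensity (β * ((j : ℝ) + 1) / 2) (y j))) := by
  have hmeas : ∀ s, AEMeasurable (Sum.elim a b s) P := by
    rintro (j | j)
    · exact (h.law_a j).aemeasurable
    · exact (h.law_b j).aemeasurable
  have hprob : ∀ s, IsProbabilityMeasure (P.map (Sum.elim a b s)) := fun s =>
    Measure.isProbabilityMeasure_map (hmeas s)
  have h1 := (iIndepFun_iff_map_fun_eq_pi_map hmeas).1 h.indep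
  have hm : AEMeasurable (fun ω s => Sum.elim a b s ω) P := aemeasurable_pi_lambda _ hmeas
  have h2 := measurePreserving_sumPiEquivProdPi (X := fun _ => ℂ)
    fun s => P.map (Sum.elim a b s)
  have hga : Measurable fun z => ENNReal.ofReal (diagDensity z) :=
    measurable_diagDensity.ennreal_ofReal
  have hgb : ∀ α, Measurable fun z => ENNReal.ofReal (subdiagDensity α z) := fun α =>
    (measurable_subdiagDensity α).ennreal_ofReal
  have h3 := pi_eq_withDensity (fun j => P.map (Sum.elim a b (.inl j)))
    (fun _ z => ENNReal.ofReal (diagDensity z)) (fun _ => hga)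
    fun j => (h.law_a j).map_eq.trans complexGaussian_eq
  have h4 := pi_eq_withDensity (fun j => P.map (Sum.elim a b (.inr j)))
    (fun j z => ENNReal.ofReal (subdiagDensity (β * ((j : ℝ) + 1) / 2) z)) (fun j => hgb _)
    fun j => (h.law_b j).map_eq.trans (subdiagLaw_eq _)
  have hA : Measurable fun x : Fin (m + 1) → ℂ => ∏ j, ENNReal.ofReal (diagDensity (x j)) :=
    Finset.measurable_fun_prod _ fun j _ => hga.comp (measurable_pi_apply j)
  have hB : Measurable fun y : Fin m → ℂ =>
      ∏ j : Fin m, ENNReal.ofReal (subdiagDensity (β * ((j : ℝ) + 1) / 2) (y j)) :=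
    Finset.measurable_fun_prod _ fun j _ => (hgb _).comp (measurable_pi_apply j)
  have h5 : ∫⁻ ω, H (fun j => a j ω, fun j => b j ω) ∂P =
      ∫⁻ x, H x ∂((Measure.pi fun j => P.map (Sum.elim a b (.inl j))).prod
        (Measure.pi fun j => P.map (Sum.elim a b (.inr j)))) := by
    rw [← h2.lintegral_comp hH, ← h1, lintegral_map' _ hm]
    · rfl
    · exact (hH.comp (MeasurableEquiv.measurable _)).aemeasurable
  have hAB : Measurable fun z : (Fin (m + 1) → ℂ) × (Fin m → ℂ) =>
      (∏ j, ENNReal.ofReal (diagDensity (z.1 j))) *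
        ∏ j : Fin m, ENNReal.ofReal (subdiagDensity (β * ((j : ℝ) + 1) / 2) (z.2 j)) :=
    (hA.comp measurable_fst).mul (hB.comp measurable_snd)
  rw [h5, h3, h4, prod_withDensity hA hB, lintegral_withDensity_eq_lintegral_mul _ hAB hH,
    lintegral_prod _ (hAB.mul hH).aemeasurable]
  exact lintegral_congr fun x => lintegral_congr fun y => mul_comm _ _

end Laws

end

section

/-! ### Symmetry and measurability of the density -/

section Density

variable {m n : ℕ}

lemma prod_norm_sub_rpow (β : ℝ) (lam : Fin n → ℂ) :
    ∏ j, ∏ k ∈ Finset.Ioi j, ‖lam k - lam j‖ ^ β = ‖(Matrix.vandermonde lam).det‖ ^ β := by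
  rw [Matrix.det_vandermonde, norm_prod, ← Real.finsetProd_rpow _ _ fun _ _ => norm_nonneg _]
  refine Finset.prod_congr rfl fun j _ => ?_
  rw [norm_prod, ← Real.finsetProd_rpow _ _ fun _ _ => norm_nonneg _]

lemma norm_det_vandermonde_comp (σ : Equiv.Perm (Fin n)) (lam : Fin n → ℂ) :
    ‖(Matrix.vandermonde (lam ∘ σ)).det‖ = ‖(Matrix.vandermonde lam).det‖ := by
  have h : Matrix.vandermonde (lam ∘ σ) = (Matrix.vandermonde lam).submatrix σ id := rfl
  rw [h, Matrix.det_permute, norm_mul]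
  rcases Int.units_eq_one_or (Equiv.Perm.sign σ) with h1 | h1 <;> rw [h1] <;> simp

lemma fIntegrand_nonneg (β : ℝ) (lam : Fin (m + 1) → ℂ) (r : Fin m → ℂ) :
    0 ≤ fIntegrand β lam r := by
  unfold fIntegrand
  positivity

lemma f_nonneg (β : ℝ) (lam : Fin (m + 1) → ℂ) : 0 ≤ f β lam :=
  integral_nonneg fun r => fIntegrand_nonneg β lam r

lemma fIntegrand_comp_perm (β : ℝ) (σ : Equiv.Perm (Fin (m + 1))) (lam : Fin (m + 1) → ℂ)
    (r : Fin m → ℂ) : fIntegrand β (lam ∘ σ) (permWeights σ r) = fIntegrand β lam r := by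
  rw [fIntegrand, complete_permWeights, g_comp_perm, fIntegrand]
  congr 1
  exact Equiv.prod_comp σ fun k => ‖complete r k‖ ^ (β / 2 - 1)

lemma MeasurePreserving.withDensity_of_comp_eq {X : Type*} [MeasurableSpace X] {μ : Measure X}
    {φ : X → X} (h : MeasurePreserving φ μ μ) {D : X → ENNReal} (hD : Measurable D)
    (hφ : ∀ x, D (φ x) = D x) : MeasurePreserving φ (μ.withDensity D) (μ.withDensity D) := by
  refine ⟨h.measurable, Measure.ext fun s hs => ?_⟩
  rw [Measure.map_apply h.measurable hs, withDensity_apply _ hs,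
    withDensity_apply _ (h.measurable hs), ← h.setLIntegral_comp_preimage hs hD]
  exact lintegral_congr fun x => (hφ x).symm

lemma measurePreserving_permWeights_eigenvectorMeasure (σ : Equiv.Perm (Fin (m + 1))) :
    MeasurePreserving (permWeights σ) (eigenvectorMeasure m) (eigenvectorMeasure m) := by
  refine MeasurePreserving.withDensity_of_comp_eq (measurePreserving_permWeights (m := m) σ)
    measurable_eigenvectorDensity fun r => ?_
  rw [complete_permWeights]
  exact Equiv.prod_comp σ fun k => ENNReal.ofReal ‖complete r k‖⁻¹

lemma measurable_fIntegrand_right (β : ℝ) (lam : Fin (m + 1) → ℂ) :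
    Measurable (fIntegrand β lam) := by
  have h := (measurable_fIntegrand (m := m) β).comp (measurable_prodMk_left (x := lam))
  exact h

lemma f_comp_perm (β : ℝ) (σ : Equiv.Perm (Fin (m + 1))) (lam : Fin (m + 1) → ℂ) :
    f β (lam ∘ σ) = f β lam := by
  have h := measurePreserving_permWeights_eigenvectorMeasure (m := m) σ
  have hm := measurable_fIntegrand_right β (lam ∘ σ)
  rw [f, ← h.map_eq, integral_map h.measurable.aemeasurable hm.aestronglyMeasurable]
  simp only [fIntegrand_comp_perm]
  rfl

lemma measurable_f (β : ℝ) : Measurable (f β : (Fin (m + 1) → ℂ) → ℝ) := by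
  have h : SFinite (eigenvectorMeasure m) := by
    unfold eigenvectorMeasure
    infer_instance
  exact ((measurable_fIntegrand β).stronglyMeasurable.integral_prod_right'
    (ν := eigenvectorMeasure m)).measurable

lemma measurable_jpdf (β Z : ℝ) : Measurable (jpdf β Z : (Fin (m + 1) → ℂ) → ℝ) := by
  have := measurable_f (m := m) β
  unfold jpdf
  fun_prop

lemma jpdf_nonneg (β : ℝ) {Z : ℝ} (hZ : 0 < Z) (lam : Fin (m + 1) → ℂ) : 0 ≤ jpdf β Z lam := by
  have := f_nonneg β lam
  unfold jpdf
  positivity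

lemma jpdf_comp_perm (β Z : ℝ) (σ : Equiv.Perm (Fin (m + 1))) (lam : Fin (m + 1) → ℂ) :
    jpdf β Z (lam ∘ σ) = jpdf β Z lam := by
  rw [jpdf, jpdf, prod_norm_sub_rpow, prod_norm_sub_rpow, norm_det_vandermonde_comp, f_comp_perm]
  congr 3
  exact Equiv.prod_comp σ fun j => Real.exp (-‖lam j‖ ^ 2 / 2)

lemma measurePreserving_comp_perm (σ : Equiv.Perm (Fin n)) :
    MeasurePreserving fun lam : Fin n → ℂ => lam ∘ σ := by
  have h : ⇑(MeasurableEquiv.piCongrLeft (fun _ : Fin n => ℂ) σ.symm) = fun lam => lam ∘ σ := by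
    funext lam k
    obtain ⟨k, rfl⟩ := σ.symm.surjective k
    rw [MeasurableEquiv.coe_piCongrLeft, Equiv.piCongrLeft_apply_apply, Function.comp_apply,
      Equiv.apply_symm_apply]
  rw [← h]
  exact volume_measurePreserving_piCongrLeft (fun _ : Fin n => ℂ) σ.symm

/-- Almost every vector has exactly one rearrangement with increasing real parts, and permutations
preserve Lebesgue measure. -/
lemma lintegral_eq_factorial_mul {H : (Fin n → ℂ) → ENNReal} (hH : Measurable H)
    (hs : ∀ (σ : Equiv.Perm (Fin n)) lam, H (lam ∘ σ) = H lam) :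
    ∫⁻ lam, H lam = n.factorial * ∫⁻ lam in reOrdered n, H lam := by
  have h1 : ∀ᵐ lam : Fin n → ℂ,
      H lam = ∑ σ : Equiv.Perm (Fin n), (reOrdered n).indicator H (lam ∘ σ) := by
    filter_upwards [ae_re_ne (n := n)] with lam hlam
    obtain ⟨σ, hσ⟩ := exists_comp_mem_reOrdered hlam
    rw [Finset.sum_eq_single σ, Set.indicator_of_mem hσ, hs]
    · intro τ _ hτ
      exact Set.indicator_of_notMem (fun h => hτ (perm_eq_of_mem_reOrdered h hσ)) _
    · exact fun h => absurd (Finset.mem_univ σ) h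
  have h2 : Measurable ((reOrdered n).indicator H) := hH.indicator measurableSet_reOrdered
  have h4 : ∀ σ : Equiv.Perm (Fin n), Measurable fun lam => (reOrdered n).indicator H (lam ∘ σ) :=
    fun σ => h2.comp (measurePreserving_comp_perm σ).measurable
  rw [lintegral_congr_ae h1, lintegral_finsetSum _ fun σ _ => h4 σ]
  have h3 : ∀ σ : Equiv.Perm (Fin n), ∫⁻ lam, (reOrdered n).indicator H (lam ∘ σ) =
      ∫⁻ lam in reOrdered n, H lam := fun σ => by
    rw [(measurePreserving_comp_perm σ).lintegral_comp h2,
      lintegral_indicator measurableSet_reOrdered]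
  simp only [h3, Finset.sum_const, Finset.card_univ, Fintype.card_perm, Fintype.card_fin,
    nsmul_eq_mul]

end Density

end

section

/-! ### The joint density of the eigenvalues -/

section JointDensity

variable {m n : ℕ}

/-- Density of the joint law of the entries. -/
def entryDensity (β : ℝ) (x : (Fin (m + 1) → ℂ) × (Fin m → ℂ)) : ENNReal :=
  (∏ j, ENNReal.ofReal (diagDensity (x.1 j))) *
    ∏ j : Fin m, ENNReal.ofReal (subdiagDensity (β * ((j : ℝ) + 1) / 2) (x.2 j))

/-- Normalization of the density of the joint law of the entries. -/
def entryConst (β : ℝ) (m : ℕ) : ℝ :=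
  (2 * Real.pi)⁻¹ ^ (m + 1) * ∏ j : Fin m, subdiagConst (β * ((j : ℝ) + 1) / 2)

lemma entryConst_pos {β : ℝ} (hβ : 0 < β) (m : ℕ) : 0 < entryConst β m :=
  mul_pos (pow_pos (inv_pos.2 Real.two_pi_pos) _)
    (Finset.prod_pos fun j _ => subdiagConst_pos (by positivity))

lemma measurable_entryDensity (β : ℝ) :
    Measurable (entryDensity β : (Fin (m + 1) → ℂ) × (Fin m → ℂ) → ENNReal) := by
  refine Measurable.mul ?_ ?_
  · exact Finset.measurable_fun_prod _ fun j _ => (measurable_diagDensity.comp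
      ((measurable_pi_apply j).comp measurable_fst)).ennreal_ofReal
  · exact Finset.measurable_fun_prod _ fun j _ => ((measurable_subdiagDensity _).comp
      ((measurable_pi_apply j).comp measurable_snd)).ennreal_ofReal

lemma entryDensity_eq {β : ℝ} (hβ : 0 < β) (a : Fin (m + 1) → ℂ) (b : Fin m → ℂ) :
    entryDensity β (a, b) = ENNReal.ofReal (entryConst β m *
      (Real.exp (-(∑ j, ‖a j‖ ^ 2 + ∑ j, ‖b j‖ ^ 2) / 2) *
        ∏ j : Fin m, ‖b j‖ ^ (β * ((j : ℝ) + 1) / 2 - 2))) := by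
  have hd : ∀ z, 0 ≤ diagDensity z := fun z => by
    have := Real.pi_pos
    unfold diagDensity
    positivity
  have hs : ∀ (j : Fin m) z, 0 ≤ subdiagDensity (β * ((j : ℝ) + 1) / 2) z := fun j z => by
    have := subdiagConst_pos (α := β * ((j : ℝ) + 1) / 2) (by positivity)
    unfold subdiagDensity
    positivity
  rw [entryDensity, ← ENNReal.ofReal_prod_of_nonneg fun j _ => hd _,
    ← ENNReal.ofReal_prod_of_nonneg fun j _ => hs j _,
    ← ENNReal.ofReal_mul (Finset.prod_nonneg fun j _ => hd _)]
  congr 1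
  simp only [diagDensity, subdiagDensity, Finset.prod_mul_distrib, Finset.prod_const,
    Finset.card_univ, Fintype.card_fin, ← Real.exp_sum, entryConst]
  have h1 : -(∑ j, ‖a j‖ ^ 2 + ∑ j, ‖b j‖ ^ 2) / 2 =
      ∑ j, -‖a j‖ ^ 2 / 2 + ∑ j, -‖b j‖ ^ 2 / 2 := by
    rw [← Finset.sum_div, ← Finset.sum_div, Finset.sum_neg_distrib, Finset.sum_neg_distrib]
    ring
  rw [h1, Real.exp_add]
  ring

/-- Where no `b k` vanishes, `charCoeffs` is a measurable embedding, so the density divided by the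
Jacobian is a measurable function of the coefficients. This allows the change of variables without
an explicit inverse. -/
lemma exists_entryDensity_extend (β : ℝ) :
    ∃ w : (Fin (m + 1) → ℂ) × (Fin m → ℂ) → ENNReal, Measurable w ∧
      ∀ a b, (∀ k, b k ≠ 0) → w (charCoeffs (a, b)) =
        entryDensity β (a, b) * (∏ k, ENNReal.ofReal (‖b k‖ ^ (2 * k.1)))⁻¹ := by
  set S : Set ((Fin (m + 1) → ℂ) × (Fin m → ℂ)) := {x | ∀ k, x.2 k ≠ 0}
  have hS : MeasurableSet S := by
    have : S = ⋂ k, {x : (Fin (m + 1) → ℂ) × (Fin m → ℂ) | x.2 k = 0}ᶜ := by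
      ext x
      simp [S]
    rw [this]
    exact MeasurableSet.iInter fun k => (measurableSet_eq_fun
      ((measurable_pi_apply k).comp measurable_snd) measurable_const).compl
  have hemb := (continuous_charCoeffs (m := m)).continuousOn.measurableEmbedding hS
    charCoeffs_injOn
  have hw : Measurable fun x : (Fin (m + 1) → ℂ) × (Fin m → ℂ) =>
      entryDensity β x * (∏ k, ENNReal.ofReal (‖x.2 k‖ ^ (2 * k.1)))⁻¹ :=
    (measurable_entryDensity β).mul (Finset.measurable_fun_prod _ fun k _ =>
      (((measurable_pi_apply k).comp measurable_snd).norm.pow_const _).ennreal_ofReal).inv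
  obtain ⟨w, hw1, hw2⟩ := hemb.exists_measurable_extend (hw.comp measurable_subtype_coe)
    fun _ => inferInstance
  exact ⟨w, hw1, fun a b hb => congrFun hw2 ⟨(a, b), hb⟩⟩

lemma exists_symmetric_extend {F : (Fin n → ℂ) → ENNReal} (hF : Measurable F) :
    ∃ G : (Fin n → ℂ) → ENNReal, Measurable G ∧
      ∀ lam ∈ reOrdered n, G (rootCoeffs lam) = F lam := by
  have hemb := (differentiable_rootCoeffs (n := n)).continuous.continuousOn.measurableEmbedding
    measurableSet_reOrdered injOn_rootCoeffs
  obtain ⟨G, hG1, hG2⟩ := hemb.exists_measurable_extend (hF.comp measurable_subtype_coe)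
    fun _ => inferInstance
  exact ⟨G, hG1, fun lam hlam => congrFun hG2 ⟨lam, hlam⟩⟩

lemma IsSpectralData.prod_norm_eq {a : Fin (m + 1) → ℂ} {b : Fin m → ℂ}
    {lam r : Fin (m + 1) → ℂ} (hs : IsSpectralData (tridiag a b) lam r) :
    ∏ k : Fin m, ‖b k‖ ^ (k.1 + 1) =
      (∏ k, ‖r k‖) * ‖(Matrix.vandermonde lam).det‖ ^ 2 := by
  have h := congrArg norm (prod_weights_mul_vandermonde_sq hs)
  simpa only [norm_prod, norm_mul, norm_pow] using h

/-- The exponents combine as `β (k + 1) / 2 - 2 - 2 k = (k + 1) (β / 2 - 2)`, so only the product `∏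
‖b k‖ ^ (k + 1) = (∏ ‖r k‖) * D ^ 2` enters. The powers of `D` add up to `4 + 2 (β / 2 - 2) = β`. -/
lemma prod_rpow_eq {β D : ℝ} {b : Fin m → ℂ} {r : Fin (m + 1) → ℂ} (hD : 0 < D)
    (hb : ∀ k, b k ≠ 0) (h : ∏ k : Fin m, ‖b k‖ ^ (k.1 + 1) = (∏ k, ‖r k‖) * D ^ 2) :
    D ^ 4 * ((∏ j : Fin m, ‖b j‖ ^ (β * ((j : ℝ) + 1) / 2 - 2)) *
      (∏ k : Fin m, ‖b k‖ ^ (2 * k.1))⁻¹) =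
      D ^ β * ∏ k, (‖r k‖ ^ (β / 2 - 1) * ‖r k‖⁻¹) := by
  have h1 : (∏ j : Fin m, ‖b j‖ ^ (β * ((j : ℝ) + 1) / 2 - 2)) *
      (∏ k : Fin m, ‖b k‖ ^ (2 * k.1))⁻¹ = (∏ k : Fin m, ‖b k‖ ^ (k.1 + 1)) ^ (β / 2 - 2) := by
    rw [← Real.finsetProd_rpow _ _ fun _ _ => by positivity, ← Finset.prod_inv_distrib,
      ← Finset.prod_mul_distrib]
    refine Finset.prod_congr rfl fun k _ => ?_
    have hk : 0 < ‖b k‖ := norm_pos_iff.2 (hb k)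
    rw [← Real.rpow_natCast, ← Real.rpow_natCast, ← Real.rpow_mul hk.le, ← Real.rpow_neg hk.le,
      ← Real.rpow_add hk]
    congr 1
    push_cast
    ring
  have hpos : 0 < (∏ k, ‖r k‖) * D ^ 2 := by
    rw [← h]
    exact Finset.prod_pos fun k _ => pow_pos (norm_pos_iff.2 (hb k)) _
  have hr0 : ∏ k, ‖r k‖ ≠ 0 := fun h0 => by
    rw [h0, zero_mul] at hpos
    exact lt_irrefl _ hpos
  have hr : ∀ k, 0 < ‖r k‖ := fun k =>
    (norm_nonneg _).lt_of_ne' (Finset.prod_ne_zero_iff.1 hr0 k (Finset.mem_univ k))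
  have h2 : ∏ k, (‖r k‖ ^ (β / 2 - 1) * ‖r k‖⁻¹) = (∏ k, ‖r k‖) ^ (β / 2 - 2) := by
    rw [← Real.finsetProd_rpow _ _ fun _ _ => (norm_nonneg _)]
    refine Finset.prod_congr rfl fun k _ => ?_
    rw [← Real.rpow_neg_one, ← Real.rpow_add (hr k)]
    congr 1
    ring
  have h3 : D ^ 4 * (D ^ 2) ^ (β / 2 - 2) = D ^ β := by
    rw [← Real.rpow_natCast D 4, ← Real.rpow_natCast D 2, ← Real.rpow_mul hD.le,
      ← Real.rpow_add hD]
    congr 1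
    push_cast
    ring
  rw [h1, h, h2, Real.mul_rpow (Finset.prod_nonneg fun _ _ => norm_nonneg _) (sq_nonneg D),
    ← h3]
  ring

/-- The squared Frobenius norm in `g` also counts the `m` ones of the superdiagonal; they account
for the factor `exp (m / 2)`. -/
lemma IsSpectralData.exp_eq {a : Fin (m + 1) → ℂ} {b : Fin m → ℂ} (hb : ∀ k, b k ≠ 0)
    {lam r : Fin (m + 1) → ℂ} (hs : IsSpectralData (tridiag a b) lam r) :
    Real.exp (-(∑ j, ‖a j‖ ^ 2 + ∑ j, ‖b j‖ ^ 2) / 2) =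
      Real.exp (m / 2) * ((∏ j, Real.exp (-‖lam j‖ ^ 2 / 2)) * Real.exp (-g lam r)) := by
  rw [← Real.exp_sum, ← Real.exp_add, ← Real.exp_add, g, reconstruct_eq hb hs,
    sum_norm_sq_tridiag, ← Finset.sum_div, Finset.sum_neg_distrib]
  congr 1
  ring

lemma vandermonde_pow_mul_extend {β : ℝ} (hβ : 0 < β)
    {w : (Fin (m + 1) → ℂ) × (Fin m → ℂ) → ENNReal}
    (hw : ∀ a b, (∀ k, b k ≠ 0) → w (charCoeffs (a, b)) =
        entryDensity β (a, b) * (∏ k, ENNReal.ofReal (‖b k‖ ^ (2 * k.1)))⁻¹)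
    {lam : Fin (m + 1) → ℂ} {r : Fin m → ℂ} (h : Admissible lam (complete r)) :
    ENNReal.ofReal (‖(Matrix.vandermonde lam).det‖ ^ 4) *
      w (rootCoeffs lam, residueCoeffs lam (complete r)) =
    ENNReal.ofReal ((entryConst β m * Real.exp (m / 2)) * (∏ j, Real.exp (-‖lam j‖ ^ 2 / 2)) *
      ‖(Matrix.vandermonde lam).det‖ ^ β) *
      ((∏ k, ENNReal.ofReal ‖complete r k‖⁻¹) * ENNReal.ofReal (fIntegrand β lam r)) := by
  obtain ⟨a, b, hb, hs⟩ := h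
  have hD : 0 < ‖(Matrix.vandermonde lam).det‖ :=
    norm_pos_iff.2 (Matrix.det_vandermonde_ne_zero_iff.2 hs.1)
  have hbpos : 0 < ∏ k : Fin m, ‖b k‖ ^ (2 * k.1) :=
    Finset.prod_pos fun k _ => pow_pos (norm_pos_iff.2 (hb k)) _
  have hc := entryConst_pos hβ m
  rw [← hs.charCoeffs_eq, hw a b hb, entryDensity_eq hβ,
    ← ENNReal.ofReal_prod_of_nonneg fun k _ => by positivity,
    ← ENNReal.ofReal_inv_of_pos hbpos, ← ENNReal.ofReal_mul (by positivity),
    ← ENNReal.ofReal_mul (by positivity), ← ENNReal.ofReal_prod_of_nonneg fun k _ => by positivity,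
    ← ENNReal.ofReal_mul (by positivity), ← ENNReal.ofReal_mul (by positivity)]
  congr 1
  have h1 := prod_rpow_eq (β := β) hD hb hs.prod_norm_eq
  rw [hs.exp_eq hb, fIntegrand]
  rw [Finset.prod_mul_distrib] at h1
  linear_combination (entryConst β m * (Real.exp (m / 2) *
    ((∏ j, Real.exp (-‖lam j‖ ^ 2 / 2)) * Real.exp (-g lam (complete r))))) * h1

lemma lintegral_entryDensity {β : ℝ} {w : (Fin (m + 1) → ℂ) × (Fin m → ℂ) → ENNReal}
    (hwm : Measurable w) (hw : ∀ a b, (∀ k, b k ≠ 0) → w (charCoeffs (a, b)) =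
        entryDensity β (a, b) * (∏ k, ENNReal.ofReal (‖b k‖ ^ (2 * k.1)))⁻¹)
    {G : (Fin (m + 1) → ℂ) → ENNReal} (hG : Measurable G) :
    ∫⁻ a : Fin (m + 1) → ℂ, ∫⁻ b : Fin m → ℂ,
      G (charCoeffs (a, b)).1 * entryDensity β (a, b) =
    ∫⁻ lam in reOrdered (m + 1), ENNReal.ofReal (‖(Matrix.vandermonde lam).det‖ ^ 4) *
      ∫⁻ r, G (rootCoeffs lam) * w (rootCoeffs lam, residueCoeffs lam (complete r)) := by
  have hm : Measurable fun x : (Fin (m + 1) → ℂ) × (Fin m → ℂ) => G x.1 * w x :=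
    (hG.comp measurable_fst).mul hwm
  rw [← lintegral_charCoeffs_eq hm]
  refine lintegral_congr fun a => lintegral_congr_ae ?_
  have h0 : ∀ᵐ b : Fin m → ℂ, ∀ k, b k ≠ 0 :=
    ae_all_iff.2 fun k => Measure.ae_eval_ne (μ := fun _ : Fin m => (volume : Measure ℂ)) k 0
  filter_upwards [h0] with b hb
  have hpos : ∏ k, ENNReal.ofReal (‖b k‖ ^ (2 * k.1)) ≠ 0 :=
    Finset.prod_ne_zero_iff.2 fun k _ =>
      (ENNReal.ofReal_pos.2 (pow_pos (norm_pos_iff.2 (hb k)) _)).ne'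
  have htop : ∏ k, ENNReal.ofReal (‖b k‖ ^ (2 * k.1)) ≠ ⊤ :=
    (ENNReal.prod_lt_top fun k _ => ENNReal.ofReal_lt_top).ne
  rw [hw a b hb, mul_assoc, mul_assoc, ENNReal.inv_mul_cancel hpos htop, mul_one]

/-- The normalization constant of the joint density of the eigenvalues. -/
def partitionFunction (β : ℝ) (m : ℕ) : ℝ :=
  (m + 1).factorial / (entryConst β m * Real.exp (m / 2))

lemma partitionFunction_pos {β : ℝ} (hβ : 0 < β) (m : ℕ) : 0 < partitionFunction β m := by
  have := entryConst_pos hβ m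
  unfold partitionFunction
  positivity

/-- The pointwise identity is available at admissible weights, hence almost everywhere.
Integrability lets the real integral `f` be read as a lower integral, and the factorial reflects
that `partitionFunction` normalizes over unordered eigenvalues. -/
lemma lintegral_eigenvector {β : ℝ} (hβ : 0 < β) {lam : Fin (m + 1) → ℂ}
    (hlam : Function.Injective lam) {w : (Fin (m + 1) → ℂ) × (Fin m → ℂ) → ENNReal}
    (hw : ∀ a b, (∀ k, b k ≠ 0) → w (charCoeffs (a, b)) =
        entryDensity β (a, b) * (∏ k, ENNReal.ofReal (‖b k‖ ^ (2 * k.1)))⁻¹) :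
    ∫⁻ r, ENNReal.ofReal (‖(Matrix.vandermonde lam).det‖ ^ 4) *
      w (rootCoeffs lam, residueCoeffs lam (complete r)) =
    (m + 1).factorial * ENNReal.ofReal (jpdf β (partitionFunction β m) lam) := by
  have hc := entryConst_pos hβ m
  have h1 : ∫⁻ r, (∏ k, ENNReal.ofReal ‖complete r k‖⁻¹) * ENNReal.ofReal (fIntegrand β lam r) =
      ENNReal.ofReal (f β lam) := by
    rw [f, ofReal_integral_eq_lintegral_ofReal (integrable_fIntegrand hlam hβ)
      (Filter.Eventually.of_forall (fIntegrand_nonneg β lam)), eigenvectorMeasure,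
      lintegral_withDensity_eq_lintegral_mul _ measurable_eigenvectorDensity
      (measurable_fIntegrand_right β lam).ennreal_ofReal]
    rfl
  rw [lintegral_congr_ae ((ae_admissible hlam).mono fun r hr => vandermonde_pow_mul_extend hβ hw hr),
    lintegral_const_mul' _ _ ENNReal.ofReal_ne_top, h1, ← ENNReal.ofReal_mul (by positivity),
    ← ENNReal.ofReal_natCast, ← ENNReal.ofReal_mul (by positivity), jpdf, prod_norm_sub_rpow,
    partitionFunction]
  congr 1
  field_simp

lemma lintegral_charCoeffs_fst {Ω : Type*} [MeasurableSpace Ω] {β : ℝ} (hβ : 0 < β)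
    {P : Measure Ω} [IsProbabilityMeasure P] {a : Fin (m + 1) → Ω → ℂ} {b : Fin m → Ω → ℂ}
    (h : IsModel β P a b) {G : (Fin (m + 1) → ℂ) → ENNReal} (hG : Measurable G) :
    ∫⁻ ω, G (charCoeffs (fun j => a j ω, fun j => b j ω)).1 ∂P =
      (m + 1).factorial * ∫⁻ lam in reOrdered (m + 1),
        G (rootCoeffs lam) * ENNReal.ofReal (jpdf β (partitionFunction β m) lam) := by
  obtain ⟨w, hwm, hw⟩ := exists_entryDensity_extend (m := m) β
  have hm : Measurable fun x : (Fin (m + 1) → ℂ) × (Fin m → ℂ) => G (charCoeffs x).1 :=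
    hG.comp (measurable_fst.comp continuous_charCoeffs.measurable)
  rw [h.lintegral_eq hm]
  refine (lintegral_entryDensity hwm hw hG).trans ?_
  rw [← lintegral_const_mul' _ _ (ENNReal.natCast_ne_top _)]
  refine setLIntegral_congr_fun measurableSet_reOrdered fun lam hlam => ?_
  have h1 := lintegral_eigenvector hβ (injective_of_mem_reOrdered hlam) hw
  have h2 : Measurable fun r : Fin m → ℂ => w (rootCoeffs lam, residueCoeffs lam (complete r)) := by
    refine hwm.comp (measurable_const.prodMk ?_)
    simp only [residueCoeffs_complete]
    exact (LinearMap.continuous_of_finiteDimensional _).measurable.add_const _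
  rw [lintegral_const_mul' _ _ ENNReal.ofReal_ne_top] at h1
  rw [lintegral_const_mul _ h2, mul_left_comm, h1]
  ring

/-- The listing `ev` is not assumed measurable. By symmetry, however, `F (ev ω)` almost surely
equals a measurable function of the characteristic coefficients, to which the change of variables
applies. -/
lemma isEigenvalueDensity_jpdf {Ω : Type*} [MeasurableSpace Ω] {β : ℝ} (hβ : 0 < β)
    {P : Measure Ω} [IsProbabilityMeasure P] {a : Fin (m + 1) → Ω → ℂ} {b : Fin m → Ω → ℂ}
    (h : IsModel β P a b) :
    IsEigenvalueDensity P (fun ω => tridiag (fun j => a j ω) (fun j => b j ω))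
      (jpdf β (partitionFunction β m)) := by
  refine ⟨jpdf_nonneg β (partitionFunction_pos hβ m), (measurable_jpdf β _).aemeasurable,
    fun σ lam => jpdf_comp_perm β _ σ lam, fun ev hev F hF hFs => ?_⟩
  obtain ⟨G, hG, hGF⟩ := exists_symmetric_extend hF
  have hE : MeasurableSet (rootCoeffs '' reOrdered (m + 1)) :=
    measurableSet_reOrdered.image_of_continuousOn_injOn
      differentiable_rootCoeffs.continuous.continuousOn injOn_rootCoeffs
  have hroot : ∀ ω, rootCoeffs (ev ω) =
      (charCoeffs (fun j => a j ω, fun j => b j ω)).1 := fun ω => by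
    refine monicPoly_injective ?_
    rw [monicPoly_rootCoeffs, ← (charpoly_tridiag_and_minor _ _).1]
    exact (hev ω).symm
  -- Applying the integral formula to the indicator of the complement shows that the random
  -- coefficients almost surely come from roots with distinct real parts.
  have hae : ∀ᵐ ω ∂P, (charCoeffs (fun j => a j ω, fun j => b j ω)).1 ∈
      rootCoeffs '' reOrdered (m + 1) := by
    have h1 := lintegral_charCoeffs_fst hβ h
      ((measurable_const (a := (1 : ENNReal))).indicator hE.compl)
    have h2 : ∫⁻ lam in reOrdered (m + 1),
        (rootCoeffs '' reOrdered (m + 1))ᶜ.indicator (fun _ => (1 : ENNReal)) (rootCoeffs lam) *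
          ENNReal.ofReal (jpdf β (partitionFunction β m) lam) = 0 := by
      rw [setLIntegral_congr_fun (g := fun _ => 0) measurableSet_reOrdered, lintegral_zero]
      intro lam hlam
      have hn : rootCoeffs lam ∉ (rootCoeffs '' reOrdered (m + 1))ᶜ := fun hn =>
        hn ⟨lam, hlam, rfl⟩
      simp only [Set.indicator_of_notMem hn, zero_mul]
    rw [h2, mul_zero, lintegral_eq_zero_iff'] at h1
    · filter_upwards [h1] with ω hω
      by_contra hn
      simp only [Pi.zero_apply] at hω
      rw [Set.indicator_of_mem hn] at hω
      exact one_ne_zero hω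
    · have hab : AEMeasurable (fun ω => ((fun j => a j ω : Fin (m + 1) → ℂ),
          (fun j => b j ω : Fin m → ℂ))) P :=
        (aemeasurable_pi_lambda _ fun j => (h.law_a j).aemeasurable).prodMk
          (aemeasurable_pi_lambda _ fun j => (h.law_b j).aemeasurable)
      exact (((measurable_const (a := (1 : ENNReal))).indicator hE.compl).comp
        (measurable_fst.comp continuous_charCoeffs.measurable)).comp_aemeasurable hab
  have h1 : ∀ᵐ ω ∂P, F (ev ω) = G (charCoeffs (fun j => a j ω, fun j => b j ω)).1 := by
    filter_upwards [hae] with ω ⟨lam, hlam, hω⟩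
    rw [← hω, hGF lam hlam]
    obtain ⟨σ, hσ⟩ := exists_perm_of_rootCoeffs_eq (injective_of_mem_reOrdered hlam)
      ((hroot ω).trans hω.symm)
    rw [hσ, hFs]
  have hm : Measurable fun lam : Fin (m + 1) → ℂ =>
      F lam * ENNReal.ofReal (jpdf β (partitionFunction β m) lam) :=
    hF.mul (measurable_jpdf β _).ennreal_ofReal
  rw [lintegral_congr_ae h1, lintegral_charCoeffs_fst hβ h hG, lintegral_eq_factorial_mul
    hm fun σ lam => by rw [hFs, jpdf_comp_perm]]
  congr 1
  refine setLIntegral_congr_fun measurableSet_reOrdered fun lam hlam => ?_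
  rw [hGF lam hlam]

end JointDensity

end

end ComplexBeta

end

theorem theorem1 (m : ℕ) (β : ℝ) (hβ : 0 < β) :
    -- the eigenvalues and the eigenvector parameters are coordinates on the matrices
    (∀ (a : Fin (m + 1) → ℂ) (b : Fin m → ℂ) (lam : Fin (m + 1) → ℂ), (∀ j, b j ≠ 0) →
      Function.Injective lam → ComplexBeta.ListsEigenvalues (ComplexBeta.tridiag a b) lam →
      ∃! r, ComplexBeta.IsSpectralData (ComplexBeta.tridiag a b) lam r) ∧
    (∀ (a : Fin (m + 1) → ℂ) (b : Fin m → ℂ) (lam r : Fin (m + 1) → ℂ), (∀ j, b j ≠ 0) →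
      ComplexBeta.IsSpectralData (ComplexBeta.tridiag a b) lam r →
      ComplexBeta.reconstruct lam r = ComplexBeta.tridiag a b) ∧
    (∀ lam : Fin (m + 1) → ℂ, Function.Injective lam →
      ∀ᵐ r : Fin m → ℂ, ComplexBeta.Admissible lam (ComplexBeta.complete r)) ∧
    -- the joint density of the eigenvalues
    (∀ lam : Fin (m + 1) → ℂ, Function.Injective lam →
      MeasureTheory.Integrable (ComplexBeta.fIntegrand β lam)
        (ComplexBeta.eigenvectorMeasure m)) ∧
    (∃ Z : ℝ, 0 < Z ∧
      ∀ {Ω : Type*} [MeasurableSpace Ω] (P : MeasureTheory.Measure Ω)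
        [MeasureTheory.IsProbabilityMeasure P]
        (a : Fin (m + 1) → Ω → ℂ) (b : Fin m → Ω → ℂ), ComplexBeta.IsModel β P a b →
        ComplexBeta.IsEigenvalueDensity P
          (fun ω => ComplexBeta.tridiag (fun j => a j ω) (fun j => b j ω))
          (ComplexBeta.jpdf β Z)) ∧
    -- `g` is nonnegative, and it vanishes only at normal matrices
    (∀ lam r : Fin (m + 1) → ℂ, ComplexBeta.Admissible lam r →
      0 ≤ ComplexBeta.g lam r ∧
      (ComplexBeta.g lam r = 0 ↔ IsStarNormal (ComplexBeta.reconstruct lam r))) ∧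
    -- `g` is a rational function
    (∃ p q : MvPolynomial (Fin 4 × Fin (m + 1)) ℝ,
      ∀ lam r : Fin (m + 1) → ℂ, ComplexBeta.Admissible lam r →
        MvPolynomial.eval (ComplexBeta.realCoords lam r) q ≠ 0 ∧
        ComplexBeta.g lam r = MvPolynomial.eval (ComplexBeta.realCoords lam r) p /
          MvPolynomial.eval (ComplexBeta.realCoords lam r) q) ∧
    -- growth of `g` in each eigenvalue
    (∀ lam r : Fin (m + 1) → ℂ, ComplexBeta.Admissible lam r → ∀ j,
      (fun z : ℂ => ComplexBeta.g (Function.update lam j z) r)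
        =O[Bornology.cobounded ℂ] fun z : ℂ => ‖z‖ ^ 4) ∧
    -- rotation invariance
    (∀ (φ : ℝ) (lam r : Fin (m + 1) → ℂ),
      ComplexBeta.g (fun j => lam j * Complex.exp ((φ : ℂ) * Complex.I)) r =
        ComplexBeta.g lam r) := by
  refine ⟨fun a b lam hb hlam hl => ?_, fun a b lam r hb hs => ComplexBeta.reconstruct_eq hb hs,
    fun lam hlam => ComplexBeta.ae_admissible hlam,
    fun lam hlam => ComplexBeta.integrable_fIntegrand hlam hβ,
    ⟨ComplexBeta.partitionFunction β m, ComplexBeta.partitionFunction_pos hβ m,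
      fun P _ a b h => ComplexBeta.isEigenvalueDensity_jpdf hβ h⟩,
    fun lam r h => ComplexBeta.g_nonneg_and_eq_zero_iff h, ComplexBeta.isRational_g,
    fun lam r h j => ComplexBeta.isBigO_g h.nonDegenerate j, fun φ lam r =>
      ComplexBeta.g_mul lam r (Complex.norm_exp_ofReal_mul_I φ)⟩
  obtain ⟨r, hr⟩ := ComplexBeta.exists_isSpectralData hb hlam hl
  exact ⟨r, hr, fun r' hr' => ComplexBeta.isSpectralData_unique hb hr' hr⟩
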